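/- **Connectives.** For partitions $p,q$ of $\{1,\dots,n\}$ the meeting graph is the multigraph whose vertices are the classes of $p$ and the classes of $q$ and in which every number $i$ is an edge between its class in $p$ and its class in $q$; $p\perp q$ means that it is connected and acyclic (parallel edges form a cycle). For a set $P$ of partitions, $P^{\perp}=\{q\mid \forall p\in P,\ p\perp q\}$. A dual pair of $n$-ary generalized connectives $(\mathcal C,\mathcal C^*)$ is a pair of non-empty sets $P_{\mathcal C},P_{\mathcal C^*}$ of partitions of $\{1,\dots,n\}$ with $P_{\mathcal C}^{\perp}=P_{\mathcal C^*}$ and $P_{\mathcal C^*}^{\perp}=P_{\mathcal C}$. The $n$-ary par $\wp^n$ has $P=\{\{(1,\dots,n)\}\}$ and the $n$-ary tensor $\otimes^n$ has $P=\{\{(1),\dots,(n)\}\}$. **Language.** Let $L$ be a family of dual pairs of generalized connectives that contains the pair of binary par and binary tensor. Formulas are built from the atoms $P$, $\sim P$ by the connectives of $L$, with $\sim\sim P=P$ and $\sim\mathcal C(A_1,\dots,A_n)=\mathcal C^*(\sim A_1,\dots,\sim A_n)$. Proofs are built from axioms $\vdash A,\sim A$ ($A$ any formula), the cut rule, and,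 for each connective $\mathcal C$ and each $p\in P_{\mathcal C}$, the rule with one premise $\vdash\Gamma_x,(A_j)_{j\in x}$ for each class $x$ of $p$ and with conclusion $\vdash(\Gamma_x)_x,\mathcal C(A_1,\dots,A_n)$. A proof-structure is a non-empty finite set of formula occurrences with axiom links (no premise; conclusions $A,\sim A$), cut links (premises $A,\sim A$; no conclusion) and $\mathcal C$-links (premises $A_1,\dots,A_n$; conclusion $\mathcal C(A_1,\dots,A_n)$), such that each occurrence is a conclusion of exactly one link and a premise of at most one. It is sequentializable if it is the translation of a proof, where axioms become axiom links and each other rule adds its link to the disjoint union of the structures of its premises. **Switchings.** A switching $f$ for $L$ assigns to every connective of $L$, of arity $n$ say, a set of positions; a position is a partition of the $n$ premises and the conclusion of a link, which says which of them the link joins. For a choice $I$ of a position for each $\mathcal C$-link of a proof-structure $\mathcal S$, the graph $\mathcal S_I$ is obtained from the formula occurrences by joining the two conclusions of each axiom link, joining the two premises of each cut link, and, at each $\mathcal C$-link, connecting the members of each class of the chosen position to a new vertex for that class. $\mathcal S$ is correct for $f$ if $\mathcal S_I$ is connected and acyclic for every $I$. For example, "keep the edges to the conclusion from the premises in $T$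 and delete the other edges" is the position whose classes are $T\cup\{\text{conclusion}\}$ and singletons; choosing for $T$ one element of each class of some $p\in P_{\mathcal C}$ gives the partition switching, whereas joining each class of $p$ and connecting one chosen class to the conclusion gives the Danos–Regnier switching. * $f$ has the *expansion property* if for every connective $\mathcal C$ of $L$ (with $\mathcal C$ and $\mathcal C^*$ both counted) and all formulas $A_1,\dots,A_n$, the proof-structure with terminal formulas $\mathcal C(A_1,\dots,A_n)$ and $\mathcal C^*(\sim A_1,\dots,\sim A_n)$, consisting of one $\mathcal C$-link, one $\mathcal C^*$-link and the axiom links $A_j,\sim A_j$, is correct for $f$. * $f$ satisfies the *sequentialization theorem* if every proof-structure that is correct for $f$ is sequentializable. * $f$ is the *$n$-ary par-switching* if every connective of $L$ is some $\wp^n$ or some $\otimes^n$, the positions of $\wp^n$ are those that keep the edge from exactly one premise to the conclusion, for each of the $n$ premises, and the only position of $\otimes^n$ keeps all edges. **Proposition.** A switching $f$ for $L$ satisfies both the expansion property and the sequentialization theorem if and only if $f$ is the $n$-ary par-switching. In particular, if $L$ contains a connective that is neither a $\wp^n$ nor a $\otimes^n$, then no switching for $L$ satisfies both. -/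

import Mathlib

namespace GMLL

/-! ### Trees of incidences -/

/-- The bipartite graph of a relation. A multigraph or hypergraph with vertex set `α`, edge set `β`
and incidence relation `inc` is connected and acyclic (parallel edges counting as a cycle) exactly
when this graph, in which every edge carries a node of its own, is a tree. -/
def incidenceGraph {α β : Type*} (inc : α → β → Prop) : SimpleGraph (α ⊕ β) where
  Adj
    | .inl a, .inr b => inc a b
    | .inr b, .inl a => inc a b
    | _, _ => False
  symm := ⟨by rintro (a | b) (a' | b') h <;> exact h⟩
  loopless := ⟨by rintro (a | b) h <;> exact h⟩

/-! ### Generalized connectives -/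

/-- The meeting graph of two partitions `p`, `q` of `{1, …, n}`: the vertices are the classes of `p`
and the classes of `q`, and every number `i` is an edge between its class in `p` and its class
in `q`. It is drawn here with a node for each edge, so that parallel edges are kept apart. -/
def meetingGraph {n : ℕ} (p q : Setoid (Fin n)) :
    SimpleGraph (Fin n ⊕ (Quotient p ⊕ Quotient q)) :=
  incidenceGraph fun i x =>
    Sum.elim (fun a => Quotient.mk p i = a) (fun b => Quotient.mk q i = b) x

/-- Two partitions are orthogonal if their meeting graph is connected and acyclic. -/
def Orthogonal {n : ℕ} (p q : Setoid (Fin n)) : Prop :=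
  (meetingGraph p q).IsTree

/-- The set of all partitions that are orthogonal to every member of `P`. -/
def orthogonalSet {n : ℕ} (P : Set (Setoid (Fin n))) : Set (Setoid (Fin n)) :=
  {q | ∀ p ∈ P, Orthogonal p q}

/-- A pair `(C, C*)` of dual generalized connectives: `rules true` is the partition set of `C`,
`rules false` that of `C*`. -/
structure ConnectivePair where
  arity : ℕ
  rules : Bool → Set (Setoid (Fin arity))
  rules_nonempty : ∀ b, (rules b).Nonempty
  rules_dual : ∀ b, orthogonalSet (rules b) = rules (!b)

/-- The connective is the `n`-ary par: its only partition has a single class. -/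
def ConnectivePair.IsPar (C : ConnectivePair) (b : Bool) : Prop :=
  C.rules b = {⊤}

/-- The connective is the `n`-ary tensor: its only partition is the one into singletons. -/
def ConnectivePair.IsTensor (C : ConnectivePair) (b : Bool) : Prop :=
  C.rules b = {⊥}

/-! ### Formulas and sequent calculus

The language is given by a family `L` of pairs of dual connectives; the connective `(i, true)` is
the first member of the `i`-th pair, and `(i, false)` is its dual. -/

inductive Formula {ι : Type*} (L : ι → ConnectivePair)
  /-- `atom k true` is the `k`-th propositional variable, `atom k false` its negation. -/
  | atom (k : ℕ) (b : Bool) : Formula L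
  | conn (i : ι) (b : Bool) (A : Fin (L i).arity → Formula L) : Formula L

/-- The dual formula. -/
def Formula.neg {ι : Type*} {L : ι → ConnectivePair} : Formula L → Formula L
  | .atom k b => .atom k (!b)
  | .conn i b A => .conn i (!b) fun j => (A j).neg

open Classical in
/-- Proofs of a sequent (a multiset of formulas): axioms `⊢ A, ∼A` for arbitrary formulas, cut, and
for each connective and each partition `p` of it the introduction rule with one premise
`⊢ Γₓ, (Aⱼ)_{j ∈ x}` for each class `x` of `p`. -/
inductive Proof {ι : Type*} (L : ι → ConnectivePair) : Multiset (Formula L) → Type _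
  | ax (A : Formula L) : Proof L {A, A.neg}
  | cut (A : Formula L) (Γ Δ : Multiset (Formula L))
      (π₁ : Proof L (A ::ₘ Γ)) (π₂ : Proof L (A.neg ::ₘ Δ)) : Proof L (Γ + Δ)
  | conn (i : ι) (b : Bool) (p : Setoid (Fin (L i).arity)) (hp : p ∈ (L i).rules b)
      (A : Fin (L i).arity → Formula L) (Γ : Quotient p → Multiset (Formula L))
      (π : ∀ x : Quotient p, Proof L
        ((Finset.univ.filter fun j => Quotient.mk p j = x).val.map A + Γ x)) :
      Proof L (Formula.conn i b A ::ₘ ∑ x, Γ x)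

/-! ### Proof-structures -/

/-- Links between formula occurrences (elements of `V`). -/
inductive Link {ι : Type*} (L : ι → ConnectivePair) (V : Type)
  | ax (u v : V) : Link L V
  | cut (u v : V) : Link L V
  | conn (i : ι) (b : Bool) (prem : Fin (L i).arity → V) (concl : V) : Link L V

/-- The premises of a link, in order. -/
def Link.premises {ι : Type*} {L : ι → ConnectivePair} {V : Type} : Link L V → List V
  | .ax _ _ => []
  | .cut u v => [u, v]
  | .conn _ _ prem _ => List.ofFn prem

/-- The conclusions of a link, in order. -/
def Link.conclusions {ι : Type*} {L : ι → ConnectivePair} {V : Type} : Link L V → List V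
  | .ax u v => [u, v]
  | .cut _ _ => []
  | .conn _ _ _ c => [c]

/-- The labels of the premises and conclusions of a link fit together. -/
def Link.WellLabelled {ι : Type*} {L : ι → ConnectivePair} {V : Type} (label : V → Formula L) :
    Link L V → Prop
  | .ax u v => label v = (label u).neg
  | .cut u v => label v = (label u).neg
  | .conn i b prem c => label c = Formula.conn i b fun j => label (prem j)

/-- A proof-structure: a nonempty finite set of labelled formula occurrences with links, such that
every occurrence is the conclusion of exactly one link and the premise of at most one link. -/
structure ProofStructure {ι : Type*} (L : ι → ConnectivePair) where
  V : Type
  finite : Finite V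
  nonempty : Nonempty V
  label : V → Formula L
  links : Set (Link L V)
  wellLabelled : ∀ l ∈ links, l.WellLabelled label
  nodup_premises : ∀ l ∈ links, l.premises.Nodup
  nodup_conclusions : ∀ l ∈ links, l.conclusions.Nodup
  existsUnique_conclusion : ∀ v, ∃! l, l ∈ links ∧ v ∈ l.conclusions
  unique_premise : ∀ l ∈ links, ∀ l' ∈ links, ∀ v, v ∈ l.premises → v ∈ l'.premises → l = l'

/-! ### Translation of proofs and sequentializability -/

/-- `π.TranslatesTo S N Λ`: the part of `S` with formula occurrences `N` and links `Λ` is the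
proof-structure of the proof `π`, obtained by recursion on `π`: an axiom becomes an axiom link, and
a rule adds its link below the disjoint union of the structures of its subproofs, attached to
terminal occurrences of the active formulas. -/
def Proof.TranslatesTo {ι : Type*} {L : ι → ConnectivePair} (S : ProofStructure L) :
    {Γ : Multiset (Formula L)} → Proof L Γ → Set S.V → Set (Link L S.V) → Prop
  | _, .ax A, N, Λ =>
      ∃ u v, u ≠ v ∧ S.label u = A ∧ S.label v = A.neg ∧ N = {u, v} ∧ Λ = {Link.ax u v}
  | _, .cut A _ _ π₁ π₂, N, Λ =>
      ∃ (N₁ N₂ : Set S.V) (Λ₁ Λ₂ : Set (Link L S.V)) (u v : S.V),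
        π₁.TranslatesTo S N₁ Λ₁ ∧ π₂.TranslatesTo S N₂ Λ₂ ∧ Disjoint N₁ N₂ ∧
        u ∈ N₁ ∧ (∀ l ∈ Λ₁, u ∉ l.premises) ∧ S.label u = A ∧
        v ∈ N₂ ∧ (∀ l ∈ Λ₂, v ∉ l.premises) ∧ S.label v = A.neg ∧
        N = N₁ ∪ N₂ ∧ Λ = insert (Link.cut u v) (Λ₁ ∪ Λ₂)
  | _, .conn i b p _ A _ π, N, Λ =>
      ∃ (N' : Quotient p → Set S.V) (Λ' : Quotient p → Set (Link L S.V))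
        (prem : Fin (L i).arity → S.V) (c : S.V),
        (∀ x, (π x).TranslatesTo S (N' x) (Λ' x)) ∧ (∀ x y, x ≠ y → Disjoint (N' x) (N' y)) ∧
        Function.Injective prem ∧
        (∀ j, prem j ∈ N' (Quotient.mk p j) ∧
          (∀ l ∈ Λ' (Quotient.mk p j), prem j ∉ l.premises) ∧ S.label (prem j) = A j) ∧
        (∀ x, c ∉ N' x) ∧ S.label c = Formula.conn i b A ∧
        N = insert c (⋃ x, N' x) ∧ Λ = insert (Link.conn i b prem c) (⋃ x, Λ' x)

/-- `S` is the proof-structure of some proof. -/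
def ProofStructure.Sequentializable {ι : Type*} {L : ι → ConnectivePair}
    (S : ProofStructure L) : Prop :=
  ∃ (Γ : Multiset (Formula L)) (π : Proof L Γ), π.TranslatesTo S Set.univ S.links

/-! ### Switchings and correctness -/

/-- A position of an `n`-ary link under a switching: a partition of its premises `some j` and its
conclusion `none`, recording which of them the link leaves joined in the correctness graph. -/
abbrev Position (n : ℕ) := Setoid (Option (Fin n))

/-- A switching for the connectives of `L`: it gives for every connective the positions that may be
chosen at a link of that connective. -/
def Switching {ι : Type*} (L : ι → ConnectivePair) :=
  ∀ (i : ι) (_ : Bool), Set (Position (L i).arity)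

/-- The position that keeps the edges from the premises in `T` to the conclusion and deletes the
edges from the other premises. -/
@[reducible] def keep {n : ℕ} (T : Set (Fin n)) : Position n where
  r o o' := o = o' ∨ (o ∈ insert none (some '' T) ∧ o' ∈ insert none (some '' T))
  iseqv :=
    { refl := fun _ => Or.inl rfl
      symm := by
        rintro x y (h | h)
        · exact Or.inl h.symm
        · exact Or.inr ⟨h.2, h.1⟩
      trans := by
        rintro x y z (rfl | h) (rfl | h')
        · exact Or.inl rfl
        · exact Or.inr h'
        · exact Or.inr h
        · exact Or.inr ⟨h.1, h'.2⟩ }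

/-- First example of a switching, the partition switching: choose a partition `p` of the connective
and keep the edges from exactly one premise of each class of `p`. -/
def partitionSwitching {ι : Type*} (L : ι → ConnectivePair) : Switching L := fun i b =>
  {P | ∃ p ∈ (L i).rules b, ∃ T : Set (Fin (L i).arity),
    (∀ x : Quotient p, ∃! j, j ∈ T ∧ Quotient.mk p j = x) ∧ P = keep T}

/-- Second example, the Danos-Regnier switching: choose a partition `p` of the connective, join the
premises in each class of `p`, and join the conclusion to one chosen class `x`. -/
def danosRegnierSwitching {ι : Type*} (L : ι → ConnectivePair) : Switching L := fun i b =>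
  {P | ∃ p ∈ (L i).rules b, ∃ x : Quotient p,
    P = Setoid.ker fun o : Option (Fin (L i).arity) => o.elim x (Quotient.mk p)}

/-- The possible states of a link: sets of groups of formula occurrences, each group being joined
by the link. Axiom and cut links have one state; a link of a connective has one for each position
that the switching allows. -/
def Link.states {ι : Type*} {L : ι → ConnectivePair} {V : Type} (f : Switching L) :
    Link L V → Set (Set (Set V))
  | .ax u v => {{{u, v}}}
  | .cut u v => {{{u, v}}}
  | .conn i b prem c =>
      {J | ∃ P ∈ f i b, J = (fun B => (fun o : Option _ => o.elim c prem) '' B) '' P.classes}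

/-- The correctness graph `S_I` for a choice `I` of a state of each link: every group that a link
joins has a node of its own, adjacent to the occurrences in the group. (A group `{u, v}` is thus an
edge `u — v` with a node in its middle, and a group `{u}` is a leaf attached to `u`.) -/
def ProofStructure.correctnessGraph {ι : Type*} {L : ι → ConnectivePair} (S : ProofStructure L)
    (I : S.links → Set (Set S.V)) : SimpleGraph (S.V ⊕ (Σ l : S.links, I l)) :=
  incidenceGraph fun v g => v ∈ (g.2 : Set S.V)

/-- `S` is a proof-net in the sense of `f`: all its correctness graphs are connected and acyclic. -/
def ProofStructure.Correct {ι : Type*} {L : ι → ConnectivePair} (f : Switching L)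
    (S : ProofStructure L) : Prop :=
  ∀ I : S.links → Set (Set S.V), (∀ l, I l ∈ l.1.states f) → (S.correctnessGraph I).IsTree

/-! ### The two properties and the par-switching -/

/-- The proof-structure with the two terminal formulas `C(A₁, …, Aₙ)` and `C*(∼A₁, …, ∼Aₙ)`, where
`C` is the connective `(i, b)`: a `C`-link and a `C*`-link whose `j`-th premises `Aⱼ`, `∼Aⱼ` are
joined by an axiom link. Occurrences on the `C`-side are tagged `true`; `none` is the conclusion. -/
def excludedMiddle {ι : Type*} (L : ι → ConnectivePair) (i : ι) (b : Bool)
    (A : Fin (L i).arity → Formula L) : ProofStructure L where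
  V := Bool × Option (Fin (L i).arity)
  finite := inferInstance
  nonempty := inferInstance
  label
    | (true, some j) => A j
    | (false, some j) => (A j).neg
    | (true, none) => Formula.conn i b A
    | (false, none) => Formula.conn i (!b) fun j => (A j).neg
  links :=
    {l | (∃ j, l = Link.ax (true, some j) (false, some j)) ∨
      l = Link.conn i b (fun j => (true, some j)) (true, none) ∨
      l = Link.conn i (!b) (fun j => (false, some j)) (false, none)}
  wellLabelled := by
    rintro l (⟨j, rfl⟩ | rfl | rfl) <;> rfl
  nodup_premises := by
    rintro l (⟨j, rfl⟩ | rfl | rfl)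
    · simp [Link.premises]
    · exact List.nodup_ofFn.2 fun j j' h => by simpa using h
    · exact List.nodup_ofFn.2 fun j j' h => by simpa using h
  nodup_conclusions := by
    rintro l (⟨j, rfl⟩ | rfl | rfl) <;> simp [Link.conclusions]
  existsUnique_conclusion := by
    rintro ⟨_ | _, _ | j⟩
    · refine ⟨_, ⟨Or.inr (Or.inr rfl), by simp [Link.conclusions]⟩, ?_⟩
      rintro l ⟨⟨j, rfl⟩ | rfl | rfl, h⟩ <;> simp_all [Link.conclusions]
    · refine ⟨_, ⟨Or.inl ⟨j, rfl⟩, by simp [Link.conclusions]⟩, ?_⟩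
      rintro l ⟨⟨j, rfl⟩ | rfl | rfl, h⟩ <;> simp_all [Link.conclusions]
    · refine ⟨_, ⟨Or.inr (Or.inl rfl), by simp [Link.conclusions]⟩, ?_⟩
      rintro l ⟨⟨j, rfl⟩ | rfl | rfl, h⟩ <;> simp_all [Link.conclusions]
    · refine ⟨_, ⟨Or.inl ⟨j, rfl⟩, by simp [Link.conclusions]⟩, ?_⟩
      rintro l ⟨⟨j, rfl⟩ | rfl | rfl, h⟩ <;> simp_all [Link.conclusions]
  unique_premise := by
    rintro l (⟨j, rfl⟩ | rfl | rfl) l' (⟨j', rfl⟩ | rfl | rfl) v h h' <;>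
      simp only [Link.premises, List.mem_ofFn, List.not_mem_nil] at h h' <;> first
        | rfl
        | (obtain ⟨k, rfl⟩ := h; obtain ⟨k', hk⟩ := h'; simp at hk)

/-- The expansion property: every excluded-middle formula has a correct proof-structure. -/
def ExpansionProperty {ι : Type*} {L : ι → ConnectivePair} (f : Switching L) : Prop :=
  ∀ (i : ι) (b : Bool) (A : Fin (L i).arity → Formula L), (excludedMiddle L i b A).Correct f

/-- The sequentialization theorem: every proof-net in the sense of `f` is sequentializable. -/
def SequentializationTheorem {ι : Type*} {L : ι → ConnectivePair} (f : Switching L) : Prop :=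
  ∀ S : ProofStructure L, S.Correct f → S.Sequentializable

/-- `f` is the `n`-ary par-switching: all connectives are `n`-ary pars and `n`-ary tensors, at a
par link exactly one premise is chosen and the edges from the others are deleted, and at a tensor
link no edge is deleted. -/
def IsParSwitching {ι : Type*} {L : ι → ConnectivePair} (f : Switching L) : Prop :=
  ∀ (i : ι) (b : Bool),
    ((L i).IsPar b ∧ f i b = {P | ∃ j, P = keep {j}}) ∨
    ((L i).IsTensor b ∧ f i b = {keep Set.univ})

end GMLL

namespace GMLL

/-! ### Trees of incidences in terms of sets of vertices -/

/-! Correctness is treated through sets of occurrences instead of paths. An incidence graph is a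
tree when every set of vertices that no edge cuts is empty or everything, and every incidence is a
bridge, witnessed by the set of vertices on its side (`incidenceGraph_isTree_iff`). Correctness is
thus proved by exhibiting separating sets. Sequentializability is refuted by exhibiting a proper
nonempty set that no link cuts: once one premise is chosen at each par link, with all other
connectives joining all their premises to the conclusion, the structure of a proof is connected
(`Proof.TranslatesTo.connected`).

Both properties force the par-switching. An excluded middle is correct iff any position of the
connective and any position of its dual, glued along the premises, give a tree
(`excludedMiddle_correct_iff`). It is then sequentializable, and its last rule must introduce one of
the two connectives; the axiom links and the other link hold all the premises together, so that
connective has the partition with a single class and is a par, and its dual is a tensor. A position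
`Q` of a tensor must join everything: otherwise its classes can be imitated above the dual par, by
bare axiom links (`singleLink`) if `Q` joins no two premises, and by paths of binary tensors
(`chain`) in general. The result is correct because `Q` glues with all positions of the par, but it
is not sequentializable. The first construction settles the binary tensor, which the second one
uses. Gluing with the full position then forces each position of a par to keep exactly one premise.
Every premise `j` occurs, because the structure `detour` goes wrong only when the par is switched to
`j`; the same structure shows that the sets of positions are not empty.

Conversely, the par-switching has the expansion property by an explicit gluing (`glue_keep_top`).
For sequentialization, disjoint sub-proofs ("boxes") grow from the axiom links by absorbing ready
links. Suppose that none is ready although some occurrence is unboxed. Among all choices of premises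
and all unboxed occurrences, take a smallest part `Y` of a correctness graph above an unboxed `c`.
Minimality makes the premises of the link of `c` boxed; as this link is not ready, it is a par with
premises in different boxes. Switch it to a premise in a box `β`, and let `k₁` be a premise outside
`β`. The graph can leave `β` inside `Y` only through pars whose chosen premise lies in `β`. If `k₁`
is above all of these, it is disconnected from `c`; if it is not above one of them, switching the
link of `c` to `k₁` gives a smaller part above the conclusion of that par (`Upper.exists_smaller`).
When all occurrences are boxed, the cuts that are left are ready, and connectedness leaves a single
box in the end. -/

/-- An incidence graph without empty edges is a tree if and only if every set of vertices that is a
union of connected pieces is trivial, and every vertex of an edge can be separated from the other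
vertices of this edge by a set that cuts no other edge. -/
theorem incidenceGraph_isTree_iff {α β : Type*} [Nonempty α] (inc : α → β → Prop)
    (hne : ∀ b, ∃ a, inc a b) :
    (incidenceGraph inc).IsTree ↔
      (∀ X : Set α, (∀ b a a', inc a b → inc a' b → a ∈ X → a' ∈ X) →
        ∀ a a', a ∈ X → a' ∈ X) ∧
      ∀ a b, inc a b → ∃ X : Set α, a ∈ X ∧ (∀ a', inc a' b → a' ≠ a → a' ∉ X) ∧
        ∀ b' a₁ a₂, b' ≠ b → inc a₁ b' → inc a₂ b' → a₁ ∈ X → a₂ ∈ X := by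
  have key : ∀ (G : SimpleGraph (α ⊕ β)) (Y : α ⊕ β → Prop),
      (∀ x y, G.Adj x y → Y x → Y y) → ∀ x y, G.Reachable x y → Y x → Y y := by
    rintro G Y hY x y ⟨w⟩
    induction w with
    | nil => exact id
    | cons h _ ih => exact fun hx => ih (hY _ _ h hx)
  constructor
  · intro hT
    refine ⟨fun X hX a a' ha => ?_, fun a b hab => ?_⟩
    · refine key _ (Sum.elim (· ∈ X) fun b => ∃ a, inc a b ∧ a ∈ X) ?_ (.inl a) (.inl a')
        (hT.connected.preconnected _ _) ha
      rintro (x | x) (y | y) h hx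
      · exact h.elim
      · exact ⟨x, h, hx⟩
      · obtain ⟨a, ha, haX⟩ := hx
        exact hX x a y ha h haX
      · exact h.elim
    · have hb := SimpleGraph.isAcyclic_iff_forall_adj_isBridge.1 hT.isAcyclic
        (show (incidenceGraph inc).Adj (.inl a) (.inr b) from hab)
      rw [SimpleGraph.isBridge_iff] at hb
      have hadj : ∀ a' b', inc a' b' → ¬ (a' = a ∧ b' = b) →
          ((incidenceGraph inc).deleteEdges {s(.inl a, .inr b)}).Adj (.inl a') (.inr b') := by
        intro a' b' h hne
        rw [SimpleGraph.deleteEdges_adj]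
        refine ⟨h, ?_⟩
        simpa using hne
      -- The witness is what remains reachable from `a` after the incidence of `a` and `b` is
      -- deleted.
      refine ⟨{a' | ((incidenceGraph inc).deleteEdges {s(.inl a, .inr b)}).Reachable
        (.inl a) (.inl a')}, SimpleGraph.Reachable.refl _, ?_, ?_⟩
      · intro a' ha' hne hX
        exact hb (SimpleGraph.Reachable.trans hX (hadj a' b ha' (by tauto)).reachable)
      · intro b' a₁ a₂ hb' h₁ h₂ hX
        exact (SimpleGraph.Reachable.trans hX (hadj a₁ b' h₁ (by tauto)).reachable).trans
          (hadj a₂ b' h₂ (by tauto)).symm.reachable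
  · rintro ⟨hc, ha⟩
    have hreach : ∀ a a', (incidenceGraph inc).Reachable (.inl a) (.inl a') := by
      intro a a'
      refine hc {a' | (incidenceGraph inc).Reachable (.inl a) (.inl a')} ?_ a a'
        (SimpleGraph.Reachable.refl _)
      intro b a₁ a₂ h₁ h₂ hX
      have h₁' : (incidenceGraph inc).Adj (.inl a₁) (.inr b) := h₁
      have h₂' : (incidenceGraph inc).Adj (.inr b) (.inl a₂) := h₂
      exact (SimpleGraph.Reachable.trans hX h₁'.reachable).trans h₂'.reachable
    have hrep : ∀ x, ∃ a, (incidenceGraph inc).Reachable x (.inl a) := by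
      rintro (a | b)
      · exact ⟨a, SimpleGraph.Reachable.refl _⟩
      · obtain ⟨a, h⟩ := hne b
        have h' : (incidenceGraph inc).Adj (.inr b) (.inl a) := h
        exact ⟨a, h'.reachable⟩
    refine ⟨⟨fun x y => ?_⟩, ?_⟩
    · obtain ⟨a, hx⟩ := hrep x
      obtain ⟨a', hy⟩ := hrep y
      exact (hx.trans (hreach a a')).trans hy.symm
    · have hbr : ∀ a b, inc a b → (incidenceGraph inc).IsBridge s(.inl a, .inr b) := by
        intro a b hab
        obtain ⟨X, haX, hX, hX'⟩ := ha a b hab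
        rw [SimpleGraph.isBridge_iff]
        intro hr
        -- `X` together with the nodes of the edges other than `b` that meet it is closed in the
        -- graph without the incidence, and it excludes the node of `b`.
        refine (key _ (Sum.elim (· ∈ X) fun b' => b' ≠ b ∧ ∃ a, inc a b' ∧ a ∈ X) ?_ _ _ hr
          haX).1 rfl
        rintro (x | x) (y | y) h hx <;> rw [SimpleGraph.deleteEdges_adj] at h
        · exact h.1.elim
        · have h1 : inc x y := h.1
          have hyb : y ≠ b := by
            rintro rfl
            by_cases hxa : x = a
            · subst hxa
              exact h.2 rfl
            · exact hX x h1 hxa hx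
          exact ⟨hyb, x, h1, hx⟩
        · obtain ⟨hxb, a', h', haX'⟩ := hx
          exact hX' x a' y hxb h' h.1 haX'
        · exact h.1.elim
      rw [SimpleGraph.isAcyclic_iff_forall_adj_isBridge]
      rintro (x | x) (y | y) h
      · exact h.elim
      · exact hbr x y h
      · rw [Sym2.eq_swap]
        exact hbr y x h
      · exact h.elim

/-- The set `X` cuts none of the groups in `J`. -/
def Respects {V : Type*} (X : Set V) (J : Set (Set V)) : Prop :=
  ∀ B ∈ J, ∀ u ∈ B, ∀ v ∈ B, u ∈ X → v ∈ X

/-- Some set of occurrences contains only `v` from the group `B` of the link `l` and cuts no other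
group. -/
abbrev Separable {ι : Type*} {L : ι → ConnectivePair} (S : ProofStructure L)
    (J : Link L S.V → Set (Set S.V)) (l : Link L S.V) (B : Set S.V) (v : S.V) : Prop :=
  ∃ X : Set S.V, v ∈ X ∧ (∀ u ∈ B, u ≠ v → u ∉ X) ∧ Respects X (J l \ {B}) ∧
    ∀ l' ∈ S.links, l' ≠ l → Respects X (J l')

/-- The correctness graph for the states `J` is a tree, in terms of sets of occurrences. -/
structure TreeLike {ι : Type*} {L : ι → ConnectivePair} (S : ProofStructure L)
    (J : Link L S.V → Set (Set S.V)) : Prop where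
  conn : ∀ X : Set S.V, (∀ l ∈ S.links, Respects X (J l)) → ∀ u v, u ∈ X → v ∈ X
  acyc : ∀ l ∈ S.links, ∀ B ∈ J l, ∀ v ∈ B, Separable S J l B v

/-- An empty group would be an isolated node, which sets of occurrences cannot detect. -/
theorem Link.nonempty_of_mem_states {ι : Type*} {L : ι → ConnectivePair} {V : Type}
    {f : Switching L} {l : Link L V} {J : Set (Set V)} (hJ : J ∈ l.states f) {B : Set V}
    (hB : B ∈ J) : B.Nonempty := by
  cases l with
  | ax u v =>
    rw [Set.mem_singleton_iff.1 hJ, Set.mem_singleton_iff] at hB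
    exact hB ▸ ⟨u, Or.inl rfl⟩
  | cut u v =>
    rw [Set.mem_singleton_iff.1 hJ, Set.mem_singleton_iff] at hB
    exact hB ▸ ⟨u, Or.inl rfl⟩
  | conn i b prem c =>
    obtain ⟨P, -, rfl⟩ := hJ
    obtain ⟨_, ⟨y, rfl⟩, rfl⟩ := hB
    exact ⟨_, y, P.refl' y, rfl⟩

theorem ProofStructure.correctnessGraph_isTree_iff {ι : Type*} {L : ι → ConnectivePair}
    (S : ProofStructure L) (J : Link L S.V → Set (Set S.V))
    (hJ : ∀ l ∈ S.links, ∀ B ∈ J l, B.Nonempty) :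
    (S.correctnessGraph fun l => J l).IsTree ↔ TreeLike S J := by
  have := S.nonempty
  rw [ProofStructure.correctnessGraph, incidenceGraph_isTree_iff]
  · constructor
    · rintro ⟨hc, ha⟩
      refine ⟨fun X hX => hc X ?_, fun l hl B hB v hv => ?_⟩
      · rintro ⟨l, B⟩ u v hu hv
        exact hX l l.2 B B.2 u hu v hv
      · obtain ⟨X, h1, h2, h3⟩ := ha v ⟨⟨l, hl⟩, ⟨B, hB⟩⟩ hv
        refine ⟨X, h1, h2, ?_, ?_⟩
        · rintro B' ⟨hB', hne⟩ u hu w hw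
          refine h3 ⟨⟨l, hl⟩, ⟨B', hB'⟩⟩ u w ?_ hu hw
          intro h
          simp at h
          exact hne h
        · intro l' hl' hne B' hB' u hu w hw
          refine h3 ⟨⟨l', hl'⟩, ⟨B', hB'⟩⟩ u w ?_ hu hw
          intro h
          exact hne (congrArg (fun x => x.1.1) h)
    · rintro ⟨hc, ha⟩
      refine ⟨fun X hX => hc X ?_, ?_⟩
      · intro l hl B hB u hu v hv
        exact hX ⟨⟨l, hl⟩, ⟨B, hB⟩⟩ u v hu hv
      · rintro v ⟨⟨l, hl⟩, ⟨B, hB⟩⟩ hv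
        obtain ⟨X, h1, h2, h3, h4⟩ := ha l hl B hB v hv
        refine ⟨X, h1, h2, ?_⟩
        rintro ⟨⟨l', hl'⟩, ⟨B', hB'⟩⟩ u w hne hu hw
        by_cases hll : l' = l
        · subst hll
          refine h3 B' ⟨hB', ?_⟩ u hu w hw
          rintro rfl
          exact hne rfl
        · exact h4 l' hl' hll B' hB' u hu w hw
  · rintro ⟨⟨l, hl⟩, ⟨B, hB⟩⟩
    exact hJ l hl B hB

theorem ProofStructure.correct_iff {ι : Type*} {L : ι → ConnectivePair} {f : Switching L}
    {S : ProofStructure L} :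
    S.Correct f ↔ ∀ J : Link L S.V → Set (Set S.V), (∀ l ∈ S.links, J l ∈ l.states f) →
      TreeLike S J := by
  classical
  constructor
  · intro h J hJ
    rw [← S.correctnessGraph_isTree_iff J fun l hl B hB => Link.nonempty_of_mem_states (hJ l hl) hB]
    exact h _ fun l => hJ l l.2
  · intro h I hI
    -- States of links outside `S` are never consulted, so any default value will do.
    let J : Link L S.V → Set (Set S.V) := fun l => if hl : l ∈ S.links then I ⟨l, hl⟩ else ∅
    have hJ : ∀ l ∈ S.links, J l ∈ l.states f := by
      intro l hl
      simp only [J, dif_pos hl]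
      exact hI ⟨l, hl⟩
    have := (S.correctnessGraph_isTree_iff J fun l hl B hB =>
      Link.nonempty_of_mem_states (hJ l hl) hB).2 (h J hJ)
    have hIJ : I = fun l : S.links => J l := by
      funext l
      simp [J]
    rw [hIJ]
    exact this

theorem respects_pair_iff {V : Type*} {X : Set V} {u v : V} :
    Respects X {{u, v}} ↔ (u ∈ X ↔ v ∈ X) := by
  constructor
  · intro h
    exact ⟨h _ rfl u (Or.inl rfl) v (Or.inr rfl), h _ rfl v (Or.inr rfl) u (Or.inl rfl)⟩
  · rintro h _ rfl a (rfl | rfl) b (rfl | rfl)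
    exacts [id, h.1, h.2, id]

/-- At a link with a single group `{u, v}` it is enough to separate `u` from `v`. -/
theorem separable_pair {ι : Type*} {L : ι → ConnectivePair} {S : ProofStructure L}
    {J : Link L S.V → Set (Set S.V)} {l : Link L S.V} {u v : S.V} (hJ : J l = {{u, v}})
    (h : ∃ X : Set S.V, u ∈ X ∧ v ∉ X ∧ ∀ l' ∈ S.links, l' ≠ l → Respects X (J l')) :
    ∀ B ∈ J l, ∀ w ∈ B, Separable S J l B w := by
  obtain ⟨X, hu, hv, hX⟩ := h
  rw [hJ]
  rintro _ rfl w hw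
  have hnil : ∀ Y : Set S.V, Respects Y (J l \ {{u, v}}) := by
    rw [hJ]
    rintro Y B ⟨h, h'⟩
    exact (h' h).elim
  rcases hw with rfl | rfl
  · refine ⟨X, hu, ?_, hnil X, hX⟩
    rintro _ (rfl | rfl) hne
    exacts [(hne rfl).elim, hv]
  -- Complementation exchanges the two ends.
  · refine ⟨Xᶜ, hv, ?_, hnil _, ?_⟩
    · rintro _ (rfl | rfl) hne
      exacts [fun h => h hu, (hne rfl).elim]
    · intro l' hl' hne B hB a ha b hb haX hbX
      exact haX (hX l' hl' hne B hB b hb a ha hbX)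

/-! ### Positions -/

/-- The occurrences around a link of a connective. -/
def plug {n : ℕ} {V : Type*} (prem : Fin n → V) (c : V) : Option (Fin n) → V :=
  fun o => o.elim c prem

/-- The set `x` is a union of classes of the position `P`. -/
def Position.Invariant {n : ℕ} (P : Position n) (x : Set (Option (Fin n))) : Prop :=
  ∀ o o', P o o' → o ∈ x → o' ∈ x

/-- The groups into which the position `P` joins the occurrences around a link. -/
def Position.groups {n : ℕ} {V : Type*} (P : Position n) (prem : Fin n → V) (c : V) :
    Set (Set V) :=
  (fun B => plug prem c '' B) '' P.classes

theorem Position.respects_groups_iff {n : ℕ} {V : Type*} {P : Position n} {prem : Fin n → V}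
    {c : V} {X : Set V} :
    Respects X (P.groups prem c) ↔ P.Invariant (plug prem c ⁻¹' X) := by
  constructor
  · intro h o o' ho
    exact h _ ⟨_, ⟨o', rfl⟩, rfl⟩ _ ⟨o, ho, rfl⟩ _ ⟨o', P.refl' o', rfl⟩
  · rintro h _ ⟨_, ⟨y, rfl⟩, rfl⟩ _ ⟨o, ho, rfl⟩ _ ⟨o', ho', rfl⟩
    exact h o o' (P.trans' ho (P.symm' ho'))

/-- Injectivity of `plug` makes different classes into different groups, so that removing one group
amounts to ignoring the class of `o`. -/
theorem Position.respects_diff_iff {n : ℕ} {V : Type*} {P : Position n} {prem : Fin n → V}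
    {c : V} {X : Set V} (hinj : Function.Injective (plug prem c)) (o : Option (Fin n)) :
    Respects X (P.groups prem c \ {plug prem c '' {o' | P o' o}}) ↔
      ∀ o₁ o₂, P o₁ o₂ → ¬ P o o₁ → plug prem c o₁ ∈ X → plug prem c o₂ ∈ X := by
  constructor
  · intro h o₁ o₂ h12 ho
    refine h (plug prem c '' {o' | P o' o₂}) ⟨⟨_, ⟨o₂, rfl⟩, rfl⟩, ?_⟩ _ ⟨o₁, h12, rfl⟩ _
      ⟨o₂, P.refl' o₂, rfl⟩
    intro heq
    have h1 : plug prem c o₁ ∈ plug prem c '' {o' | P o' o₂} := ⟨o₁, h12, rfl⟩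
    rw [heq] at h1
    obtain ⟨o', ho', he⟩ := h1
    rw [← hinj he] at ho
    exact ho (P.symm' ho')
  · rintro h _ ⟨⟨_, ⟨y, rfl⟩, rfl⟩, hne⟩ _ ⟨o₁, h1, rfl⟩ _ ⟨o₂, h2, rfl⟩
    refine h o₁ o₂ (P.trans' h1 (P.symm' h2)) ?_
    intro ho
    apply hne
    have hyo : P y o := P.trans' (P.symm' h1) (P.symm' ho)
    have : {x | P x y} = {x | P x o} :=
      Set.ext fun x => ⟨fun hx => P.trans' hx hyo, fun hx => P.trans' hx (P.symm' hyo)⟩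
    show plug prem c '' {x | P x y} = _
    rw [this]

/-- Separation at a link of a connective, in terms of its position. -/
theorem separable_conn_iff {ι : Type*} {L : ι → ConnectivePair} {S : ProofStructure L}
    {J : Link L S.V → Set (Set S.V)} {i : ι} {b : Bool} {prem : Fin (L i).arity → S.V} {c : S.V}
    {P : Position (L i).arity} (hinj : Function.Injective (plug prem c))
    (hJ : J (.conn i b prem c) = P.groups prem c) :
    (∀ B ∈ J (.conn i b prem c), ∀ v ∈ B, Separable S J (.conn i b prem c) B v) ↔
      ∀ o, ∃ X : Set S.V, plug prem c o ∈ X ∧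
        (∀ o', P o o' → o' ≠ o → plug prem c o' ∉ X) ∧
        (∀ o₁ o₂, P o₁ o₂ → ¬ P o o₁ → plug prem c o₁ ∈ X → plug prem c o₂ ∈ X) ∧
        ∀ l' ∈ S.links, l' ≠ .conn i b prem c → Respects X (J l') := by
  rw [hJ]
  constructor
  · intro h o
    obtain ⟨X, h1, h2, h3, h4⟩ := h (plug prem c '' {o' | P o' o}) ⟨_, ⟨o, rfl⟩, rfl⟩
      (plug prem c o) ⟨o, P.refl' o, rfl⟩
    rw [hJ, Position.respects_diff_iff hinj] at h3
    refine ⟨X, h1, fun o' ho' hne => h2 _ ⟨o', P.symm' ho', rfl⟩ fun h => hne (hinj h), h3, h4⟩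
  · rintro h _ ⟨_, ⟨y, rfl⟩, rfl⟩ _ ⟨o, ho, rfl⟩
    have hyo : {x | P x y} = {x | P x o} :=
      Set.ext fun x => ⟨fun hx => P.trans' hx (P.symm' ho), fun hx => P.trans' hx ho⟩
    obtain ⟨X, h1, h2, h3, h4⟩ := h o
    refine ⟨X, h1, ?_, ?_, h4⟩
    · rintro _ ⟨o', ho', rfl⟩ hne
      refine h2 o' (P.trans' ho (P.symm' ho')) ?_
      rintro rfl
      exact hne rfl
    · show Respects X (J _ \ {plug prem c '' {x | P x y}})
      rw [hJ, hyo, Position.respects_diff_iff hinj]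
      exact h3

theorem keep_iff {n : ℕ} {T : Set (Fin n)} {o o' : Option (Fin n)} :
    keep T o o' ↔ o = o' ∨ (o ∈ insert none (some '' T) ∧ o' ∈ insert none (some '' T)) :=
  Iff.rfl

theorem keep_univ (n : ℕ) : keep (Set.univ : Set (Fin n)) = ⊤ := by
  ext o o'
  rw [keep_iff]
  cases o <;> cases o' <;> simp

/-! ### Pars and tensors -/

/-- Two numbers in one class of `q` would be parallel edges, as they also share the only class of
`⊤`. -/
theorem eq_bot_of_orthogonal_top {n : ℕ} {q : Setoid (Fin n)} (h : Orthogonal ⊤ q) : q = ⊥ := by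
  rcases n with _ | n
  · ext a
    exact a.elim0
  rw [Orthogonal, meetingGraph, incidenceGraph_isTree_iff] at h
  · refine Setoid.ext fun a b => ⟨fun hab => ?_, fun hab => ?_⟩
    · by_contra hne
      obtain ⟨X, h1, h2, h3⟩ := h.2 a (.inr (Quotient.mk q a)) rfl
      refine h2 b (Quotient.sound (q.symm' hab)) (fun e => hne e.symm) ?_
      exact h3 (.inl (Quotient.mk ⊤ a)) a b (by simp) rfl (Quotient.sound trivial) h1
    · rw [show a = b from hab]
  · rintro (x | x) <;> obtain ⟨a, rfl⟩ := Quotient.exists_rep x <;> exact ⟨a, rfl⟩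

/-- The singleton classes are leaves, so all connections run through `q`: its classes are the
components. -/
theorem eq_top_of_orthogonal_bot {n : ℕ} {q : Setoid (Fin n)} (h : Orthogonal ⊥ q) : q = ⊤ := by
  rcases n with _ | n
  · ext a
    exact a.elim0
  rw [Orthogonal, meetingGraph, incidenceGraph_isTree_iff] at h
  · refine Setoid.ext fun a b => ⟨fun _ => trivial, fun _ => ?_⟩
    refine h.1 {x | q a x} ?_ a b (q.refl' a)
    rintro (x | x) u v hu hv hX
    · have : u = v := Quotient.exact (hu.trans hv.symm)
      exact this ▸ hX
    · exact q.trans' hX (Quotient.exact (hu.trans hv.symm))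
  · rintro (x | x) <;> obtain ⟨a, rfl⟩ := Quotient.exists_rep x <;> exact ⟨a, rfl⟩

/-- Duality leaves only `⊥` for the partitions of the dual, and there is at least one. -/
theorem ConnectivePair.isTensor_not_of_top_mem {C : ConnectivePair} {b : Bool}
    (h : ⊤ ∈ C.rules b) : C.IsTensor (!b) := by
  refine (Set.Nonempty.subset_singleton_iff (C.rules_nonempty (!b))).1 ?_
  rw [← C.rules_dual b]
  exact fun q hq => eq_bot_of_orthogonal_top (hq ⊤ h)

theorem ConnectivePair.isPar_not_of_bot_mem {C : ConnectivePair} {b : Bool}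
    (h : ⊥ ∈ C.rules b) : C.IsPar (!b) := by
  refine (Set.Nonempty.subset_singleton_iff (C.rules_nonempty (!b))).1 ?_
  rw [← C.rules_dual b]
  exact fun q hq => eq_top_of_orthogonal_bot (hq ⊥ h)

theorem ConnectivePair.IsPar.isTensor_not {C : ConnectivePair} {b : Bool} (h : C.IsPar b) :
    C.IsTensor (!b) :=
  ConnectivePair.isTensor_not_of_top_mem (by rw [show C.rules b = {⊤} from h]; rfl)

theorem ConnectivePair.IsTensor.isPar_not {C : ConnectivePair} {b : Bool} (h : C.IsTensor b) :
    C.IsPar (!b) :=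
  ConnectivePair.isPar_not_of_bot_mem (by rw [show C.rules b = {⊥} from h]; rfl)

theorem ConnectivePair.isPar_of_top_mem {C : ConnectivePair} {b : Bool}
    (h : ⊤ ∈ C.rules b) : C.IsPar b := by
  simpa using (ConnectivePair.isTensor_not_of_top_mem h).isPar_not

/-! ### Formulas and links -/

/-- A formula is not one of its own immediate subformulas. This is what keeps the conclusion of a
link apart from its premises. -/
theorem Formula.ne_conn_apply {ι : Type*} {L : ι → ConnectivePair} (F : Formula L) :
    ∀ (i : ι) (b : Bool) (A : Fin (L i).arity → Formula L) (j : Fin (L i).arity),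
      F = Formula.conn i b A → A j ≠ F := by
  induction F with
  | atom k b => rintro i b A j ⟨⟩
  | conn i b A ih =>
    rintro i' b' A' j h hj
    cases h
    exact ih j i b A j hj rfl

namespace ProofStructure

variable {ι : Type*} {L : ι → ConnectivePair} (S : ProofStructure L)

theorem prem_ne_concl {i : ι} {b : Bool} {prem : Fin (L i).arity → S.V} {c : S.V}
    (h : Link.conn i b prem c ∈ S.links) (j : Fin (L i).arity) : prem j ≠ c := by
  intro hj
  have hl : S.label c = Formula.conn i b fun j => S.label (prem j) := S.wellLabelled _ h
  exact Formula.ne_conn_apply _ i b _ j hl (congrArg S.label hj)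

theorem prem_injective {i : ι} {b : Bool} {prem : Fin (L i).arity → S.V} {c : S.V}
    (h : Link.conn i b prem c ∈ S.links) : Function.Injective prem :=
  List.nodup_ofFn.1 (S.nodup_premises _ h)

theorem plug_injective {i : ι} {b : Bool} {prem : Fin (L i).arity → S.V} {c : S.V}
    (h : Link.conn i b prem c ∈ S.links) : Function.Injective (plug prem c) := by
  rintro (_ | j) (_ | j') hjj
  · rfl
  · exact (S.prem_ne_concl h j' hjj.symm).elim
  · exact (S.prem_ne_concl h j hjj).elim
  · rw [S.prem_injective h hjj]

end ProofStructure

section Links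

variable {ι : Type*} {L : ι → ConnectivePair} {V : Type}

theorem Link.mem_premises_conn {i : ι} {b : Bool} {prem : Fin (L i).arity → V} {c v : V} :
    v ∈ (Link.conn i b prem c : Link L V).premises ↔ ∃ j, prem j = v := by
  simp [Link.premises, List.mem_ofFn]

theorem Link.mem_premises_cut {u w v : V} :
    v ∈ (Link.cut u w : Link L V).premises ↔ v = u ∨ v = w := by
  simp [Link.premises]

theorem Link.mem_conclusions_conn {i : ι} {b : Bool} {prem : Fin (L i).arity → V} {c v : V} :
    v ∈ (Link.conn i b prem c : Link L V).conclusions ↔ v = c := by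
  simp [Link.conclusions]

theorem Link.mem_conclusions_ax {u w v : V} :
    v ∈ (Link.ax u w : Link L V).conclusions ↔ v = u ∨ v = w := by
  simp [Link.conclusions]

theorem Link.conn_ne_conn {i i' : ι} {b b' : Bool} {prem : Fin (L i).arity → V}
    {prem' : Fin (L i').arity → V} {c c' : V} (h : c ≠ c') :
    (Link.conn i b prem c : Link L V) ≠ Link.conn i' b' prem' c' := by
  intro he
  injection he with _ _ _ he
  exact h he

end Links

/-- `l.Joined I v`: the link `l` joins `v` to other occurrences, when `I l` is the premise that is
chosen at a par link `l`. -/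
def Link.Joined {ι : Type*} {L : ι → ConnectivePair} {V : Type} (I : Link L V → V) :
    Link L V → V → Prop
  | .ax u w, v => v = u ∨ v = w
  | .cut u w, v => v = u ∨ v = w
  | .conn i b prem c, v =>
      v = c ∨ (v ∈ Set.range prem ∧ ((L i).IsPar b → v = I (.conn i b prem c)))

/-- The set `X` does not cut the group of occurrences joined by `l`. -/
def Link.Uncut {ι : Type*} {L : ι → ConnectivePair} {V : Type} (I : Link L V → V)
    (X : Set V) (l : Link L V) : Prop :=
  ∀ u v, l.Joined I u → l.Joined I v → u ∈ X → v ∈ X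

/-- The function `I` chooses a premise of every par link in `Λ`. -/
def IsChoice {ι : Type*} {L : ι → ConnectivePair} {V : Type} (Λ : Set (Link L V))
    (I : Link L V → V) : Prop :=
  ∀ i b prem c, Link.conn i b prem c ∈ Λ → (L i).IsPar b →
    I (.conn i b prem c) ∈ Set.range prem

theorem Proof.TranslatesTo.mem {ι : Type*} {L : ι → ConnectivePair} {S : ProofStructure L}
    {Γ : Multiset (Formula L)} {π : Proof L Γ} {N : Set S.V} {Λ : Set (Link L S.V)}
    (h : π.TranslatesTo S N Λ) :
    ∀ l ∈ Λ, (∀ v ∈ l.premises, v ∈ N) ∧ ∀ v ∈ l.conclusions, v ∈ N := by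
  induction π generalizing N Λ with
  | ax A =>
    obtain ⟨u, v, -, -, -, rfl, rfl⟩ := h
    rintro l rfl
    simp [Link.premises, Link.conclusions]
  | cut A Γ Δ π₁ π₂ ih₁ ih₂ =>
    obtain ⟨N₁, N₂, Λ₁, Λ₂, u, v, h₁, h₂, -, hu, -, -, hv, -, -, rfl, rfl⟩ := h
    rintro l (rfl | hl | hl)
    · simp [Link.premises, Link.conclusions, hu, hv]
    · exact ⟨fun w hw => Or.inl ((ih₁ h₁ l hl).1 w hw), fun w hw => Or.inl ((ih₁ h₁ l hl).2 w hw)⟩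
    · exact ⟨fun w hw => Or.inr ((ih₂ h₂ l hl).1 w hw), fun w hw => Or.inr ((ih₂ h₂ l hl).2 w hw)⟩
  | conn i b p hp A Γ π ih =>
    obtain ⟨N', Λ', prem, c, hπ, -, -, hprem, -, -, rfl, rfl⟩ := h
    rintro l (rfl | hl)
    · simp only [Link.premises, Link.conclusions, List.mem_ofFn, List.mem_singleton]
      refine ⟨?_, ?_⟩
      · rintro _ ⟨j, rfl⟩
        exact Or.inr (Set.mem_iUnion.2 ⟨_, (hprem j).1⟩)
      · rintro _ rfl
        exact Or.inl rfl
    · obtain ⟨x, hx⟩ := Set.mem_iUnion.1 hl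
      exact ⟨fun w hw => Or.inr (Set.mem_iUnion.2 ⟨x, (ih x (hπ x) l hx).1 w hw⟩),
        fun w hw => Or.inr (Set.mem_iUnion.2 ⟨x, (ih x (hπ x) l hx).2 w hw⟩)⟩

/-- The structure of a proof is connected, whatever premises of the par links are chosen. -/
theorem Proof.TranslatesTo.connected {ι : Type*} {L : ι → ConnectivePair} {S : ProofStructure L}
    {Γ : Multiset (Formula L)} {π : Proof L Γ} {N : Set S.V} {Λ : Set (Link L S.V)}
    (h : π.TranslatesTo S N Λ) {I : Link L S.V → S.V} (hI : IsChoice Λ I) {X : Set S.V}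
    (hX : ∀ l ∈ Λ, l.Uncut I X) : ∀ u ∈ N, ∀ v ∈ N, u ∈ X → v ∈ X := by
  induction π generalizing N Λ with
  | ax A =>
    obtain ⟨u, v, -, -, -, rfl, rfl⟩ := h
    intro w hw w' hw'
    exact hX _ rfl w w' hw hw'
  | cut A Γ Δ π₁ π₂ ih₁ ih₂ =>
    obtain ⟨N₁, N₂, Λ₁, Λ₂, u, v, h₁, h₂, -, hu, -, -, hv, -, -, rfl, rfl⟩ := h
    have k₁ := ih₁ h₁ (fun i b prem c hl => hI i b prem c (Or.inr (Or.inl hl)))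
      fun l hl => hX l (Or.inr (Or.inl hl))
    have k₂ := ih₂ h₂ (fun i b prem c hl => hI i b prem c (Or.inr (Or.inr hl)))
      fun l hl => hX l (Or.inr (Or.inr hl))
    have huv := hX _ (Or.inl rfl) u v (Or.inl rfl) (Or.inr rfl)
    have hvu := hX _ (Or.inl rfl) v u (Or.inr rfl) (Or.inl rfl)
    rintro w (hw | hw) w' (hw' | hw') hwX
    · exact k₁ w hw w' hw' hwX
    · exact k₂ v hv w' hw' (huv (k₁ w hw u hu hwX))
    · exact k₁ u hu w' hw' (hvu (k₂ w hw v hv hwX))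
    · exact k₂ w hw w' hw' hwX
  | conn i b p hp A Γ π ih =>
    obtain ⟨N', Λ', prem, c, hπ, -, -, hprem, -, -, rfl, rfl⟩ := h
    have k := fun x => ih x (hπ x)
      (fun i b prem c hl => hI i b prem c (Or.inr (Set.mem_iUnion.2 ⟨x, hl⟩)))
      fun l hl => hX l (Or.inr (Set.mem_iUnion.2 ⟨x, hl⟩))
    have hl := hX _ (Or.inl rfl)
    have hc : ∀ x, ∀ w ∈ N' x, w ∈ X ↔ c ∈ X := by
      intro x w hw
      by_cases hpar : (L i).IsPar b
      · obtain ⟨j, hj⟩ := hI i b prem c (Or.inl rfl) hpar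
        -- A par rule has a single premise, so the chosen occurrence links the conclusion to the
        -- whole of it.
        have hpt : p = ⊤ := by
          rw [show (L i).rules b = {⊤} from hpar] at hp
          exact hp
        have hx : Quotient.mk p j = x := by
          obtain ⟨j', rfl⟩ := Quotient.exists_rep x
          exact Quotient.sound (by subst hpt; trivial)
        have hjx := hx ▸ (hprem j).1
        have hjj : Link.Joined I (.conn i b prem c) (prem j) := Or.inr ⟨⟨j, rfl⟩, fun _ => hj⟩
        exact ⟨fun h => hl _ _ hjj (Or.inl rfl) (k x w hw _ hjx h),
          fun h => k x _ hjx w hw (hl _ _ (Or.inl rfl) hjj h)⟩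
      · obtain ⟨j, rfl⟩ := Quotient.exists_rep x
        have hjx := (hprem j).1
        have hjj : Link.Joined I (.conn i b prem c) (prem j) :=
          Or.inr ⟨⟨j, rfl⟩, fun h => (hpar h).elim⟩
        exact ⟨fun h => hl _ _ hjj (Or.inl rfl) (k _ w hw _ hjx h),
          fun h => k _ _ hjx w hw (hl _ _ (Or.inl rfl) hjj h)⟩
    have hc' : ∀ w ∈ insert c (⋃ x, N' x), w ∈ X ↔ c ∈ X := by
      rintro w (rfl | hw)
      · rfl
      · obtain ⟨x, hx⟩ := Set.mem_iUnion.1 hw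
        exact hc x w hx
    intro w hw w' hw' h
    exact (hc' w' hw').2 ((hc' w hw).1 h)

theorem ProofStructure.Sequentializable.connected {ι : Type*} {L : ι → ConnectivePair}
    {S : ProofStructure L} (h : S.Sequentializable) {I : Link L S.V → S.V}
    (hI : IsChoice S.links I) {X : Set S.V} (hX : ∀ l ∈ S.links, l.Uncut I X) {u v : S.V}
    (hu : u ∈ X) : v ∈ X := by
  obtain ⟨Γ, π, h⟩ := h
  exact h.connected hI hX u trivial v trivial hu

/-! ### Excluded middle -/

/-- The axiom link at premise `j` lies in one subproof together with both its ends, and the other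
link lies in one subproof `y` with all its premises. Hence every premise of the last link lies in
`y`, and `p` has a single class. The flag `s` tells the side of the last link. -/
theorem excludedMiddle_eq_top {ι : Type*} {L : ι → ConnectivePair} {i₀ : ι} {b₀ : Bool}
    {A : Fin (L i₀).arity → Formula L} {n : ℕ} {p : Setoid (Fin n)}
    {N : Quotient p → Set (excludedMiddle L i₀ b₀ A).V}
    {Λ : Quotient p → Set (Link L (excludedMiddle L i₀ b₀ A).V)} (s : Bool)
    (e : Fin n → Fin (L i₀).arity)
    (hN : ∀ x y, x ≠ y → Disjoint (N x) (N y))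
    (hmem : ∀ x, ∀ l ∈ Λ x, (∀ v ∈ l.premises, v ∈ N x) ∧ ∀ v ∈ l.conclusions, v ∈ N x)
    (hprem : ∀ j, (s, some (e j)) ∈ N (Quotient.mk p j))
    (hax : ∀ j, ∃ x, Link.ax (true, some (e j)) (false, some (e j)) ∈ Λ x)
    (hother : ∃ x, ∃ l ∈ Λ x, ∀ j, (!s, some (e j)) ∈ l.premises) : p = ⊤ := by
  have huniq : ∀ x y v, v ∈ N x → v ∈ N y → x = y := by
    intro x y v hx hy
    by_contra hne
    exact Set.disjoint_left.1 (hN x y hne) hx hy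
  obtain ⟨y, l, hl, hlp⟩ := hother
  have key : ∀ j, Quotient.mk p j = y := by
    intro j
    obtain ⟨x, hx⟩ := hax j
    have h1 := (hmem x _ hx).2 (true, some (e j)) (Link.mem_conclusions_ax.2 (Or.inl rfl))
    have h2 := (hmem x _ hx).2 (false, some (e j)) (Link.mem_conclusions_ax.2 (Or.inr rfl))
    have hs : (s, some (e j)) ∈ N x := by cases s <;> assumption
    have hs' : (!s, some (e j)) ∈ N x := by cases s <;> assumption
    rw [huniq _ _ _ (hprem j) hs]
    exact huniq _ _ _ hs' ((hmem y l hl).1 _ (hlp j))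
  refine Setoid.ext fun a b => ⟨fun _ => trivial, fun _ => ?_⟩
  exact Quotient.exact ((key a).trans (key b).symm)

/-- If an excluded middle is sequentializable, one of the two connectives is a par. -/
theorem isPar_or_isPar_not_of_sequentializable {ι : Type*} {L : ι → ConnectivePair} {i : ι}
    {b : Bool} {A : Fin (L i).arity → Formula L} (h : (excludedMiddle L i b A).Sequentializable) :
    (L i).IsPar b ∨ (L i).IsPar (!b) := by
  obtain ⟨Γ, π, h⟩ := h
  have hC : Link.conn i b (fun j => (true, some j)) (true, none) ∈
      (excludedMiddle L i b A).links := Or.inr (Or.inl rfl)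
  have hC' : Link.conn i (!b) (fun j => (false, some j)) (false, none) ∈
      (excludedMiddle L i b A).links := Or.inr (Or.inr rfl)
  have hA : ∀ j, Link.ax (true, some j) (false, some j) ∈ (excludedMiddle L i b A).links :=
    fun j => Or.inl ⟨j, rfl⟩
  -- An axiom alone has no link of a connective and an excluded middle has no cut link, so the last
  -- rule introduces one of the two connectives.
  cases π with
  | ax A' =>
    obtain ⟨u, v, -, -, -, -, hΛ⟩ := h
    rw [hΛ] at hC
    cases hC
  | cut A' Γ Δ π₁ π₂ =>
    obtain ⟨N₁, N₂, Λ₁, Λ₂, u, v, -, -, -, -, -, -, -, -, -, -, hΛ⟩ := h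
    have : Link.cut u v ∈ (excludedMiddle L i b A).links := hΛ ▸ Or.inl rfl
    rcases this with ⟨j, h⟩ | h | h <;> cases h
  | conn i' b' p hp A' Γ π =>
    obtain ⟨N', Λ', prem, c, hπ, hdisj, -, hprem, -, -, -, hΛ⟩ := h
    have hmem := fun x => (hπ x).mem
    have hl : Link.conn i' b' prem c ∈ (excludedMiddle L i b A).links := hΛ ▸ Or.inl rfl
    have hin : ∀ l ∈ (excludedMiddle L i b A).links, l ≠ Link.conn i' b' prem c →
        ∃ x, l ∈ Λ' x := by
      intro l hl hne
      rw [hΛ] at hl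
      exact Set.mem_iUnion.1 (hl.resolve_left hne)
    rcases hl with ⟨j, h⟩ | h | h
    · cases h
    · cases h
      left
      have := excludedMiddle_eq_top (e := id) true hdisj hmem (fun j => (hprem j).1)
        (fun j => hin _ (hA j) nofun)
        (by
          obtain ⟨x, hx⟩ := hin _ hC' (Link.conn_ne_conn nofun)
          exact ⟨x, _, hx, fun j => Link.mem_premises_conn.2 ⟨j, rfl⟩⟩)
      subst this
      exact ConnectivePair.isPar_of_top_mem hp
    · cases h
      right
      have := excludedMiddle_eq_top (e := id) false hdisj hmem (fun j => (hprem j).1)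
        (fun j => hin _ (hA j) nofun)
        (by
          obtain ⟨x, hx⟩ := hin _ hC (Link.conn_ne_conn nofun)
          exact ⟨x, _, hx, fun j => Link.mem_premises_conn.2 ⟨j, rfl⟩⟩)
      subst this
      exact ConnectivePair.isPar_of_top_mem hp

/-! ### Gluing two positions along the premises -/

/-- The graph obtained from the positions `P` and `Q` of two links by joining their corresponding
premises is a tree. -/
structure Glue {n : ℕ} (P Q : Position n) : Prop where
  conn : ∀ x y, P.Invariant x → Q.Invariant y → (∀ j, some j ∈ x ↔ some j ∈ y) →
    (x = ∅ ∧ y = ∅) ∨ (x = Set.univ ∧ y = Set.univ)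
  left : ∀ o, ∃ x y : Set (Option (Fin n)), Q.Invariant y ∧ (∀ j, some j ∈ x ↔ some j ∈ y) ∧ o ∈ x ∧
    (∀ o', P o o' → o' ≠ o → o' ∉ x) ∧ ∀ o₁ o₂, P o₁ o₂ → ¬ P o o₁ → o₁ ∈ x → o₂ ∈ x
  right : ∀ o, ∃ x y : Set (Option (Fin n)), P.Invariant x ∧ (∀ j, some j ∈ x ↔ some j ∈ y) ∧ o ∈ y ∧
    (∀ o', Q o o' → o' ≠ o → o' ∉ y) ∧ ∀ o₁ o₂, Q o₁ o₂ → ¬ Q o o₁ → o₁ ∈ y → o₂ ∈ y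
  ax : ∀ j, ∃ x y : Set (Option (Fin n)), P.Invariant x ∧ Q.Invariant y ∧ (∀ j', j' ≠ j → (some j' ∈ x ↔ some j' ∈ y)) ∧
    some j ∈ x ∧ some j ∉ y

theorem Position.Invariant.compl {n : ℕ} {P : Position n} {x : Set (Option (Fin n))}
    (h : P.Invariant x) : P.Invariant xᶜ :=
  fun o o' ho hx hx' => hx (h o' o (P.symm' ho) hx')

namespace Glue

variable {n : ℕ} {P Q : Position n}

theorem symm (h : Glue P Q) : Glue Q P where
  conn x y hx hy hxy := by
    rcases h.conn y x hy hx fun j => (hxy j).symm with ⟨h1, h2⟩ | ⟨h1, h2⟩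
    exacts [Or.inl ⟨h2, h1⟩, Or.inr ⟨h2, h1⟩]
  left o := by
    obtain ⟨x, y, h1, h2, h3⟩ := h.right o
    exact ⟨y, x, h1, fun j => (h2 j).symm, h3⟩
  right o := by
    obtain ⟨x, y, h1, h2, h3⟩ := h.left o
    exact ⟨y, x, h1, fun j => (h2 j).symm, h3⟩
  ax j := by
    obtain ⟨x, y, hx, hy, hxy, h1, h2⟩ := h.ax j
    exact ⟨yᶜ, xᶜ, hy.compl, hx.compl, fun j' hj' => not_congr (hxy j' hj').symm, h2,
      fun h => h h1⟩

/-- Otherwise the conclusion would be a component by itself. -/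
theorem exists_right_none (h : Glue P Q) : ∃ j, Q none (some j) := by
  by_contra hc
  push Not at hc
  have hinv : Q.Invariant {none} := by
    rintro o o' ho rfl
    rcases o' with _ | j
    · rfl
    · exact (hc j ho).elim
  rcases h.conn ∅ {none} (fun o o' _ h => h) hinv (by simp) with ⟨-, h⟩ | ⟨h, -⟩
  · exact Set.singleton_ne_empty _ h
  · exact Set.empty_ne_univ h

theorem exists_left_none (h : Glue P Q) : ∃ j, P none (some j) :=
  h.symm.exists_right_none

/-- Two premises joined by `P` would close a cycle through `⊤`, and by connectedness the conclusion
is joined to some premise. So `P` joins the conclusion to exactly one premise and does nothing else.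
-/
theorem eq_keep (h : Glue P ⊤) : ∃ j, P = keep {j} := by
  have hdisc : ∀ a b, P (some a) (some b) → a = b := by
    intro a b hab
    by_contra hne
    obtain ⟨x, y, hx, hy, hxy, h1, h2⟩ := h.ax a
    have h3 := hx _ _ hab h1
    exact h2 (hy _ _ trivial ((hxy b fun e => hne e.symm).1 h3))
  obtain ⟨j, hj⟩ := h.exists_left_none
  refine ⟨j, Setoid.ext ?_⟩
  have hnone : ∀ k, P none (some k) ↔ k = j := by
    intro k
    constructor
    · intro hk
      exact hdisc k j (P.trans' (P.symm' hk) hj)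
    · rintro rfl
      exact hj
  rintro (_ | a) (_ | b) <;> rw [keep_iff]
  · simp
  · rw [hnone]
    simp
  · rw [P.comm', hnone]
    simp
  · constructor
    · intro hab
      exact Or.inl (by rw [hdisc a b hab])
    · simp only [Set.image_singleton, Set.mem_insert_iff, Set.mem_singleton_iff]
      rintro (h | h)
      · rw [h]
      · have ha : a = j := by simpa using h.1
        have hb : b = j := by simpa using h.2
        rw [ha, hb]

/-- Separators of single members of a class add up: the union over `d ∈ D` separates `D` from the
rest of its class. -/
theorem separate_right (h : Glue P Q) (o : Option (Fin n)) (D : Set (Option (Fin n)))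
    (hD : ∀ d ∈ D, Q o d) : ∃ x y : Set (Option (Fin n)), P.Invariant x ∧ (∀ j, some j ∈ x ↔ some j ∈ y) ∧
      (∀ o', Q o o' → (o' ∈ y ↔ o' ∈ D)) ∧ ∀ o₁ o₂, Q o₁ o₂ → ¬ Q o o₁ → o₁ ∈ y → o₂ ∈ y := by
  choose x y hx hxy hmem hnot hinv using h.right
  refine ⟨⋃ d ∈ D, x d, ⋃ d ∈ D, y d, ?_, ?_, ?_, ?_⟩
  · intro a b hab ha
    simp only [Set.mem_iUnion] at ha ⊢
    obtain ⟨d, hd, ha⟩ := ha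
    exact ⟨d, hd, hx d a b hab ha⟩
  · intro j
    simp only [Set.mem_iUnion, hxy]
  · intro o' ho'
    simp only [Set.mem_iUnion]
    constructor
    · rintro ⟨d, hd, h⟩
      by_contra hne
      refine hnot d o' (Q.trans' (Q.symm' (hD d hd)) ho') ?_ h
      rintro rfl
      exact hne hd
    · intro h
      exact ⟨o', h, hmem o'⟩
  · intro a b hab hoa ha
    simp only [Set.mem_iUnion] at ha ⊢
    obtain ⟨d, hd, ha⟩ := ha
    exact ⟨d, hd, hinv d a b hab (fun h => hoa (Q.trans' (hD d hd) h)) ha⟩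

end Glue

/-- The graph is a star around the node of `⊤`, with the premises of the other link hanging from its
rays and one ray prolonged from premise `j` to the other conclusion. The witnesses are the two sides
of each bridge. -/
theorem glue_keep_top {n : ℕ} (j : Fin n) : Glue (keep {j}) ⊤ := by
  have hk : ∀ {o o' : Option (Fin n)}, keep {j} o o' ↔
      o = o' ∨ ((o = none ∨ o = some j) ∧ (o' = none ∨ o' = some j)) := by
    intro o o'
    rw [keep_iff]
    simp
  have hinv : ∀ (x : Set (Option (Fin n))), (none ∈ x ↔ some j ∈ x) →
      (keep {j} : Position n).Invariant x := by
    intro x hx o o' ho h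
    rcases hk.1 ho with rfl | ⟨rfl | rfl, rfl | rfl⟩
    exacts [h, h, hx.1 h, hx.2 h, h]
  have hkj : keep {j} none (some j) := hk.2 (Or.inr ⟨Or.inl rfl, Or.inr rfl⟩)
  refine ⟨?_, ?_, ?_, ?_⟩
  · intro x y hx hy hxy
    by_cases hjy : some j ∈ y
    · right
      have hy' : y = Set.univ := Set.eq_univ_of_forall fun o => hy _ _ trivial hjy
      refine ⟨Set.eq_univ_of_forall ?_, hy'⟩
      subst hy'
      rintro (_ | a)
      · exact hx _ _ ((keep {j}).symm' hkj) ((hxy j).2 trivial)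
      · exact (hxy a).2 trivial
    · left
      have hy' : y = ∅ := Set.eq_empty_of_forall_notMem fun o ho => hjy (hy _ _ trivial ho)
      refine ⟨Set.eq_empty_of_forall_notMem ?_, hy'⟩
      subst hy'
      rintro (_ | a) h
      · exact (hxy j).1 (hx _ _ hkj h)
      · exact (hxy a).1 h
  · rintro (_ | a)
    · refine ⟨{none}, ∅, fun _ _ _ h => h, by simp, rfl, fun o' _ h => h, ?_⟩
      rintro o₁ o₂ - h rfl
      exact (h ((keep {j}).refl' _)).elim
    · by_cases haj : a = j
      · subst haj
        refine ⟨Set.range some, Set.univ, fun _ _ _ h => h, by simp, ⟨a, rfl⟩, ?_, ?_⟩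
        · rintro (_ | b) h hne
          · simp
          · rcases hk.1 h with h | h
            · exact (hne h.symm).elim
            · exact (hne (by simpa using h)).elim
        · rintro o₁ o₂ h12 hna h
          rcases hk.1 h12 with rfl | ⟨h1, -⟩
          · exact h
          · exact (hna (hk.2 (Or.inr ⟨Or.inr rfl, h1⟩))).elim
      · refine ⟨Set.univ, Set.univ, fun _ _ _ h => h, by simp, trivial, ?_, fun _ _ _ _ h => h⟩
        intro o' h hne
        rcases hk.1 h with h | h
        · exact (hne h.symm).elim
        · exact (haj (by simpa using h.1)).elim
  · rintro (_ | a)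
    · refine ⟨∅, {none}, fun _ _ _ h => h, by simp, rfl, fun o' _ h => h, ?_⟩
      intro o₁ o₂ _ h
      exact (h trivial).elim
    · by_cases haj : a = j
      · subst haj
        refine ⟨{none, some a}, {some a}, hinv _ (by simp), by simp, rfl, fun o' _ h => h, ?_⟩
        intro o₁ o₂ _ h
        exact (h trivial).elim
      · refine ⟨{some a}, {some a}, hinv _ (by simp [Ne.symm haj]), by simp, rfl,
          fun o' _ h => h, ?_⟩
        intro o₁ o₂ _ h
        exact (h trivial).elim
  · intro a
    by_cases haj : a = j
    · subst haj
      refine ⟨{none, some a}, ∅, hinv _ (by simp), fun _ _ _ h => h, ?_, by simp, by simp⟩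
      intro j' hj'
      simp [hj']
    · refine ⟨{some a}, ∅, hinv _ (by simp [Ne.symm haj]), fun _ _ _ h => h, ?_, rfl, by simp⟩
      intro j' hj'
      simp [hj']

/-- The link of the connective `(i, b)` in an excluded middle; its premises and conclusion are tagged
by `s`. -/
abbrev sideLink {ι : Type*} (L : ι → ConnectivePair) (i : ι) (b s : Bool) :
    Link L (Bool × Option (Fin (L i).arity)) :=
  Link.conn i b (fun j => (s, some j)) (s, none)

/-- A set of occurrences of an excluded middle, given by its two sides. -/
def sides {n : ℕ} (x y : Set (Option (Fin n))) : Set (Bool × Option (Fin n)) :=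
  {v | v.2 ∈ cond v.1 x y}

theorem preimage_sides_true {n : ℕ} {x y : Set (Option (Fin n))} :
    plug (fun j => (true, some j)) (true, none) ⁻¹' sides x y = x := by
  ext o
  cases o <;> rfl

theorem preimage_sides_false {n : ℕ} {x y : Set (Option (Fin n))} :
    plug (fun j => (false, some j)) (false, none) ⁻¹' sides x y = y := by
  ext o
  cases o <;> rfl

theorem plug_mem_sides {n : ℕ} {x y : Set (Option (Fin n))} (s : Bool) (o : Option (Fin n)) :
    plug (fun j => (s, some j)) (s, none) o ∈ sides x y ↔ o ∈ cond s x y := by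
  cases o <;> rfl

theorem eq_sides {n : ℕ} (X : Set (Bool × Option (Fin n))) :
    ∃ x y, X = sides x y :=
  ⟨{o | (true, o) ∈ X}, {o | (false, o) ∈ X}, by ext ⟨_ | _, o⟩ <;> rfl⟩

/-- A set of occurrences is a pair of sets, one for each side. Not to cut an axiom link means
agreement of the two at that premise, and the conditions at the two links are invariance under `P`
and under `Q`. -/
theorem excludedMiddle_treeLike_iff {ι : Type*} {L : ι → ConnectivePair} {i : ι} {b : Bool}
    {A : Fin (L i).arity → Formula L}
    {J : Link L (Bool × Option (Fin (L i).arity)) → Set (Set (Bool × Option (Fin (L i).arity)))}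
    {P Q : Position (L i).arity}
    (hax : ∀ j, J (.ax (true, some j) (false, some j)) = {{(true, some j), (false, some j)}})
    (hP : J (sideLink L i b true) = P.groups (fun j => (true, some j)) (true, none))
    (hQ : J (sideLink L i (!b) false) = Q.groups (fun j => (false, some j)) (false, none)) :
    TreeLike (excludedMiddle L i b A) J ↔ Glue P Q := by
  have hC : sideLink L i b true ∈ (excludedMiddle L i b A).links := Or.inr (Or.inl rfl)
  have hC' : sideLink L i (!b) false ∈ (excludedMiddle L i b A).links := Or.inr (Or.inr rfl)
  have hrax : ∀ j x y, Respects (sides x y) (J (.ax (true, some j) (false, some j))) ↔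
      (some j ∈ x ↔ some j ∈ y) := by
    intro j x y
    rw [hax, respects_pair_iff]
    rfl
  have hrP : ∀ x y, Respects (sides x y) (J (sideLink L i b true)) ↔ P.Invariant x := by
    intro x y
    rw [hP, Position.respects_groups_iff, preimage_sides_true]
  have hrQ : ∀ x y, Respects (sides x y) (J (sideLink L i (!b) false)) ↔ Q.Invariant y := by
    intro x y
    rw [hQ, Position.respects_groups_iff, preimage_sides_false]
  have hall : ∀ p : Link L (Bool × Option (Fin (L i).arity)) → Prop,
      (∀ l ∈ (excludedMiddle L i b A).links, p l) ↔
      (∀ j, p (.ax (true, some j) (false, some j))) ∧ p (sideLink L i b true) ∧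
        p (sideLink L i (!b) false) := by
    intro p
    refine ⟨fun h => ⟨fun j => h _ (Or.inl ⟨j, rfl⟩), h _ hC, h _ hC'⟩, ?_⟩
    rintro ⟨h1, h2, h3⟩ l (⟨j, rfl⟩ | rfl | rfl)
    exacts [h1 j, h2, h3]
  have hne : sideLink L i b true ≠ sideLink L i (!b) false := Link.conn_ne_conn nofun
  have hax_inj : ∀ j j', (Link.ax (true, some j') (false, some j') :
      Link L (Bool × Option (Fin (L i).arity))) ≠ Link.ax (true, some j) (false, some j) ↔
      j' ≠ j := by
    intro j j'
    simp
  have hsepC : (∀ B ∈ J (sideLink L i b true), ∀ v ∈ B,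
      Separable (excludedMiddle L i b A) J (sideLink L i b true) B v) ↔ _ :=
    separable_conn_iff ((excludedMiddle L i b A).plug_injective hC) hP
  have hsepC' : (∀ B ∈ J (sideLink L i (!b) false), ∀ v ∈ B,
      Separable (excludedMiddle L i b A) J (sideLink L i (!b) false) B v) ↔ _ :=
    separable_conn_iff ((excludedMiddle L i b A).plug_injective hC') hQ
  have hconn : (∀ X : Set (excludedMiddle L i b A).V,
      (∀ l ∈ (excludedMiddle L i b A).links, Respects X (J l)) → ∀ u v, u ∈ X → v ∈ X) ↔
      ∀ x y, P.Invariant x → Q.Invariant y → (∀ j, some j ∈ x ↔ some j ∈ y) →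
        (x = ∅ ∧ y = ∅) ∨ (x = Set.univ ∧ y = Set.univ) := by
    constructor
    · intro h x y hx hy hxy
      have := h (sides x y) ((hall _).2 ⟨fun j => (hrax j x y).2 (hxy j), (hrP x y).2 hx,
        (hrQ x y).2 hy⟩)
      by_cases hex : ∃ u, u ∈ sides x y
      · obtain ⟨u, hu⟩ := hex
        exact Or.inr ⟨Set.eq_univ_of_forall fun o => this u (true, o) hu,
          Set.eq_univ_of_forall fun o => this u (false, o) hu⟩
      · exact Or.inl ⟨Set.eq_empty_of_forall_notMem fun o ho => hex ⟨(true, o), ho⟩,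
          Set.eq_empty_of_forall_notMem fun o ho => hex ⟨(false, o), ho⟩⟩
    · intro h X hX u v hu
      obtain ⟨x, y, rfl⟩ := eq_sides X
      obtain ⟨h1, h2, h3⟩ := (hall _).1 hX
      rcases h x y ((hrP x y).1 h2) ((hrQ x y).1 h3) fun j => (hrax j x y).1 (h1 j) with
        ⟨rfl, rfl⟩ | ⟨rfl, rfl⟩
      · obtain ⟨_ | _, u⟩ := u <;> exact hu.elim
      · obtain ⟨_ | _, v⟩ := v <;> trivial
  constructor
  · rintro ⟨hc, ha⟩
    refine ⟨hconn.1 hc, ?_, ?_, ?_⟩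
    · intro o
      obtain ⟨X, h1, h2, h3, h4⟩ := hsepC.1 (ha _ hC) o
      obtain ⟨x, y, rfl⟩ := eq_sides X
      exact ⟨x, y, (hrQ x y).1 (h4 _ hC' hne.symm),
        fun j => (hrax j x y).1 (h4 _ (Or.inl ⟨j, rfl⟩) nofun), (plug_mem_sides true o).1 h1,
        fun o' ho hne' h => h2 o' ho hne' ((plug_mem_sides true o').2 h),
        fun o₁ o₂ h12 ho h => (plug_mem_sides true o₂).1
          (h3 o₁ o₂ h12 ho ((plug_mem_sides true o₁).2 h))⟩
    · intro o
      obtain ⟨X, h1, h2, h3, h4⟩ := hsepC'.1 (ha _ hC') o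
      obtain ⟨x, y, rfl⟩ := eq_sides X
      exact ⟨x, y, (hrP x y).1 (h4 _ hC hne),
        fun j => (hrax j x y).1 (h4 _ (Or.inl ⟨j, rfl⟩) nofun), (plug_mem_sides false o).1 h1,
        fun o' ho hne' h => h2 o' ho hne' ((plug_mem_sides false o').2 h),
        fun o₁ o₂ h12 ho h => (plug_mem_sides false o₂).1
          (h3 o₁ o₂ h12 ho ((plug_mem_sides false o₁).2 h))⟩
    · intro j
      obtain ⟨X, h1, h2, h3, h4⟩ := ha _ (Or.inl ⟨j, rfl⟩)
        {(true, some j), (false, some j)} (by rw [hax]; rfl) (true, some j) (Or.inl rfl)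
      obtain ⟨x, y, rfl⟩ := eq_sides X
      exact ⟨x, y, (hrP x y).1 (h4 _ hC nofun), (hrQ x y).1 (h4 _ hC' nofun),
        fun j' hj' => (hrax j' x y).1 (h4 _ (Or.inl ⟨j', rfl⟩) ((hax_inj j j').2 hj')), h1,
        h2 (false, some j) (Or.inr rfl) nofun⟩
  · intro h
    refine ⟨hconn.2 h.conn, (hall _).2 ⟨?_, ?_, ?_⟩⟩
    · intro j
      obtain ⟨x, y, hx, hy, hxy, h1, h2⟩ := h.ax j
      refine separable_pair (hax j) ⟨sides x y, h1, h2, (hall _).2 ⟨?_, ?_, ?_⟩⟩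
      · intro j' hj'
        exact (hrax j' x y).2 (hxy j' ((hax_inj j j').1 hj'))
      · exact fun _ => (hrP x y).2 hx
      · exact fun _ => (hrQ x y).2 hy
    · refine hsepC.2 fun o => ?_
      obtain ⟨x, y, hy, hxy, h1, h2, h3⟩ := h.left o
      exact ⟨sides x y, (plug_mem_sides true o).2 h1,
        fun o' ho hne' h => h2 o' ho hne' ((plug_mem_sides true o').1 h),
        fun o₁ o₂ h12 ho h => (plug_mem_sides true o₂).2
          (h3 o₁ o₂ h12 ho ((plug_mem_sides true o₁).1 h)), (hall _).2 ⟨fun j _ => (hrax j x y).2 (hxy j), fun h => (h rfl).elim,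
        fun _ => (hrQ x y).2 hy⟩⟩
    · refine hsepC'.2 fun o => ?_
      obtain ⟨x, y, hx, hxy, h1, h2, h3⟩ := h.right o
      exact ⟨sides x y, (plug_mem_sides false o).2 h1,
        fun o' ho hne' h => h2 o' ho hne' ((plug_mem_sides false o').1 h),
        fun o₁ o₂ h12 ho h => (plug_mem_sides false o₂).2
          (h3 o₁ o₂ h12 ho ((plug_mem_sides false o₁).1 h)), (hall _).2 ⟨fun j _ => (hrax j x y).2 (hxy j), fun _ => (hrP x y).2 hx,
        fun h => (h rfl).elim⟩⟩

/-- The positions of the two links can be chosen independently, and the formulas `A` play no role.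
-/
theorem excludedMiddle_correct_iff {ι : Type*} {L : ι → ConnectivePair} {f : Switching L} {i : ι}
    {b : Bool} {A : Fin (L i).arity → Formula L} :
    (excludedMiddle L i b A).Correct f ↔ ∀ P ∈ f i b, ∀ Q ∈ f i (!b), Glue P Q := by
  classical
  rw [ProofStructure.correct_iff]
  constructor
  · intro h P hP Q hQ
    let J : Link L (Bool × Option (Fin (L i).arity)) →
        Set (Set (Bool × Option (Fin (L i).arity))) := fun l =>
      if l = sideLink L i b true then P.groups (fun j => (true, some j)) (true, none)
      else if l = sideLink L i (!b) false then Q.groups (fun j => (false, some j)) (false, none)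
      else match l with
        | .ax u v => {{u, v}}
        | _ => ∅
    have hax : ∀ j, J (.ax (true, some j) (false, some j)) =
        {{(true, some j), (false, some j)}} := fun j => by
      simp [J]
    have hJP : J (sideLink L i b true) = P.groups (fun j => (true, some j)) (true, none) := by
      simp [J]
    have hJQ : J (sideLink L i (!b) false) = Q.groups (fun j => (false, some j)) (false, none) := by
      have hne : sideLink L i (!b) false ≠ sideLink L i b true :=
        Link.conn_ne_conn (by simp)
      show ite _ _ _ = _
      rw [if_neg hne, if_pos rfl]
    refine (excludedMiddle_treeLike_iff hax hJP hJQ).1 (h J ?_)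
    rintro l (⟨j, rfl⟩ | rfl | rfl)
    · exact hax j
    · exact ⟨P, hP, hJP⟩
    · exact ⟨Q, hQ, hJQ⟩
  · intro h J hJ
    obtain ⟨P, hP, hJP⟩ := hJ (sideLink L i b true) (Or.inr (Or.inl rfl))
    obtain ⟨Q, hQ, hJQ⟩ := hJ (sideLink L i (!b) false) (Or.inr (Or.inr rfl))
    exact (excludedMiddle_treeLike_iff (fun j => hJ _ (Or.inl ⟨j, rfl⟩)) hJP hJQ).2 (h P hP Q hQ)

/-! ### Choices of premises and separation at pars and tensors -/

/-- In arity zero a meeting graph has no nodes at all, whereas a tree has one. -/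
theorem ConnectivePair.arity_pos (C : ConnectivePair) : 0 < C.arity := by
  rcases Nat.eq_zero_or_pos C.arity with h | h
  · obtain ⟨p, hp⟩ := C.rules_nonempty true
    obtain ⟨q, hq⟩ := C.rules_nonempty (!true)
    rw [← C.rules_dual] at hq
    have := (hq p hp).connected.nonempty
    have hempty : IsEmpty (Fin C.arity) := h ▸ Fin.isEmpty
    obtain ⟨x | x | x⟩ := this
    · exact hempty.elim x
    · exact hempty.elim x.out
    · exact hempty.elim x.out
  · exact h

theorem exists_isChoice {ι : Type*} {L : ι → ConnectivePair} {V : Type} (Λ : Set (Link L V))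
    {i : ι} {b : Bool} (prem : Fin (L i).arity → V) (c : V) (j : Fin (L i).arity) :
    ∃ I, IsChoice Λ I ∧ I (.conn i b prem c) = prem j := by
  classical
  let I : Link L V → V := fun l => if l = .conn i b prem c then prem j else
    match l with
    | .ax u _ => u
    | .cut u _ => u
    | .conn i' _ prem' _ => prem' ⟨0, (L i').arity_pos⟩
  refine ⟨I, ?_, if_pos rfl⟩
  intro i' b' prem' c' _ _
  by_cases h : (Link.conn i' b' prem' c' : Link L V) = .conn i b prem c
  · have hI : I (.conn i' b' prem' c') = prem j := if_pos h
    rw [hI]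
    cases h
    exact ⟨j, rfl⟩
  · exact ⟨_, (if_neg h).symm⟩

theorem Respects.compl {V : Type*} {X : Set V} {J : Set (Set V)} (h : Respects X J) :
    Respects Xᶜ J :=
  fun B hB u hu v hv huX hvX => huX (h B hB v hv u hu hvX)

theorem keep_singleton_iff {n : ℕ} {k : Fin n} {o o' : Option (Fin n)} : keep {k} o o' ↔
    o = o' ∨ ((o = none ∨ o = some k) ∧ (o' = none ∨ o' = some k)) := by
  rw [keep_iff]
  simp

theorem Position.invariant_keep_iff {n : ℕ} {k : Fin n} {x : Set (Option (Fin n))} :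
    (keep {k} : Position n).Invariant x ↔ (none ∈ x ↔ some k ∈ x) := by
  constructor
  · intro h
    have hk : keep {k} none (some k) := keep_singleton_iff.2 (Or.inr ⟨Or.inl rfl, Or.inr rfl⟩)
    exact ⟨h _ _ hk, h _ _ ((keep {k}).symm' hk)⟩
  · rintro hx o o' ho h
    rcases keep_singleton_iff.1 ho with rfl | ⟨rfl | rfl, rfl | rfl⟩
    exacts [h, h, hx.1 h, hx.2 h, h]

theorem Position.invariant_top_iff {n : ℕ} {x : Set (Option (Fin n))} :
    (⊤ : Position n).Invariant x ↔ ∀ j, some j ∈ x ↔ none ∈ x := by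
  constructor
  · exact fun h j => ⟨h _ _ trivial, h _ _ trivial⟩
  · rintro h (_ | j) (_ | j') - ho
    exacts [ho, (h j').2 ho, (h j).1 ho, (h j').2 ((h j).1 ho)]

section Separation

variable {ι : Type*} {L : ι → ConnectivePair} {S : ProofStructure L}
  {J : Link L S.V → Set (Set S.V)} {i : ι} {b : Bool} {prem : Fin (L i).arity → S.V} {c : S.V}

/-- The only group with more than one member is that of the conclusion and premise `k`. All the
others are singletons, for which nothing has to be separated. -/
theorem separable_keep (hl : .conn i b prem c ∈ S.links) {k : Fin (L i).arity}
    (hJ : J (.conn i b prem c) = (keep {k} : Position _).groups prem c)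
    (h : ∃ X : Set S.V, c ∈ X ∧ prem k ∉ X ∧
      ∀ l' ∈ S.links, l' ≠ .conn i b prem c → Respects X (J l')) :
    ∀ B ∈ J (.conn i b prem c), ∀ v ∈ B, Separable S J (.conn i b prem c) B v := by
  obtain ⟨X, hc, hk, hX⟩ := h
  rw [separable_conn_iff (S.plug_injective hl) hJ]
  have hsingle : ∀ o, (o = none ∨ o = some k) → ∀ o₁ o₂, keep {k} o₁ o₂ → ¬ keep {k} o o₁ →
      ∀ Y : Set S.V, plug prem c o₁ ∈ Y → plug prem c o₂ ∈ Y := by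
    intro o ho o₁ o₂ h12 hno Y hY
    rcases keep_singleton_iff.1 h12 with rfl | ⟨h1, -⟩
    · exact hY
    · exact (hno (keep_singleton_iff.2 (Or.inr ⟨ho, h1⟩))).elim
  intro o
  by_cases ho : o = none ∨ o = some k
  · rcases ho with rfl | rfl
    · refine ⟨X, hc, ?_, fun o₁ o₂ h h' => hsingle _ (Or.inl rfl) _ _ h h' X, hX⟩
      intro o' h hne
      rcases keep_singleton_iff.1 h with h | ⟨-, h | rfl⟩
      exacts [(hne h.symm).elim, (hne h).elim, hk]
    · refine ⟨Xᶜ, hk, ?_, fun o₁ o₂ h h' => hsingle _ (Or.inr rfl) _ _ h h' _,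
        fun l' hl' hne => (hX l' hl' hne).compl⟩
      intro o' h hne
      rcases keep_singleton_iff.1 h with h | ⟨-, rfl | h⟩
      exacts [(hne h.symm).elim, fun h => h hc, (hne h).elim]
  · refine ⟨Set.univ, trivial, ?_, fun _ _ _ _ _ => trivial, fun _ _ _ _ _ _ _ _ _ _ => trivial⟩
    intro o' h hne
    rcases keep_singleton_iff.1 h with h | ⟨h, -⟩
    exacts [(hne h.symm).elim, (ho h).elim]

/-- There is only one group, hence no condition about other groups of the same link. -/
theorem separable_top (hl : .conn i b prem c ∈ S.links)
    (hJ : J (.conn i b prem c) = (⊤ : Position _).groups prem c)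
    (h : ∀ o, ∃ X : Set S.V, plug prem c o ∈ X ∧ (∀ o', o' ≠ o → plug prem c o' ∉ X) ∧
      ∀ l' ∈ S.links, l' ≠ .conn i b prem c → Respects X (J l')) :
    ∀ B ∈ J (.conn i b prem c), ∀ v ∈ B, Separable S J (.conn i b prem c) B v := by
  rw [separable_conn_iff (S.plug_injective hl) hJ]
  intro o
  obtain ⟨X, h1, h2, h3⟩ := h o
  exact ⟨X, h1, fun o' _ hne => h2 o' hne, fun _ _ _ h => (h trivial).elim, h3⟩

theorem respects_keep_iff {k : Fin (L i).arity} {X : Set S.V}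
    (hJ : J (.conn i b prem c) = (keep {k} : Position _).groups prem c) :
    Respects X (J (.conn i b prem c)) ↔ (c ∈ X ↔ prem k ∈ X) := by
  rw [hJ, Position.respects_groups_iff, Position.invariant_keep_iff]
  rfl

theorem respects_top_iff {X : Set S.V}
    (hJ : J (.conn i b prem c) = (⊤ : Position _).groups prem c) :
    Respects X (J (.conn i b prem c)) ↔ ∀ k, prem k ∈ X ↔ c ∈ X := by
  rw [hJ, Position.respects_groups_iff, Position.invariant_top_iff]
  rfl

end Separation

/-! ### A single link with axioms above it -/

/-- The proof-structure of a single link of the connective `(i, b)`, all of whose premises are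
conclusions of axiom links; the occurrences `some (true, j)` are the premises. -/
abbrev singleLink {ι : Type*} (L : ι → ConnectivePair) (i : ι) (b : Bool) : ProofStructure L where
  V := Option (Bool × Fin (L i).arity)
  finite := inferInstance
  nonempty := inferInstance
  label
    | some (s, _) => .atom 0 s
    | none => .conn i b fun _ => .atom 0 true
  links := {l | (∃ j, l = .ax (some (true, j)) (some (false, j))) ∨
    l = .conn i b (fun j => some (true, j)) none}
  wellLabelled := by
    rintro l (⟨j, rfl⟩ | rfl) <;> rfl
  nodup_premises := by
    rintro l (⟨j, rfl⟩ | rfl)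
    · simp [Link.premises]
    · exact List.nodup_ofFn.2 fun j j' h => by simpa using h
  nodup_conclusions := by
    rintro l (⟨j, rfl⟩ | rfl) <;> simp [Link.conclusions]
  existsUnique_conclusion := by
    rintro (_ | ⟨_ | _, j⟩)
    · refine ⟨_, ⟨Or.inr rfl, by simp [Link.conclusions]⟩, ?_⟩
      rintro l ⟨⟨j, rfl⟩ | rfl, h⟩ <;> simp_all [Link.conclusions]
    · refine ⟨_, ⟨Or.inl ⟨j, rfl⟩, by simp [Link.conclusions]⟩, ?_⟩
      rintro l ⟨⟨j, rfl⟩ | rfl, h⟩ <;> simp_all [Link.conclusions]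
    · refine ⟨_, ⟨Or.inl ⟨j, rfl⟩, by simp [Link.conclusions]⟩, ?_⟩
      rintro l ⟨⟨j, rfl⟩ | rfl, h⟩ <;> simp_all [Link.conclusions]
  unique_premise := by
    rintro l (⟨j, rfl⟩ | rfl) l' (⟨j', rfl⟩ | rfl) v h h' <;> simp_all [Link.premises]

/-- With `j` chosen at the par, the axiom link above `k` is disconnected from the rest. -/
theorem singleLink_not_sequentializable {ι : Type*} {L : ι → ConnectivePair} {i : ι} {b : Bool}
    (hpar : (L i).IsPar b) {j k : Fin (L i).arity} (hjk : j ≠ k) :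
    ¬ (singleLink L i b).Sequentializable := by
  intro h
  obtain ⟨I, hI, hIj⟩ := exists_isChoice (singleLink L i b).links (i := i) (b := b)
    (fun j => some (true, j)) none j
  -- The conclusion and the axiom link above premise `j`.
  let X : Set (Option (Bool × Fin (L i).arity)) := {v | ∀ p, v = some p → p.2 = j}
  have hX : some (true, k) ∈ X := by
    refine h.connected hI (X := X) ?_ (u := none) (v := some (true, k)) nofun
    rintro l (⟨m, rfl⟩ | rfl) u v hu hv huX
    · have hm : m = j := by rcases hu with rfl | rfl <;> exact huX _ rfl
      rcases hv with rfl | rfl <;> rintro _ ⟨⟩ <;> exact hm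
    · rcases hv with rfl | ⟨-, hv⟩
      · nofun
      · rw [hv hpar, hIj]
        rintro _ ⟨⟩
        rfl
  exact hjk (hX _ rfl).symm

/-- A position `Q` that joins no two premises adds nothing but its conclusion as a leaf, so the bare
axiom links above `(i, b)` imitate the gluing with `Q`. -/
theorem singleLink_correct {ι : Type*} {L : ι → ConnectivePair} {f : Switching L} {i : ι}
    {b : Bool} {Q : Position (L i).arity} (hQ : ∀ j k, Q (some j) (some k) → j = k)
    (hglue : ∀ P ∈ f i b, Glue P Q) : (singleLink L i b).Correct f := by
  rw [ProofStructure.correct_iff]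
  intro J hJ
  have hlink : .conn i b (fun j => some (true, j)) none ∈ (singleLink L i b).links := Or.inr rfl
  obtain ⟨P, hP, hJP⟩ := hJ _ hlink
  have hJP : J (.conn i b (fun j => some (true, j)) none) =
    P.groups (fun j => some (true, j)) none := hJP
  have hJax : ∀ j, J (.ax (some (true, j)) (some (false, j))) =
    {{some (true, j), some (false, j)}} := fun j => hJ _ (Or.inl ⟨j, rfl⟩)
  have hg := hglue P hP
  obtain ⟨k, hk⟩ := hg.exists_right_none
  have hax : ∀ (X : Set (Option (Bool × Fin (L i).arity))) j,
      Respects X (J (.ax (some (true, j)) (some (false, j)))) ↔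
      (some (true, j) ∈ X ↔ some (false, j) ∈ X) := by
    intro X j
    rw [hJax, respects_pair_iff]
  constructor
  · intro X hX
    have hX1 : ∀ j, some (true, j) ∈ X ↔ some (false, j) ∈ X :=
      fun j => (hax X j).1 (hX _ (Or.inl ⟨j, rfl⟩))
    have hX2 := hX _ hlink
    rw [hJP, Position.respects_groups_iff] at hX2
    -- The conclusion on the side of `Q` has no counterpart here; it inherits its membership from
    -- the premise `k` that `Q` joins to it.
    let y : Set (Option (Fin (L i).arity)) := {o | some (true, o.getD k) ∈ X}
    have hy : Q.Invariant y := by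
      rintro (_ | j) (_ | j') ho h
      · exact h
      · rw [hQ j' k (Q.trans' (Q.symm' ho) hk)]
        exact h
      · rw [hQ j k (Q.trans' ho hk)] at h
        exact h
      · rw [← hQ _ _ ho]
        exact h
    intro u v hu
    rcases hg.conn _ y hX2 hy (fun j => Iff.rfl) with ⟨h, -⟩ | ⟨h, -⟩ <;>
      rw [Set.ext_iff] at h
    · rcases u with _ | ⟨_ | _, j⟩
      · exact ((h none).1 hu).elim
      · exact ((h (some j)).1 ((hX1 j).2 hu)).elim
      · exact ((h (some j)).1 hu).elim
    · rcases v with _ | ⟨_ | _, j⟩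
      · exact (h none).2 trivial
      · exact (hX1 j).1 ((h (some j)).2 trivial)
      · exact (h (some j)).2 trivial
  · rintro l (⟨j, rfl⟩ | rfl)
    · refine separable_pair (hJax j) ⟨{v | v ≠ some (false, j)}, by simp, by simp, ?_⟩
      rintro l (⟨j', rfl⟩ | rfl) hne
      · rw [hax]
        have : j' ≠ j := by
          rintro rfl
          exact hne rfl
        simpa using this
      · rw [hJP, Position.respects_groups_iff]
        rintro (_ | o) (_ | o') - - <;> nofun
    · refine (separable_conn_iff ((singleLink L i b).plug_injective hlink) hJP).2 fun o => ?_
      obtain ⟨x, -, -, -, h1, h2, h3⟩ := hg.left o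
      let X : Set (Option (Bool × Fin (L i).arity)) := {v | v.map Prod.snd ∈ x}
      have hX : ∀ o, plug (fun j => some (true, j)) none o ∈ X ↔ o ∈ x := by
        rintro (_ | o) <;> rfl
      refine ⟨X, (hX o).2 h1, fun o' h h' h'' => h2 o' h h' ((hX o').1 h''),
        fun o₁ o₂ h12 h h' => (hX o₂).2 (h3 o₁ o₂ h12 h ((hX o₁).1 h')), ?_⟩
      rintro l (⟨j', rfl⟩ | rfl) hne
      · exact (hax X j').2 Iff.rfl
      · exact (hne rfl).elim

/-! ### A structure in which a par needs a given premise to be tested -/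

/-- The formula occurrences of `detour`. -/
inductive DetourV (n : ℕ) : Type
  | up (k : Fin n)
  | dual (k : Fin n)
  | extra
  | extraDual
  | concl
  | conclDual
  | product

instance (n : ℕ) : Finite (DetourV n) := by
  let g : DetourV n → (Fin n ⊕ Fin n) ⊕ Fin 5 := fun v => match v with
    | .up k => .inl (.inl k)
    | .dual k => .inl (.inr k)
    | .extra => .inr 0
    | .extraDual => .inr 1
    | .concl => .inr 2
    | .conclDual => .inr 3
    | .product => .inr 4
  refine Finite.of_injective g ?_
  intro v w h
  cases v <;> cases w <;> simp [g] at h ⊢ <;> exact h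

section Detour

variable {ι : Type*} (L : ι → ConnectivePair) (i : ι) (b : Bool) (j : Fin (L i).arity)
  (i₀ : ι) (b₀ : Bool)

/-- The premises of the link of `(i, !b)` in `detour`. -/
abbrev detourDual {n : ℕ} (j k : Fin n) : DetourV n :=
  if k = j then .extraDual else .dual k

/-- The premises of the binary link in `detour`. -/
abbrev detourPair {n m : ℕ} (j : Fin n) (k : Fin m) : DetourV n :=
  if k.val = 0 then .concl else .dual j

/-- An excluded middle of the connective `(i, b)` in which the axiom link between the `j`-th premises
is moved: one end is now joined by a binary connective to the conclusion of `(i, b)`, and the `j`-th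
premise of the dual connective belongs to a new axiom link. -/
abbrev detour (h₀ : (L i₀).arity = 2) : ProofStructure L where
  V := DetourV (L i).arity
  finite := inferInstance
  nonempty := ⟨.extra⟩
  label
    | .up _ => .atom 0 true
    | .dual _ => .atom 0 false
    | .extra => .atom 0 true
    | .extraDual => .atom 0 false
    | .concl => .conn i b fun _ => .atom 0 true
    | .conclDual => .conn i (!b) fun _ => .atom 0 false
    | .product => .conn i₀ b₀ fun k => if k.val = 0 then .conn i b fun _ => .atom 0 true
        else .atom 0 false
  links := {l | (∃ k, l = .ax (.up k) (.dual k)) ∨ l = .ax .extra .extraDual ∨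
    l = .conn i b .up .concl ∨ l = .conn i (!b) (detourDual j) .conclDual ∨
    l = .conn i₀ b₀ (detourPair j) .product}
  wellLabelled := by
    rintro l (⟨k, rfl⟩ | rfl | rfl | rfl | rfl)
    · rfl
    · rfl
    · rfl
    · simp only [Link.WellLabelled, detourDual]
      congr 1
      funext k
      split_ifs <;> rfl
    · simp only [Link.WellLabelled, detourPair]
      congr 1
      funext k
      split_ifs <;> rfl
  nodup_premises := by
    rintro l (⟨k, rfl⟩ | rfl | rfl | rfl | rfl)
    · simp [Link.premises]
    · simp [Link.premises]
    · exact List.nodup_ofFn.2 fun k k' h => by simpa using h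
    · refine List.nodup_ofFn.2 fun k k' h => ?_
      simp only [detourDual] at h
      split_ifs at h with h1 h2 h2
      · rw [h1, h2]
      · simpa using h
    · refine List.nodup_ofFn.2 fun k k' h => ?_
      have hk := k.2
      have hk' := k'.2
      simp only [detourPair] at h
      split_ifs at h with h1 h2 h2 <;> ext <;> omega
  nodup_conclusions := by
    rintro l (⟨k, rfl⟩ | rfl | rfl | rfl | rfl) <;> simp [Link.conclusions]
  existsUnique_conclusion := by
    rintro (k | k | _ | _ | _ | _ | _)
    · refine ⟨_, ⟨Or.inl ⟨k, rfl⟩, by simp [Link.conclusions]⟩, ?_⟩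
      rintro l ⟨⟨k, rfl⟩ | rfl | rfl | rfl | rfl, h⟩ <;> simp_all [Link.conclusions]
    · refine ⟨_, ⟨Or.inl ⟨k, rfl⟩, by simp [Link.conclusions]⟩, ?_⟩
      rintro l ⟨⟨k, rfl⟩ | rfl | rfl | rfl | rfl, h⟩ <;> simp_all [Link.conclusions]
    · refine ⟨_, ⟨Or.inr (Or.inl rfl), by simp [Link.conclusions]⟩, ?_⟩
      rintro l ⟨⟨k, rfl⟩ | rfl | rfl | rfl | rfl, h⟩ <;> simp_all [Link.conclusions]
    · refine ⟨_, ⟨Or.inr (Or.inl rfl), by simp [Link.conclusions]⟩, ?_⟩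
      rintro l ⟨⟨k, rfl⟩ | rfl | rfl | rfl | rfl, h⟩ <;> simp_all [Link.conclusions]
    · refine ⟨_, ⟨Or.inr (Or.inr (Or.inl rfl)), by simp [Link.conclusions]⟩, ?_⟩
      rintro l ⟨⟨k, rfl⟩ | rfl | rfl | rfl | rfl, h⟩ <;> simp_all [Link.conclusions]
    · refine ⟨_, ⟨Or.inr (Or.inr (Or.inr (Or.inl rfl))), by simp [Link.conclusions]⟩, ?_⟩
      rintro l ⟨⟨k, rfl⟩ | rfl | rfl | rfl | rfl, h⟩ <;> simp_all [Link.conclusions]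
    · refine ⟨_, ⟨Or.inr (Or.inr (Or.inr (Or.inr rfl))), by simp [Link.conclusions]⟩, ?_⟩
      rintro l ⟨⟨k, rfl⟩ | rfl | rfl | rfl | rfl, h⟩ <;> simp_all [Link.conclusions]
  unique_premise := by
    have hd : ∀ k v, detourDual j k = v → v = .extraDual ∨ ∃ m, m ≠ j ∧ v = .dual m := by
      rintro k v rfl
      simp only [detourDual]
      split_ifs with h
      exacts [Or.inl rfl, Or.inr ⟨k, h, rfl⟩]
    have hp : ∀ (k : Fin (L i₀).arity) v, detourPair j k = v → v = .concl ∨ v = .dual j := by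
      rintro k v rfl
      simp only [detourPair]
      split_ifs <;> simp
    rintro l (⟨k, rfl⟩ | rfl | rfl | rfl | rfl) l' (⟨k', rfl⟩ | rfl | rfl | rfl | rfl) v h h' <;>
      simp only [Link.premises, List.mem_ofFn, List.not_mem_nil] at h h' <;> first
        | rfl
        | (exfalso
           obtain ⟨k, h⟩ := h
           obtain ⟨k', h'⟩ := h'
           first
             | (obtain rfl | ⟨m, hm, rfl⟩ := hd _ _ h <;> simp at h')
             | (obtain rfl | ⟨m, hm, rfl⟩ := hd _ _ h' <;> simp at h)
             | (obtain rfl | rfl := hp _ _ h <;> simp at h')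
             | (obtain rfl | rfl := hp _ _ h' <;> simp at h)
             | (obtain rfl | rfl := hp _ _ h <;> obtain h1 | ⟨m, hm, h1⟩ := hd _ _ h' <;>
                  simp at h1; exact hm h1.symm)
             | (obtain rfl | rfl := hp _ _ h' <;> obtain h1 | ⟨m, hm, h1⟩ := hd _ _ h <;>
                  simp at h1; exact hm h1.symm))

variable {L i b j i₀ b₀} (h₀ : (L i₀).arity = 2)

theorem detour_links {p : Link L (DetourV (L i).arity) → Prop} :
    (∀ l ∈ (detour L i b j i₀ b₀ h₀).links, p l) ↔ (∀ k, p (.ax (.up k) (.dual k))) ∧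
      p (.ax .extra .extraDual) ∧ p (.conn i b .up .concl) ∧
      p (.conn i (!b) (detourDual j) .conclDual) ∧ p (.conn i₀ b₀ (detourPair j) .product) := by
  constructor
  · exact fun h => ⟨fun k => h _ (Or.inl ⟨k, rfl⟩), h _ (Or.inr (Or.inl rfl)),
      h _ (Or.inr (Or.inr (Or.inl rfl))), h _ (Or.inr (Or.inr (Or.inr (Or.inl rfl)))),
      h _ (Or.inr (Or.inr (Or.inr (Or.inr rfl))))⟩
  · rintro ⟨h1, h2, h3, h4, h5⟩ l (⟨k, rfl⟩ | rfl | rfl | rfl | rfl)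
    exacts [h1 k, h2, h3, h4, h5]

/-- When the par is switched to `j`, its conclusion, its premise `j`, the axiom link there and the
binary link close a cycle. These occurrences form a piece without any connection to the rest. -/
theorem detour_not_sequentializable (hpar : (L i).IsPar b) :
    ¬ (detour L i b j i₀ b₀ h₀).Sequentializable := by
  intro h
  obtain ⟨I, hI, hIj⟩ := exists_isChoice (detour L i b j i₀ b₀ h₀).links (i := i) (b := b)
    .up .concl j
  let X : Set (DetourV (L i).arity) :=
    {v | v = .up j ∨ v = .dual j ∨ v = .concl ∨ v = .product}
  have hX : DetourV.extra ∈ X := by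
    refine h.connected hI (X := X) ?_ (u := .concl) (v := .extra) (by simp [X])
    refine (detour_links h₀).2 ⟨?_, ?_, ?_, ?_, ?_⟩
    · rintro k u v (rfl | rfl) (rfl | rfl) huX <;> simpa [X] using huX
    · rintro u v (rfl | rfl) (rfl | rfl) huX <;> simp [X] at huX
    · rintro u v - (rfl | ⟨-, hv⟩) huX
      · simp [X]
      · rw [hv hpar, hIj]
        simp [X]
    · rintro u v (rfl | ⟨⟨k, rfl⟩, -⟩) - huX
      · simp [X] at huX
      · simp only [X, detourDual] at huX
        split_ifs at huX with hk <;> simp [hk] at huX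
    · rintro u v - (rfl | ⟨⟨k, rfl⟩, -⟩) huX
      · simp [X]
      · simp only [X, detourPair]
        split_ifs with hk <;> simp
  simp [X] at hX

-- When the par is switched to some `m ≠ j`, its conclusion hangs on the axiom link at `m`, hence on
-- the dual link, and the binary link and the axiom link at `j` hang below that conclusion. The
-- result is a tree, whose bridges are separated by explicit sets.
set_option maxHeartbeats 2000000 in
theorem detour_correct {f : Switching L}
    (hf : ∀ P ∈ f i b, ∀ Q ∈ f i (!b), ∀ R ∈ f i₀ b₀,
      (∃ k, k ≠ j ∧ P = keep {k}) ∧ Q = ⊤ ∧ R = ⊤) :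
    (detour L i b j i₀ b₀ h₀).Correct f := by
  rw [ProofStructure.correct_iff]
  intro J hJ
  have hC : .conn i b .up .concl ∈ (detour L i b j i₀ b₀ h₀).links := Or.inr (Or.inr (Or.inl rfl))
  have hC' : .conn i (!b) (detourDual j) .conclDual ∈ (detour L i b j i₀ b₀ h₀).links :=
    Or.inr (Or.inr (Or.inr (Or.inl rfl)))
  have hT : .conn i₀ b₀ (detourPair j) .product ∈ (detour L i b j i₀ b₀ h₀).links :=
    Or.inr (Or.inr (Or.inr (Or.inr rfl)))
  obtain ⟨P, hP, hJP⟩ := hJ _ hC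
  obtain ⟨Q, hQ, hJQ⟩ := hJ _ hC'
  obtain ⟨R, hR, hJR⟩ := hJ _ hT
  obtain ⟨⟨m, hmj, rfl⟩, rfl, rfl⟩ := hf P hP Q hQ R hR
  have hJax : ∀ k, J (.ax (.up k) (.dual k)) = {{.up k, .dual k}} := fun k => hJ _ (Or.inl ⟨k, rfl⟩)
  have hJax' : J (.ax .extra .extraDual) = {{.extra, .extraDual}} := hJ _ (Or.inr (Or.inl rfl))
  have rax : ∀ (X : Set (DetourV (L i).arity)) k, Respects X (J (.ax (.up k) (.dual k))) ↔
      (.up k ∈ X ↔ .dual k ∈ X) := fun X k => by rw [hJax, respects_pair_iff]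
  have rax' : ∀ X : Set (DetourV (L i).arity), Respects X (J (.ax .extra .extraDual)) ↔
      (.extra ∈ X ↔ .extraDual ∈ X) := fun X => by rw [hJax', respects_pair_iff]
  have rC : ∀ X : Set (DetourV (L i).arity), Respects X (J (.conn i b .up .concl)) ↔
      (.concl ∈ X ↔ .up m ∈ X) := fun X => respects_keep_iff (S := detour L i b j i₀ b₀ h₀) hJP
  have rC' : ∀ X : Set (DetourV (L i).arity),
      Respects X (J (.conn i (!b) (detourDual j) .conclDual)) ↔
      (.extraDual ∈ X ↔ .conclDual ∈ X) ∧ ∀ k, k ≠ j → (.dual k ∈ X ↔ .conclDual ∈ X) := by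
    intro X
    rw [respects_top_iff (S := detour L i b j i₀ b₀ h₀) hJQ]
    constructor
    · intro h
      exact ⟨by simpa [detourDual] using h j, fun k hk => by simpa [detourDual, hk] using h k⟩
    · rintro ⟨h1, h2⟩ k
      by_cases hk : k = j
      · simpa [detourDual, hk] using h1
      · simpa [detourDual, hk] using h2 k hk
  have rT : ∀ X : Set (DetourV (L i).arity),
      Respects X (J (.conn i₀ b₀ (detourPair j) .product)) ↔
      (.concl ∈ X ↔ .product ∈ X) ∧ (.dual j ∈ X ↔ .product ∈ X) := by
    intro X
    rw [respects_top_iff (S := detour L i b j i₀ b₀ h₀) hJR]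
    constructor
    · intro h
      exact ⟨by simpa [detourPair] using h ⟨0, by omega⟩,
        by simpa [detourPair] using h ⟨1, by omega⟩⟩
    · rintro ⟨h1, h2⟩ k
      by_cases hk : k.val = 0
      · simpa [detourPair, hk] using h1
      · simpa [detourPair, hk] using h2
  have hjm : j ≠ m := hmj.symm
  constructor
  · intro X hX
    obtain ⟨h1, h2, h3, h4, h5⟩ := (detour_links h₀).1 hX
    rw [rax'] at h2
    rw [rC] at h3
    rw [rC'] at h4
    rw [rT] at h5
    have h1 : ∀ k, DetourV.up k ∈ X ↔ .dual k ∈ X := fun k => (rax X k).1 (h1 k)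
    have hall : ∀ v, v ∈ X ↔ .concl ∈ X := by
      have hcd : .conclDual ∈ X ↔ .concl ∈ X := by rw [h3, h1, h4.2 m hmj]
      have hd : ∀ k, .dual k ∈ X ↔ .concl ∈ X := by
        intro k
        by_cases hk : k = j
        · rw [hk, h5.2, h5.1]
        · rw [h4.2 k hk, hcd]
      rintro (k | k | _ | _ | _ | _ | _)
      exacts [(h1 k).trans (hd k), hd k, h2.trans (h4.1.trans hcd), h4.1.trans hcd, Iff.rfl, hcd,
        h5.1.symm]
    intro u v hu
    exact (hall v).2 ((hall u).1 hu)
  · refine (detour_links h₀).2 ⟨?_, ?_, ?_, ?_, ?_⟩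
    · intro k
      refine separable_pair (hJax k) ?_
      by_cases hk : k = m
      · subst hk
        -- The axiom link at the chosen premise carries the whole side of the par, including the
        -- binary link and the axiom link at `j`.
        refine ⟨{v | v = .up k ∨ v = .concl ∨ v = .product ∨ v = .dual j ∨ v = .up j},
          by simp, by simpa using hmj, (detour_links h₀).2 ⟨?_, ?_, ?_, ?_, ?_⟩⟩
        all_goals clear hJ hJax hJax' hJP hJQ hJR hf hP hQ hR hC hC' hT; intros; simp_all
      · refine ⟨{v | v = .up k}, by simp, by simp, (detour_links h₀).2 ⟨?_, ?_, ?_, ?_, ?_⟩⟩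
        all_goals clear hJ hJax hJax' hJP hJQ hJR hf hP hQ hR hC hC' hT; intros; simp_all [eq_comm]
    · refine separable_pair hJax' ⟨{v | v = .extra}, by simp, by simp,
        (detour_links h₀).2 ⟨?_, ?_, ?_, ?_, ?_⟩⟩
      all_goals clear hJ hJax hJax' hJP hJQ hJR hf hP hQ hR hC hC' hT; intros; simp_all
    · refine separable_keep hC hJP ⟨{v | v = .concl ∨ v = .product ∨ v = .dual j ∨ v = .up j},
        by simp, by simpa using hmj, (detour_links h₀).2 ⟨?_, ?_, ?_, ?_, ?_⟩⟩
      all_goals clear hJ hJax hJax' hJP hJQ hJR hf hP hQ hR hC hC' hT; intros; simp_all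
    · refine separable_top hC' hJQ ?_
      rintro (_ | k)
      · refine ⟨{v | v = .conclDual}, by simp [plug], ?_,
          (detour_links h₀).2 ⟨?_, ?_, ?_, ?_, ?_⟩⟩
        · rintro (_ | k) hk
          · exact (hk rfl).elim
          · simp only [plug, Option.elim, detourDual]
            split_ifs <;> simp
        all_goals clear hJ hJax hJax' hJP hJQ hJR hf hP hQ hR hC hC' hT; intros; simp_all
      by_cases hk : k = j
      · subst hk
        refine ⟨{v | v = .extraDual ∨ v = .extra}, by simp [plug, detourDual], ?_,
          (detour_links h₀).2 ⟨?_, ?_, ?_, ?_, ?_⟩⟩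
        · rintro (_ | k') hk
          · simp [plug]
          · have : k' ≠ k := fun h => hk (by rw [h])
            simp [plug, detourDual, this]
        all_goals clear hJ hJax hJax' hJP hJQ hJR hf hP hQ hR hC hC' hT; intros; simp_all
      · have hkm : ∀ k', some k' ≠ some k → detourDual j k' ≠ .dual k := by
          intro k' h
          simp only [detourDual]
          split_ifs
          · simp
          · simpa using h
        by_cases hm : k = m
        · subst hm
          refine ⟨{v | v = .dual k ∨ v = .up k ∨ v = .concl ∨ v = .product ∨ v = .dual j ∨ v = .up j},
            by simp [plug, detourDual, hk], ?_, (detour_links h₀).2 ⟨?_, ?_, ?_, ?_, ?_⟩⟩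
          · rintro (_ | k') hk'
            · simp [plug]
            · have := hkm k' hk'
              have h2 : detourDual j k' ≠ .dual j := by
                simp only [detourDual]
                split_ifs with h
                · simp
                · simpa using h
              simp only [plug, Option.elim, Set.mem_ofPred_eq, this, h2, false_or]
              simp only [detourDual]
              split_ifs <;> simp
          all_goals clear hJ hJax hJax' hJP hJQ hJR hf hP hQ hR hC hC' hT; intros; simp_all
        · refine ⟨{v | v = .dual k ∨ v = .up k},
            by simp [plug, detourDual, hk], ?_, (detour_links h₀).2 ⟨?_, ?_, ?_, ?_, ?_⟩⟩
          · rintro (_ | k') hk'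
            · simp [plug]
            · have := hkm k' hk'
              simp only [plug, Option.elim, Set.mem_ofPred_eq, this, false_or]
              simp only [detourDual]
              split_ifs <;> simp
          all_goals clear hJ hJax hJax' hJP hJQ hJR hf hP hQ hR hC hC' hT; intros; simp_all [eq_comm]
    · refine separable_top hT hJR ?_
      rintro (_ | k)
      · refine ⟨{v | v = .product}, by simp [plug], ?_, (detour_links h₀).2 ⟨?_, ?_, ?_, ?_, ?_⟩⟩
        · rintro (_ | k) hk
          · exact (hk rfl).elim
          · simp only [plug, Option.elim, detourPair]
            split_ifs <;> simp
        all_goals clear hJ hJax hJax' hJP hJQ hJR hf hP hQ hR hC hC' hT; intros; simp_all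
      by_cases hk : k.val = 0
      -- The first premise of the binary link is the par's conclusion; on its side lies everything
      -- but the binary link's conclusion and the axiom link at `j`.
      · refine ⟨{v | v ≠ .product ∧ v ≠ .dual j ∧ v ≠ .up j}, by simp [plug, detourPair, hk], ?_,
          (detour_links h₀).2 ⟨?_, ?_, ?_, ?_, ?_⟩⟩
        · rintro (_ | k') hk'
          · simp [plug]
          · have : k'.val ≠ 0 := fun h => hk' (by rw [Option.some_inj]; ext; omega)
            simp [plug, detourPair, this]
        all_goals clear hJ hJax hJax' hJP hJQ hJR hf hP hQ hR hC hC' hT; intros; simp_all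
      · refine ⟨{v | v = .dual j ∨ v = .up j}, by simp [plug, detourPair, hk], ?_,
          (detour_links h₀).2 ⟨?_, ?_, ?_, ?_, ?_⟩⟩
        · rintro (_ | k') hk'
          · simp [plug]
          · have : k'.val = 0 := by
              by_contra h
              exact hk' (by rw [Option.some_inj]; ext; omega)
            simp [plug, detourPair, this]
        all_goals clear hJ hJax hJax' hJP hJQ hJR hf hP hQ hR hC hC' hT; intros; simp_all

end Detour

/-! ### A par above which the classes of a position are realized by binary tensors -/

/-- `m` is the next premise after `l` in its class of the position `Q`. -/
def Position.Next {n : ℕ} (Q : Position n) (l m : Fin n) : Prop :=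
  l < m ∧ Q (some l) (some m) ∧ ∀ k, l < k → k < m → ¬ Q (some l) (some k)

namespace Position.Next

variable {n : ℕ} {Q : Position n} {l l' m m' : Fin n}

theorem right_unique (h : Q.Next l m) (h' : Q.Next l m') : m = m' := by
  rcases lt_trichotomy m m' with hlt | heq | hlt
  · exact (h'.2.2 m h.1 hlt h.2.1).elim
  · exact heq
  · exact (h.2.2 m' h'.1 hlt h'.2.1).elim

theorem left_unique (h : Q.Next l m) (h' : Q.Next l' m) : l = l' := by
  have hll : Q (some l) (some l') := Q.trans' h.2.1 (Q.symm' h'.2.1)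
  rcases lt_trichotomy l l' with hlt | heq | hlt
  · exact (h.2.2 l' hlt h'.1 hll).elim
  · exact heq
  · exact (h'.2.2 l hlt h.1 (Q.symm' hll)).elim

/-- A property that is inherited along successive premises is constant on the classes. -/
theorem constant {z : Fin n → Prop} (hz : ∀ l m, Q.Next l m → (z l ↔ z m)) :
    ∀ l m, Q (some l) (some m) → (z l ↔ z m) := by
  classical
  have key : ∀ N : ℕ, ∀ l m : Fin n, m.val = N → l < m → Q (some l) (some m) → (z l ↔ z m) := by
    intro N
    induction N using Nat.strong_induction_on with
    | _ N ih =>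
      intro l m hm hlm hQ
      -- The earlier members of the class of `m`; the largest of them is its predecessor.
      let s : Finset (Fin n) := Finset.univ.filter fun k => k < m ∧ Q (some k) (some m)
      have hs : s.Nonempty := ⟨l, by simp [s, hlm, hQ]⟩
      obtain ⟨k, hks, hmax⟩ := s.exists_max_image id hs
      have hk : k < m ∧ Q (some k) (some m) := by simpa [s] using hks
      have hnext : Q.Next k m := by
        refine ⟨hk.1, hk.2, fun k' h1 h2 h3 => ?_⟩
        have : k' ≤ k := hmax k' (by simpa [s, h2] using Q.trans' (Q.symm' h3) hk.2)
        exact absurd h1 (not_lt.2 this)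
      have hlk : l ≤ k := hmax l (by simp [s, hlm, hQ])
      rcases hlk.lt_or_eq with hlt | rfl
      · exact (ih k.val (hm ▸ hk.1) l k rfl hlt (Q.trans' hQ (Q.symm' hk.2))).trans (hz k m hnext)
      · exact hz _ _ hnext
  intro l m hQ
  rcases lt_trichotomy l m with h | rfl | h
  · exact key _ l m rfl h hQ
  · rfl
  · exact (key _ m l rfl h (Q.symm' hQ)).symm

end Position.Next

/-- When a class of `Q` is drawn as a path, this is the trace on the side of `P` of cutting the path
just after `k`: the set separates the later members of the class of `k` from the others, and is
constant along all other steps. -/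
theorem Glue.exists_above {n : ℕ} {P Q : Position n} (h : Glue P Q) (k : Fin n) :
    ∃ x : Set (Option (Fin n)), P.Invariant x ∧ some k ∉ x ∧
      (∀ l m, Q.Next l m → l ≠ k → (some m ∈ x ↔ some l ∈ x)) ∧
      ∀ m, Q.Next k m → some m ∈ x := by
  obtain ⟨x, y, hx, hxy, hD, hy⟩ := h.separate_right (some k)
    {o | ∃ m, k < m ∧ Q (some k) (some m) ∧ o = some m} (by rintro _ ⟨m, -, hm, rfl⟩; exact hm)
  have hz : ∀ m, Q (some k) (some m) → (some m ∈ x ↔ k < m) := by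
    intro m hm
    rw [hxy, hD _ hm]
    constructor
    · rintro ⟨m', h1, -, h2⟩
      rw [Option.some_inj] at h2
      exact h2 ▸ h1
    · exact fun h => ⟨m, h, hm, rfl⟩
  refine ⟨x, hx, ?_, ?_, ?_⟩
  · rw [hz k (Q.refl' _)]
    exact lt_irrefl k
  · intro l m hlm hlk
    by_cases hkl : Q (some k) (some l)
    · rw [hz l hkl, hz m (Q.trans' hkl hlm.2.1)]
      refine ⟨fun hkm => ?_, fun h => h.trans hlm.1⟩
      rcases lt_trichotomy l k with h | h | h
      · exact (hlm.2.2 k h hkm (Q.symm' hkl)).elim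
      · exact (hlk h).elim
      · exact h
    · rw [hxy, hxy]
      exact ⟨hy _ _ (Q.symm' hlm.2.1) fun h => hkl (Q.trans' h (Q.symm' hlm.2.1)),
        hy _ _ hlm.2.1 hkl⟩
  · intro m hm
    exact (hz m hm.2.1).2 hm.1

/-- The mirror image: the path is cut just before `k`, and the earlier members are separated. -/
theorem Glue.exists_below {n : ℕ} {P Q : Position n} (h : Glue P Q) (k : Fin n) :
    ∃ x : Set (Option (Fin n)), P.Invariant x ∧ some k ∉ x ∧
      (∀ l m, Q.Next l m → m ≠ k → (some m ∈ x ↔ some l ∈ x)) ∧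
      ∀ l, Q.Next l k → some l ∈ x := by
  obtain ⟨x, y, hx, hxy, hD, hy⟩ := h.separate_right (some k)
    {o | ∃ m, m < k ∧ Q (some k) (some m) ∧ o = some m} (by rintro _ ⟨m, -, hm, rfl⟩; exact hm)
  have hz : ∀ m, Q (some k) (some m) → (some m ∈ x ↔ m < k) := by
    intro m hm
    rw [hxy, hD _ hm]
    constructor
    · rintro ⟨m', h1, -, h2⟩
      rw [Option.some_inj] at h2
      exact h2 ▸ h1
    · exact fun h => ⟨m, h, hm, rfl⟩
  refine ⟨x, hx, ?_, ?_, ?_⟩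
  · rw [hz k (Q.refl' _)]
    exact lt_irrefl k
  · intro l m hlm hmk
    by_cases hkl : Q (some k) (some l)
    · rw [hz l hkl, hz m (Q.trans' hkl hlm.2.1)]
      refine ⟨fun h => hlm.1.trans h, fun hlk => ?_⟩
      rcases lt_trichotomy m k with h | h | h
      · exact h
      · exact (hmk h).elim
      · exact (hlm.2.2 k hlk h (Q.symm' hkl)).elim
    · rw [hxy, hxy]
      exact ⟨hy _ _ (Q.symm' hlm.2.1) fun h => hkl (Q.trans' h (Q.symm' hlm.2.1)),
        hy _ _ hlm.2.1 hkl⟩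
  · intro l hl
    exact (hz l (Q.symm' hl.2.1)).2 hl.1

/-- The formula occurrences of `chain`. -/
inductive ChainV (n : ℕ) : Type
  | prem (k : Fin n)
  | tail (k : Fin n)
  | tailDual (k : Fin n)
  | head (k : Fin n)
  | headDual (k : Fin n)
  | concl

instance (n : ℕ) : Finite (ChainV n) := by
  let g : ChainV n → Option (Fin n × Fin 5) := fun v => match v with
    | .prem k => some (k, 0)
    | .tail k => some (k, 1)
    | .tailDual k => some (k, 2)
    | .head k => some (k, 3)
    | .headDual k => some (k, 4)
    | .concl => none
  refine Finite.of_injective g ?_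
  intro v w h
  cases v <;> cases w <;> simp [g] at h ⊢ <;> exact h

/-- A set of occurrences of `chain`. -/
def chainSet {n : ℕ} (x : Set (Option (Fin n))) (t td h hd : Fin n → Prop) : Set (ChainV n) :=
  {v | match v with
    | .prem k => some k ∈ x
    | .tail k => t k
    | .tailDual k => td k
    | .head k => h k
    | .headDual k => hd k
    | .concl => none ∈ x}

/-- The premises of the binary tensors in `chain`. -/
abbrev chainPair {n m : ℕ} (k : Fin n) (j : Fin m) : ChainV n :=
  if j.val = 0 then .tail k else .head k

section Chain

variable {ι : Type*} (L : ι → ConnectivePair) (i : ι) (b : Bool) (Q : Position (L i).arity)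
  (i₀ : ι) (b₀ : Bool)

/-- A link of the connective `(i, b)` each of whose premises is the conclusion of a link of the
binary connective `(i₀, b₀)`; these links are chained up along the classes of `Q` by axioms and
cuts. -/
abbrev chain (h₀ : (L i₀).arity = 2) : ProofStructure L where
  V := ChainV (L i).arity
  finite := inferInstance
  nonempty := ⟨.concl⟩
  label
    | .prem _ => .conn i₀ b₀ fun j => if j.val = 0 then .atom 0 true else .atom 0 false
    | .tail _ => .atom 0 true
    | .tailDual _ => .atom 0 false
    | .head _ => .atom 0 false
    | .headDual _ => .atom 0 true
    | .concl => .conn i b fun _ =>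
        .conn i₀ b₀ fun j => if j.val = 0 then .atom 0 true else .atom 0 false
  links := {l | (∃ k, l = .ax (.tailDual k) (.tail k)) ∨ (∃ k, l = .ax (.headDual k) (.head k)) ∨
    (∃ k m, Q.Next k m ∧ l = .cut (.headDual m) (.tailDual k)) ∨
    (∃ k, l = .conn i₀ b₀ (chainPair k) (.prem k)) ∨ l = .conn i b .prem .concl}
  wellLabelled := by
    rintro l (⟨k, rfl⟩ | ⟨k, rfl⟩ | ⟨k, m, -, rfl⟩ | ⟨k, rfl⟩ | rfl)
    · rfl
    · rfl
    · rfl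
    · simp only [Link.WellLabelled, chainPair]
      congr 1
      funext k
      split_ifs <;> rfl
    · rfl
  nodup_premises := by
    rintro l (⟨k, rfl⟩ | ⟨k, rfl⟩ | ⟨k, m, -, rfl⟩ | ⟨k, rfl⟩ | rfl)
    · simp [Link.premises]
    · simp [Link.premises]
    · simp [Link.premises]
    · refine List.nodup_ofFn.2 fun j j' h => ?_
      have hj := j.2
      have hj' := j'.2
      simp only [chainPair] at h
      split_ifs at h with h1 h2 h2 <;> ext <;> omega
    · exact List.nodup_ofFn.2 fun k k' h => by simpa using h
  nodup_conclusions := by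
    rintro l (⟨k, rfl⟩ | ⟨k, rfl⟩ | ⟨k, m, -, rfl⟩ | ⟨k, rfl⟩ | rfl) <;> simp [Link.conclusions]
  existsUnique_conclusion := by
    rintro (k | k | k | k | k | _)
    · refine ⟨_, ⟨Or.inr (Or.inr (Or.inr (Or.inl ⟨k, rfl⟩))), by simp [Link.conclusions]⟩, ?_⟩
      rintro l ⟨⟨k, rfl⟩ | ⟨k, rfl⟩ | ⟨k, m, -, rfl⟩ | ⟨k, rfl⟩ | rfl, h⟩ <;>
        simp_all [Link.conclusions]
    · refine ⟨_, ⟨Or.inl ⟨k, rfl⟩, by simp [Link.conclusions]⟩, ?_⟩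
      rintro l ⟨⟨k, rfl⟩ | ⟨k, rfl⟩ | ⟨k, m, -, rfl⟩ | ⟨k, rfl⟩ | rfl, h⟩ <;>
        simp_all [Link.conclusions]
    · refine ⟨_, ⟨Or.inl ⟨k, rfl⟩, by simp [Link.conclusions]⟩, ?_⟩
      rintro l ⟨⟨k, rfl⟩ | ⟨k, rfl⟩ | ⟨k, m, -, rfl⟩ | ⟨k, rfl⟩ | rfl, h⟩ <;>
        simp_all [Link.conclusions]
    · refine ⟨_, ⟨Or.inr (Or.inl ⟨k, rfl⟩), by simp [Link.conclusions]⟩, ?_⟩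
      rintro l ⟨⟨k, rfl⟩ | ⟨k, rfl⟩ | ⟨k, m, -, rfl⟩ | ⟨k, rfl⟩ | rfl, h⟩ <;>
        simp_all [Link.conclusions]
    · refine ⟨_, ⟨Or.inr (Or.inl ⟨k, rfl⟩), by simp [Link.conclusions]⟩, ?_⟩
      rintro l ⟨⟨k, rfl⟩ | ⟨k, rfl⟩ | ⟨k, m, -, rfl⟩ | ⟨k, rfl⟩ | rfl, h⟩ <;>
        simp_all [Link.conclusions]
    · refine ⟨_, ⟨Or.inr (Or.inr (Or.inr (Or.inr rfl))), by simp [Link.conclusions]⟩, ?_⟩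
      rintro l ⟨⟨k, rfl⟩ | ⟨k, rfl⟩ | ⟨k, m, -, rfl⟩ | ⟨k, rfl⟩ | rfl, h⟩ <;>
        simp_all [Link.conclusions]
  unique_premise := by
    have hp : ∀ k (j : Fin (L i₀).arity) v, chainPair k j = v →
        v = (.tail k : ChainV (L i).arity) ∨ v = .head k := by
      rintro k j v rfl
      simp only [chainPair]
      split_ifs <;> simp
    rintro l (⟨k, rfl⟩ | ⟨k, rfl⟩ | ⟨k, m, hk, rfl⟩ | ⟨k, rfl⟩ | rfl) l'
      (⟨k', rfl⟩ | ⟨k', rfl⟩ | ⟨k', m', hk', rfl⟩ | ⟨k', rfl⟩ | rfl) v h h' <;>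
      simp only [Link.premises, List.mem_ofFn, List.not_mem_nil, List.mem_cons, or_false] at h h'
    · rcases h with rfl | rfl <;> simp only [reduceCtorEq, or_false, false_or, ChainV.headDual.injEq,
        ChainV.tailDual.injEq] at h'
      · subst h'
        rw [hk.left_unique hk']
      · subst h'
        rw [hk.right_unique hk']
    · obtain ⟨j, h'⟩ := h'
      rcases hp _ _ _ h' with rfl | rfl <;> simp at h
    · obtain ⟨j, h'⟩ := h'
      rcases h with rfl | rfl <;> simp at h'
    · obtain ⟨j, h⟩ := h
      rcases hp _ _ _ h with rfl | rfl <;> simp at h'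
    · obtain ⟨j, h⟩ := h
      obtain ⟨j', h'⟩ := h'
      rcases hp _ _ _ h with rfl | rfl <;> rcases hp _ _ _ h' with h | h <;> simp at h <;> rw [h]
    · obtain ⟨j, h⟩ := h
      obtain ⟨j', h'⟩ := h'
      rcases hp _ _ _ h with rfl | rfl <;> simp at h'
    · obtain ⟨j, h⟩ := h
      rcases h' with rfl | rfl <;> simp at h
    · obtain ⟨j, h⟩ := h
      obtain ⟨j', h'⟩ := h'
      rcases hp _ _ _ h' with rfl | rfl <;> simp at h
    · rfl

variable {L i b Q i₀ b₀} (h₀ : (L i₀).arity = 2)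

theorem chain_links {p : Link L (ChainV (L i).arity) → Prop} :
    (∀ l ∈ (chain L i b Q i₀ b₀ h₀).links, p l) ↔ (∀ k, p (.ax (.tailDual k) (.tail k))) ∧
      (∀ k, p (.ax (.headDual k) (.head k))) ∧
      (∀ k m, Q.Next k m → p (.cut (.headDual m) (.tailDual k))) ∧
      (∀ k, p (.conn i₀ b₀ (chainPair k) (.prem k))) ∧ p (.conn i b .prem .concl) := by
  constructor
  · exact fun h => ⟨fun k => h _ (Or.inl ⟨k, rfl⟩), fun k => h _ (Or.inr (Or.inl ⟨k, rfl⟩)),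
      fun k m hk => h _ (Or.inr (Or.inr (Or.inl ⟨k, m, hk, rfl⟩))),
      fun k => h _ (Or.inr (Or.inr (Or.inr (Or.inl ⟨k, rfl⟩)))),
      h _ (Or.inr (Or.inr (Or.inr (Or.inr rfl))))⟩
  · rintro ⟨h1, h2, h3, h4, h5⟩ l (⟨k, rfl⟩ | ⟨k, rfl⟩ | ⟨k, m, hk, rfl⟩ | ⟨k, rfl⟩ | rfl)
    exacts [h1 k, h2 k, h3 k m hk, h4 k, h5]

/-- With premise `j` chosen at the par, only the path that imitates the class of `j` hangs on the
conclusion; the path through `j'` is another component. -/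
theorem chain_not_sequentializable (hpar : (L i).IsPar b) {j j' : Fin (L i).arity}
    (hj : ¬ Q (some j) (some j')) : ¬ (chain L i b Q i₀ b₀ h₀).Sequentializable := by
  intro h
  obtain ⟨I, hI, hIj⟩ := exists_isChoice (chain L i b Q i₀ b₀ h₀).links (i := i) (b := b)
    .prem .concl j
  let z : Fin (L i).arity → Prop := fun k => Q (some j) (some k)
  -- All occurrences on the path of the class of `j`, and the conclusion of the par.
  let X : Set (ChainV (L i).arity) := chainSet {o | ∀ k, o = some k → z k} z z z z
  have hX : ChainV.tail j' ∈ X := by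
    refine h.connected hI (X := X) ?_ (u := .concl) (v := .tail j') (fun k hk => nomatch hk)
    have hprem : ∀ k, ChainV.prem k ∈ X ↔ z k :=
      fun k => ⟨fun h => h k rfl, fun h k' hk' => Option.some.inj hk' ▸ h⟩
    refine (chain_links h₀).2 ⟨?_, ?_, ?_, ?_, ?_⟩
    · rintro k u v (rfl | rfl) (rfl | rfl) huX <;> exact huX
    · rintro k u v (rfl | rfl) (rfl | rfl) huX <;> exact huX
    · rintro k m hkm u v (rfl | rfl) (rfl | rfl) huX
      exacts [huX, Q.trans' huX (Q.symm' hkm.2.1), Q.trans' huX hkm.2.1, huX]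
    · have hz : ∀ k v, Link.Joined I (.conn i₀ b₀ (chainPair k) (.prem k)) v → (v ∈ X ↔ z k) := by
        rintro k v (rfl | ⟨⟨m, rfl⟩, -⟩)
        · exact hprem k
        · simp only [chainPair]
          split_ifs <;> rfl
      intro k u v hu hv
      rw [hz k u hu, hz k v hv]
      exact id
    · rintro u v - (rfl | ⟨-, hv⟩) -
      · exact fun k hk => nomatch hk
      · rw [hv hpar, hIj, hprem]
  exact hj hX

-- Binary tensors in the full position turn each class of `Q` into a path through its premises. A
-- path connects as much as the class does and has no cycle, so the gluing with `Q`, without the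
-- conclusion of `Q`, is reproduced. Bridges inside a path are separated by `Glue.exists_above` and
-- `Glue.exists_below`.
set_option maxHeartbeats 800000 in
theorem chain_correct {f : Switching L} (hf : ∀ P ∈ f i b, Glue P Q) (hf₀ : ∀ R ∈ f i₀ b₀, R = ⊤) :
    (chain L i b Q i₀ b₀ h₀).Correct f := by
  rw [ProofStructure.correct_iff]
  intro J hJ
  have hC : .conn i b .prem .concl ∈ (chain L i b Q i₀ b₀ h₀).links :=
    Or.inr (Or.inr (Or.inr (Or.inr rfl)))
  have hT : ∀ k, .conn i₀ b₀ (chainPair k) (.prem k) ∈ (chain L i b Q i₀ b₀ h₀).links :=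
    fun k => Or.inr (Or.inr (Or.inr (Or.inl ⟨k, rfl⟩)))
  obtain ⟨P, hP, hJP⟩ := hJ _ hC
  have hJP : J (.conn i b .prem .concl) = P.groups .prem .concl := hJP
  have hJT : ∀ k, J (.conn i₀ b₀ (chainPair k) (.prem k)) =
      (⊤ : Position (L i₀).arity).groups (chainPair k) (.prem k) := by
    intro k
    obtain ⟨R, hR, hJR⟩ := hJ _ (hT k)
    rw [← hf₀ R hR]
    exact hJR
  have hJt : ∀ k, J (.ax (.tailDual k) (.tail k)) = {{.tailDual k, .tail k}} :=
    fun k => hJ _ (Or.inl ⟨k, rfl⟩)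
  have hJh : ∀ k, J (.ax (.headDual k) (.head k)) = {{.headDual k, .head k}} :=
    fun k => hJ _ (Or.inr (Or.inl ⟨k, rfl⟩))
  have hJc : ∀ k m, Q.Next k m → J (.cut (.headDual m) (.tailDual k)) =
      {{.headDual m, .tailDual k}} := fun k m hk => hJ _ (Or.inr (Or.inr (Or.inl ⟨k, m, hk, rfl⟩)))
  have rt : ∀ (X : Set (ChainV (L i).arity)) k, Respects X (J (.ax (.tailDual k) (.tail k))) ↔
      (.tailDual k ∈ X ↔ .tail k ∈ X) := fun X k => by rw [hJt, respects_pair_iff]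
  have rh : ∀ (X : Set (ChainV (L i).arity)) k, Respects X (J (.ax (.headDual k) (.head k))) ↔
      (.headDual k ∈ X ↔ .head k ∈ X) := fun X k => by rw [hJh, respects_pair_iff]
  have rc : ∀ (X : Set (ChainV (L i).arity)) k m, Q.Next k m →
      (Respects X (J (.cut (.headDual m) (.tailDual k))) ↔
      (.headDual m ∈ X ↔ .tailDual k ∈ X)) := fun X k m hk => by rw [hJc k m hk, respects_pair_iff]
  have rT : ∀ (X : Set (ChainV (L i).arity)) k,
      Respects X (J (.conn i₀ b₀ (chainPair k) (.prem k))) ↔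
      (.tail k ∈ X ↔ .prem k ∈ X) ∧ (.head k ∈ X ↔ .prem k ∈ X) := by
    intro X k
    rw [respects_top_iff (S := chain L i b Q i₀ b₀ h₀) (hJT k)]
    constructor
    · intro h
      exact ⟨by simpa [chainPair] using h ⟨0, by omega⟩,
        by simpa [chainPair] using h ⟨1, by omega⟩⟩
    · rintro ⟨h1, h2⟩ j
      by_cases hj : j.val = 0
      · simpa [chainPair, hj] using h1
      · simpa [chainPair, hj] using h2
  have rC : ∀ X : Set (ChainV (L i).arity), Respects X (J (.conn i b .prem .concl)) ↔
      P.Invariant (plug .prem .concl ⁻¹' X) := by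
    intro X
    rw [hJP, Position.respects_groups_iff]
  have hplug : ∀ (x : Set (Option (Fin (L i).arity))) t td h hd,
      plug .prem .concl ⁻¹' chainSet x t td h hd = x := by
    intro x t td h hd
    ext (_ | k) <;> rfl
  have hg := hf P hP
  -- The conditions under which a set, given by its components, cuts no link except possibly `l₀`.
  have sep : ∀ (l₀ : Link L (ChainV (L i).arity)) x t td h hd,
      (∀ k, .ax (.tailDual k) (.tail k) ≠ l₀ → (td k ↔ t k)) →
      (∀ k, .ax (.headDual k) (.head k) ≠ l₀ → (hd k ↔ h k)) →
      (∀ k m, Q.Next k m → .cut (.headDual m) (.tailDual k) ≠ l₀ → (hd m ↔ td k)) →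
      (∀ k, .conn i₀ b₀ (chainPair k) (.prem k) ≠ l₀ →
        (t k ↔ some k ∈ x) ∧ (h k ↔ some k ∈ x)) →
      (.conn i b .prem .concl ≠ l₀ → P.Invariant x) →
      ∀ l ∈ (chain L i b Q i₀ b₀ h₀).links, l ≠ l₀ → Respects (chainSet x t td h hd) (J l) := by
    intro l₀ x t td h hd h1 h2 h3 h4 h5
    refine (chain_links h₀).2 ⟨fun k hk => (rt _ k).2 (h1 k hk), fun k hk => (rh _ k).2 (h2 k hk),
      fun k m hk hne => (rc _ k m hk).2 (h3 k m hk hne), fun k hk => (rT _ k).2 (h4 k hk),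
      fun hne => (rC _).2 ?_⟩
    rw [hplug]
    exact h5 hne
  clear hJ hf hf₀
  constructor
  · intro X hX
    obtain ⟨h1, h2, h3, h4, h5⟩ := (chain_links h₀).1 hX
    have h1 := fun k => (rt X k).1 (h1 k)
    have h2 := fun k => (rh X k).1 (h2 k)
    have h3 := fun k m hk => (rc X k m hk).1 (h3 k m hk)
    have h4 := fun k => (rT X k).1 (h4 k)
    rw [rC] at h5
    obtain ⟨k₀, hk₀⟩ := hg.exists_right_none
    have hconst : ∀ l m, Q (some l) (some m) → (.prem l ∈ X ↔ .prem m ∈ X) :=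
      Position.Next.constant fun l m hlm => by
        rw [← (h4 l).1, ← (h4 m).2, ← h1, ← h2, h3 l m hlm]
    -- The missing conclusion of `Q` is treated like the premise `k₀` that `Q` joins to it.
    have hy : Q.Invariant {o | .prem (o.getD k₀) ∈ X} := by
      rintro (_ | l) (_ | m) ho h
      · exact h
      · exact (hconst _ _ (Q.trans' (Q.symm' hk₀) ho)).1 h
      · exact (hconst _ _ (Q.trans' ho hk₀)).1 h
      · exact (hconst _ _ ho).1 h
    intro u v hu
    have hall : ∀ v : ChainV (L i).arity, ∃ o, v ∈ X ↔ plug .prem .concl o ∈ X := by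
      rintro (k | k | k | k | k | _)
      · exact ⟨some k, Iff.rfl⟩
      · exact ⟨some k, (h4 k).1⟩
      · exact ⟨some k, (h1 k).trans (h4 k).1⟩
      · exact ⟨some k, (h4 k).2⟩
      · exact ⟨some k, (h2 k).trans (h4 k).2⟩
      · exact ⟨none, Iff.rfl⟩
    obtain ⟨o, ho⟩ := hall u
    obtain ⟨o', ho'⟩ := hall v
    rcases hg.conn _ _ h5 hy (fun j => Iff.rfl) with ⟨h, -⟩ | ⟨h, -⟩ <;> rw [Set.ext_iff] at h
    · exact ((h o).1 (ho.1 hu)).elim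
    · exact ho'.2 ((h o').2 trivial)
  · refine (chain_links h₀).2 ⟨?_, ?_, ?_, ?_, ?_⟩
    · intro k
      obtain ⟨x, hx, hk, hne, hnext⟩ := hg.exists_above k
      refine separable_pair (hJt k) ⟨chainSet x (some · ∈ x) (fun m => m = k ∨ some m ∈ x)
        (some · ∈ x) (some · ∈ x), Or.inl rfl, hk, sep _ _ _ _ _ _ ?_ ?_ ?_ ?_ fun _ => hx⟩
      · intro m hm
        have : m ≠ k := by
          rintro rfl
          exact hm rfl
        simp [this]
      · exact fun _ _ => Iff.rfl
      · intro l m hlm _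
        by_cases hl : l = k
        · simp [hl, hnext m (hl ▸ hlm)]
        · simp [hl, hne l m hlm hl]
      · exact fun _ _ => ⟨Iff.rfl, Iff.rfl⟩
    · intro k
      obtain ⟨x, hx, hk, hne, hnext⟩ := hg.exists_below k
      refine separable_pair (hJh k) ⟨chainSet x (some · ∈ x) (some · ∈ x) (some · ∈ x)
        (fun m => m = k ∨ some m ∈ x), Or.inl rfl, hk, sep _ _ _ _ _ _ ?_ ?_ ?_ ?_ fun _ => hx⟩
      · exact fun _ _ => Iff.rfl
      · intro m hm
        have : m ≠ k := by
          rintro rfl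
          exact hm rfl
        simp [this]
      · intro l m hlm _
        by_cases hm : m = k
        · simp [hm, hnext l (hm ▸ hlm)]
        · simp [hm, hne l m hlm hm]
      · exact fun _ _ => ⟨Iff.rfl, Iff.rfl⟩
    · intro k m hkm
      obtain ⟨x, hx, hk, hne, hnext⟩ := hg.exists_above k
      refine separable_pair (hJc k m hkm) ⟨chainSet x (some · ∈ x) (some · ∈ x) (some · ∈ x)
        (some · ∈ x), hnext m hkm, hk, sep _ _ _ _ _ _ ?_ ?_ ?_ ?_ fun _ => hx⟩
      · exact fun _ _ => Iff.rfl
      · exact fun _ _ => Iff.rfl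
      · intro l m' hlm hl
        refine hne l m' hlm ?_
        rintro rfl
        rw [hlm.right_unique hkm] at hl
        exact hl rfl
      · exact fun _ _ => ⟨Iff.rfl, Iff.rfl⟩
    · intro k
      have hpk : ∀ m : Fin (L i).arity,
          (Link.conn i₀ b₀ (chainPair m) (.prem m) : Link L (ChainV (L i).arity)) ≠
          .conn i₀ b₀ (chainPair k) (.prem k) → m ≠ k := by
        rintro m h rfl
        exact h rfl
      refine separable_top (hT k) (hJT k) ?_
      rintro (_ | j)
      -- Separating the tensor's conclusion from both of its premises corresponds to cutting the
      -- axiom link at `k` in the excluded middle: `x` rules on the par's side, `y` on the paths.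
      · obtain ⟨x, y, hx, hy, hxy, h1, h2⟩ := hg.ax k
        refine ⟨chainSet x (some · ∈ y) (some · ∈ y) (some · ∈ y) (some · ∈ y), h1, ?_,
          sep _ _ _ _ _ _ ?_ ?_ ?_ ?_ fun _ => hx⟩
        · rintro (_ | j) hne
          · exact (hne rfl).elim
          · simp only [plug, Option.elim, chainPair]
            split_ifs <;> exact h2
        · exact fun _ _ => Iff.rfl
        · exact fun _ _ => Iff.rfl
        · exact fun l m hlm _ => ⟨hy _ _ (Q.symm' hlm.2.1), hy _ _ hlm.2.1⟩
        · exact fun m hm => ⟨(hxy m (hpk m hm)).symm, (hxy m (hpk m hm)).symm⟩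
      by_cases hj : j.val = 0
      · obtain ⟨x, hx, hk, hne, hnext⟩ := hg.exists_above k
        refine ⟨chainSet x (fun m => m = k ∨ some m ∈ x) (fun m => m = k ∨ some m ∈ x)
          (some · ∈ x) (some · ∈ x), ?_, ?_, sep _ _ _ _ _ _ ?_ ?_ ?_ ?_ fun _ => hx⟩
        · simp only [plug, Option.elim, chainPair, if_pos hj]
          exact Or.inl rfl
        · rintro (_ | j') hne
          · exact hk
          · have : j'.val ≠ 0 := fun h => hne (by rw [Option.some_inj]; ext; omega)
            simp only [plug, Option.elim, chainPair, if_neg this]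
            exact hk
        · exact fun _ _ => Iff.rfl
        · exact fun _ _ => Iff.rfl
        · intro l m hlm _
          by_cases hl : l = k
          · simp [hl, hnext m (hl ▸ hlm)]
          · simp [hl, hne l m hlm hl]
        · intro m hm
          simp [hpk m hm]
      · obtain ⟨x, hx, hk, hne, hnext⟩ := hg.exists_below k
        refine ⟨chainSet x (some · ∈ x) (some · ∈ x) (fun m => m = k ∨ some m ∈ x)
          (fun m => m = k ∨ some m ∈ x), ?_, ?_, sep _ _ _ _ _ _ ?_ ?_ ?_ ?_ fun _ => hx⟩
        · simp only [plug, Option.elim, chainPair, if_neg hj]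
          exact Or.inl rfl
        · rintro (_ | j') hne
          · exact hk
          · have : j'.val = 0 := by
              by_contra h
              exact hne (by rw [Option.some_inj]; ext; omega)
            simp only [plug, Option.elim, chainPair, if_pos this]
            exact hk
        · exact fun _ _ => Iff.rfl
        · exact fun _ _ => Iff.rfl
        · intro l m hlm _
          by_cases hm : m = k
          · simp [hm, hnext l (hm ▸ hlm)]
          · simp [hm, hne l m hlm hm]
        · intro m hm
          simp [hpk m hm]
    · refine (separable_conn_iff ((chain L i b Q i₀ b₀ h₀).plug_injective hC) hJP).2 fun o => ?_
      obtain ⟨x, y, hy, hxy, h1, h2, h3⟩ := hg.left o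
      let X : Set (ChainV (L i).arity) :=
        chainSet x (some · ∈ x) (some · ∈ x) (some · ∈ x) (some · ∈ x)
      have hX : ∀ o, plug .prem .concl o ∈ X ↔ o ∈ x := by
        rintro (_ | o) <;> rfl
      refine ⟨X, (hX o).2 h1, fun o' h h' h'' => h2 o' h h' ((hX o').1 h''),
        fun o₁ o₂ h12 h h' => (hX o₂).2 (h3 o₁ o₂ h12 h ((hX o₁).1 h')),
        sep _ _ _ _ _ _ ?_ ?_ ?_ ?_ ?_⟩
      · exact fun _ _ => Iff.rfl
      · exact fun _ _ => Iff.rfl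
      · intro l m hlm _
        rw [hxy, hxy]
        exact ⟨hy _ _ (Q.symm' hlm.2.1), hy _ _ hlm.2.1⟩
      · exact fun _ _ => ⟨Iff.rfl, Iff.rfl⟩
      · exact fun h => (h rfl).elim

end Chain

/-! ### The two properties determine the switching -/

section Necessity

variable {ι : Type*} {L : ι → ConnectivePair} {f : Switching L}

theorem ExpansionProperty.glue (hexp : ExpansionProperty f) {i : ι} {b : Bool}
    {P Q : Position (L i).arity} (hP : P ∈ f i b) (hQ : Q ∈ f i (!b)) : Glue P Q :=
  excludedMiddle_correct_iff.1 (hexp i b fun _ => .atom 0 true) P hP Q hQ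

/-- If this failed, `detour` would be correct. Besides supplying the premise `j`, the statement
shows that the three sets of positions are nonempty. -/
theorem exists_detour_positions (hseq : SequentializationTheorem f) {i i₀ : ι} {b : Bool}
    (b₀ : Bool) (hpar : (L i).IsPar b) (h₀ : (L i₀).arity = 2) (j : Fin (L i).arity) :
    ∃ P ∈ f i b, ∃ Q ∈ f i (!b), ∃ R ∈ f i₀ b₀, (∃ k, k ≠ j ∧ P = keep {k}) → Q = ⊤ → R ≠ ⊤ := by
  by_contra hc
  push Not at hc
  refine detour_not_sequentializable (j := j) (b₀ := b₀) h₀ hpar (hseq _ (detour_correct h₀ ?_))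
  exact fun P hP Q hQ R hR => hc P hP Q hQ R hR

/-- `R` joins two premises, for otherwise `singleLink` would be correct. In arity two these are all
the premises, and the conclusion is joined to one of them. -/
theorem eq_top_of_binary (hexp : ExpansionProperty f) (hseq : SequentializationTheorem f) {i : ι}
    {b : Bool} (hpar : (L i).IsPar b) (h₀ : (L i).arity = 2) :
    ∀ R ∈ f i (!b), R = ⊤ := by
  intro R hR
  have hglue : ∀ P ∈ f i b, Glue P R := fun P hP => hexp.glue hP hR
  -- Only the existence of a position of the par is used here.
  obtain ⟨P, hP, -⟩ := exists_detour_positions hseq b hpar h₀ ⟨0, by omega⟩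
  obtain ⟨k, hk⟩ := (hglue P hP).exists_right_none
  have h01 : (⟨0, by omega⟩ : Fin (L i).arity) ≠ ⟨1, by omega⟩ := by simp
  have hex : ∃ j j', j ≠ j' ∧ R (some j) (some j') := by
    by_contra hc
    push Not at hc
    refine singleLink_not_sequentializable hpar h01 (hseq _ (singleLink_correct ?_ hglue))
    intro j j' h
    by_contra hne
    exact hc j j' hne h
  obtain ⟨j, j', hne, hjj⟩ := hex
  have hall : ∀ m, R none (some m) := by
    have hm : ∀ m, m = j ∨ m = j' := by
      intro m
      have h1 := m.2
      have h2 := j.2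
      have h3 := j'.2
      have h4 : j.val ≠ j'.val := fun h => hne (Fin.ext h)
      by_cases h : m.val = j.val
      · exact Or.inl (Fin.ext h)
      · right
        ext
        omega
    have hj : R none (some j) := by
      rcases hm k with rfl | rfl
      exacts [hk, R.trans' hk (R.symm' hjj)]
    intro m
    rcases hm m with rfl | rfl
    exacts [hj, R.trans' hj hjj]
  refine Setoid.ext fun o o' => ⟨fun _ => trivial, fun _ => ?_⟩
  have hno : ∀ o, R none o := by
    rintro (_ | m)
    exacts [R.refl' _, hall m]
  exact R.trans' (R.symm' (hno o)) (hno o')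

/-- A switching with both properties is the par-switching. -/
theorem isParSwitching_of_expansion_of_sequentialization
    (hL : ∃ i b, (L i).arity = 2 ∧ (L i).IsPar b) (hexp : ExpansionProperty f)
    (hseq : SequentializationTheorem f) : IsParSwitching f := by
  obtain ⟨i₀, b₀, h₀, hpar₀⟩ := hL
  have hR := eq_top_of_binary hexp hseq hpar₀ h₀
  have htensor : ∀ i b, (L i).IsPar b → ∀ Q ∈ f i (!b), Q = ⊤ := by
    intro i b hpar Q hQ
    have hglue : ∀ P ∈ f i b, Glue P Q := fun P hP => hexp.glue hP hQ
    by_contra hne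
    obtain ⟨P, hP, -⟩ := exists_detour_positions hseq b₀ hpar h₀ ⟨0, (L i).arity_pos⟩
    obtain ⟨k, hk⟩ := (hglue P hP).exists_right_none
    have hex : ∃ j j', ¬ Q (some j) (some j') := by
      by_contra hc
      push Not at hc
      refine hne (Setoid.ext fun o o' => ⟨fun _ => trivial, fun _ => ?_⟩)
      have hno : ∀ o, Q none o := by
        rintro (_ | m)
        exacts [Q.refl' _, Q.trans' hk (hc k m)]
      exact Q.trans' (Q.symm' (hno o)) (hno o')
    obtain ⟨j, j', hjj⟩ := hex
    exact chain_not_sequentializable h₀ hpar hjj (hseq _ (chain_correct h₀ hglue hR))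
  have htop : ∀ i b, (L i).IsPar b → f i (!b) = {⊤} := by
    intro i b hpar
    obtain ⟨-, -, Q, hQ, -⟩ := exists_detour_positions hseq b₀ hpar h₀ ⟨0, (L i).arity_pos⟩
    exact (Set.Nonempty.subset_singleton_iff ⟨Q, hQ⟩).1 (htensor i b hpar)
  have hkeep : ∀ i b, (L i).IsPar b → ∀ P ∈ f i b, ∃ j, P = keep {j} := by
    intro i b hpar P hP
    have hQ : (⊤ : Position _) ∈ f i (!b) := by
      rw [htop i b hpar]
      rfl
    exact (hexp.glue hP hQ).eq_keep
  have hpars : ∀ i b, (L i).IsPar b → f i b = {P | ∃ j, P = keep {j}} := by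
    intro i b hpar
    refine Set.Subset.antisymm (hkeep i b hpar) ?_
    rintro _ ⟨j, rfl⟩
    -- The binary link is now the tensor `(i₀, !b₀)`, so that `R` is known to be full.
    obtain ⟨P, hP, Q, hQ, R, hR', himp⟩ := exists_detour_positions hseq (!b₀) hpar h₀ j
    obtain ⟨k, rfl⟩ := hkeep i b hpar P hP
    by_cases hk : k = j
    · exact hk ▸ hP
    · exact (himp ⟨k, hk, rfl⟩ (htensor i b hpar Q hQ) (hR R hR')).elim
  intro i b
  rcases isPar_or_isPar_not_of_sequentializable
    (hseq _ (hexp i b fun _ => .atom 0 true)) with h | h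
  · exact Or.inl ⟨h, hpars i b h⟩
  · right
    have h1 := h.isTensor_not
    have h2 := htop i _ h
    rw [Bool.not_not] at h1 h2
    exact ⟨h1, by rw [h2, keep_univ]⟩

end Necessity

/-- The two alternatives of the par-switching overlap only in arity one, where their positions agree
as well. -/
theorem ConnectivePair.subsingleton_of_isPar_of_isTensor {C : ConnectivePair} {b : Bool}
    (h : C.IsPar b) (h' : C.IsTensor b) : Subsingleton (Fin C.arity) := by
  have htop : (⊤ : Setoid (Fin C.arity)) = ⊥ := by
    have : ({⊤} : Set (Setoid (Fin C.arity))) = {⊥} := h.symm.trans h'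
    simpa using this
  refine ⟨fun a b => ?_⟩
  have : (⊤ : Setoid (Fin C.arity)) a b := trivial
  rw [htop] at this
  exact this

theorem IsParSwitching.eq_keep {ι : Type*} {L : ι → ConnectivePair} {f : Switching L}
    (hf : IsParSwitching f) {i : ι} {b : Bool} (h : (L i).IsPar b) :
    f i b = {P | ∃ j, P = keep {j}} := by
  rcases hf i b with ⟨-, h'⟩ | ⟨h', hfi⟩
  · exact h'
  · have := ConnectivePair.subsingleton_of_isPar_of_isTensor h h'
    have hu : ∀ j : Fin (L i).arity, ({j} : Set (Fin (L i).arity)) = Set.univ :=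
      fun j => Set.eq_univ_of_forall fun k => Subsingleton.elim k j
    rw [hfi]
    ext P
    constructor
    · rintro rfl
      exact ⟨⟨0, (L i).arity_pos⟩, by rw [hu]⟩
    · rintro ⟨j, rfl⟩
      rw [hu]
      rfl

theorem IsParSwitching.eq_top {ι : Type*} {L : ι → ConnectivePair} {f : Switching L}
    (hf : IsParSwitching f) {i : ι} {b : Bool} (h : (L i).IsTensor b) :
    f i b = {⊤} := by
  rcases hf i b with ⟨h', -⟩ | ⟨-, hfi⟩
  · have := ConnectivePair.subsingleton_of_isPar_of_isTensor h' h
    have hu : ∀ j : Fin (L i).arity, ({j} : Set (Fin (L i).arity)) = Set.univ :=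
      fun j => Set.eq_univ_of_forall fun k => Subsingleton.elim k j
    rw [hf.eq_keep h']
    ext P
    constructor
    · rintro ⟨j, rfl⟩
      rw [hu, keep_univ]
      rfl
    · rintro rfl
      exact ⟨⟨0, (L i).arity_pos⟩, by rw [hu, keep_univ]⟩
  · rw [hfi, keep_univ]

/-- The par-switching has the expansion property. -/
theorem IsParSwitching.expansionProperty {ι : Type*} {L : ι → ConnectivePair} {f : Switching L}
    (hf : IsParSwitching f) : ExpansionProperty f := by
  intro i b A
  rw [excludedMiddle_correct_iff]
  intro P hP Q hQ
  rcases hf i b with ⟨h, -⟩ | ⟨h, -⟩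
  · rw [hf.eq_keep h] at hP
    rw [hf.eq_top h.isTensor_not] at hQ
    obtain ⟨j, rfl⟩ := hP
    rw [show Q = ⊤ from hQ]
    exact glue_keep_top j
  · rw [hf.eq_top h] at hP
    rw [hf.eq_keep h.isPar_not] at hQ
    obtain ⟨j, rfl⟩ := hQ
    rw [show P = ⊤ from hP]
    exact (glue_keep_top j).symm

/-! ### Correctness for the par-switching -/

/-- All correctness graphs of the par-switching are connected and acyclic, in terms of sets of
occurrences. -/
structure ParCorrect {ι : Type*} {L : ι → ConnectivePair} (S : ProofStructure L) : Prop where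
  conn : ∀ I, IsChoice S.links I → ∀ X : Set S.V, (∀ l ∈ S.links, l.Uncut I X) →
    ∀ u v, u ∈ X → v ∈ X
  acyc : ∀ I, IsChoice S.links I → ∀ l ∈ S.links, ∀ v, l.Joined I v → ∃ X : Set S.V, v ∈ X ∧
    (∀ u, l.Joined I u → u ≠ v → u ∉ X) ∧ ∀ l' ∈ S.links, l' ≠ l → l'.Uncut I X

open Classical in
/-- The states of the links that correspond to a choice of premises of the par links. -/
noncomputable def choiceStates {ι : Type*} {L : ι → ConnectivePair} {V : Type}
    (I : Link L V → V) : Link L V → Set (Set V)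
  | .ax u v => {{u, v}}
  | .cut u v => {{u, v}}
  | .conn i b prem c =>
      if (L i).IsPar b then (keep {k | prem k = I (.conn i b prem c)}).groups prem c
      else (⊤ : Position _).groups prem c

theorem choiceStates_par {ι : Type*} {L : ι → ConnectivePair} {S : ProofStructure L}
    {I : Link L S.V → S.V} {i : ι} {b : Bool} {prem : Fin (L i).arity → S.V} {c : S.V}
    (hl : .conn i b prem c ∈ S.links) (hpar : (L i).IsPar b) {k : Fin (L i).arity}
    (hk : prem k = I (.conn i b prem c)) :
    choiceStates I (.conn i b prem c) = (keep {k} : Position _).groups prem c := by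
  have : {k' | prem k' = I (.conn i b prem c)} = {k} := by
    ext k'
    constructor
    · exact fun h => S.prem_injective hl (Eq.trans h hk.symm)
    · rintro rfl
      exact hk
  simp only [choiceStates, if_pos hpar, this]

theorem choiceStates_not_par {ι : Type*} {L : ι → ConnectivePair} {V : Type}
    {I : Link L V → V} {i : ι} {b : Bool} {prem : Fin (L i).arity → V} {c : V}
    (hpar : ¬ (L i).IsPar b) :
    choiceStates I (.conn i b prem c) = (⊤ : Position _).groups prem c := by
  simp only [choiceStates, if_neg hpar]

/-- A choice of premises selects an allowed state of each link. The singleton groups of unchosen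
premises separate nothing, so only the occurrences in `Link.Joined` matter. -/
theorem IsParSwitching.parCorrect {ι : Type*} {L : ι → ConnectivePair} {f : Switching L}
    (hf : IsParSwitching f) {S : ProofStructure L} (hS : S.Correct f) : ParCorrect S := by
  rw [ProofStructure.correct_iff] at hS
  have htree : ∀ I, IsChoice S.links I → TreeLike S (choiceStates I) := by
    intro I hI
    refine hS _ fun l hl => ?_
    match l, hl with
    | .ax u v, _ => rfl
    | .cut u v, _ => rfl
    | .conn i b prem c, hl =>
      by_cases hpar : (L i).IsPar b
      · obtain ⟨k, hk⟩ := hI i b prem c hl hpar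
        refine ⟨keep {k}, ?_, choiceStates_par hl hpar hk⟩
        rw [hf.eq_keep hpar]
        exact ⟨k, rfl⟩
      · refine ⟨⊤, ?_, choiceStates_not_par hpar⟩
        rcases hf i b with ⟨h, -⟩ | ⟨-, h⟩
        · exact (hpar h).elim
        · rw [h, keep_univ]
          rfl
  have hresp : ∀ I, IsChoice S.links I → ∀ X, ∀ l ∈ S.links,
      Respects X (choiceStates I l) ↔ l.Uncut I X := by
    intro I hI X l hl
    match l, hl with
    | .ax u v, _ =>
      refine Iff.trans (b := u ∈ X ↔ v ∈ X) respects_pair_iff ⟨?_, fun h => ?_⟩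
      · rintro h a a' (rfl | rfl) (rfl | rfl)
        exacts [id, h.1, h.2, id]
      · exact ⟨h u v (Or.inl rfl) (Or.inr rfl), h v u (Or.inr rfl) (Or.inl rfl)⟩
    | .cut u v, _ =>
      refine Iff.trans (b := u ∈ X ↔ v ∈ X) respects_pair_iff ⟨?_, fun h => ?_⟩
      · rintro h a a' (rfl | rfl) (rfl | rfl)
        exacts [id, h.1, h.2, id]
      · exact ⟨h u v (Or.inl rfl) (Or.inr rfl), h v u (Or.inr rfl) (Or.inl rfl)⟩
    | .conn i b prem c, hl =>
      by_cases hpar : (L i).IsPar b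
      · obtain ⟨k, hk⟩ := hI i b prem c hl hpar
        rw [respects_keep_iff (choiceStates_par hl hpar hk)]
        constructor
        · rintro h u v (rfl | ⟨-, hu⟩) (rfl | ⟨-, hv⟩)
          · exact id
          · rw [hv hpar, ← hk]
            exact h.1
          · rw [hu hpar, ← hk]
            exact h.2
          · rw [hu hpar, hv hpar]
            exact id
        · intro h
          have hj : Link.Joined I (.conn i b prem c) (prem k) := Or.inr ⟨⟨k, rfl⟩, fun _ => hk⟩
          exact ⟨h _ _ (Or.inl rfl) hj, h _ _ hj (Or.inl rfl)⟩
      · rw [respects_top_iff (choiceStates_not_par hpar)]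
        constructor
        · rintro h u v (rfl | ⟨⟨k, rfl⟩, -⟩) (rfl | ⟨⟨k', rfl⟩, -⟩)
          exacts [id, (h k').2, (h k).1, fun hk => (h k').2 ((h k).1 hk)]
        · intro h k
          have hj : Link.Joined I (.conn i b prem c) (prem k) :=
            Or.inr ⟨⟨k, rfl⟩, fun h => (hpar h).elim⟩
          exact ⟨h _ _ hj (Or.inl rfl), h _ _ (Or.inl rfl) hj⟩
  have hgroup : ∀ I, IsChoice S.links I → ∀ l ∈ S.links,
      ∃ B ∈ choiceStates I l, ∀ u, u ∈ B ↔ l.Joined I u := by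
    intro I hI l hl
    match l, hl with
    | .ax u v, _ => exact ⟨{u, v}, rfl, fun _ => Iff.rfl⟩
    | .cut u v, _ => exact ⟨{u, v}, rfl, fun _ => Iff.rfl⟩
    | .conn i b prem c, hl =>
      by_cases hpar : (L i).IsPar b
      · obtain ⟨k, hk⟩ := hI i b prem c hl hpar
        rw [choiceStates_par hl hpar hk]
        refine ⟨_, ⟨_, ⟨none, rfl⟩, rfl⟩, fun u => ?_⟩
        constructor
        · rintro ⟨o, ho, rfl⟩
          rcases keep_singleton_iff.1 ho with rfl | ⟨rfl | rfl, -⟩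
          exacts [Or.inl rfl, Or.inl rfl, Or.inr ⟨⟨k, rfl⟩, fun _ => hk⟩]
        · rintro (rfl | ⟨-, hu⟩)
          · exact ⟨none, keep_singleton_iff.2 (Or.inl rfl), rfl⟩
          · exact ⟨some k, keep_singleton_iff.2 (Or.inr ⟨Or.inr rfl, Or.inl rfl⟩),
              hk.trans (hu hpar).symm⟩
      · rw [choiceStates_not_par hpar]
        refine ⟨_, ⟨_, ⟨none, rfl⟩, rfl⟩, fun u => ?_⟩
        constructor
        · rintro ⟨_ | k, -, rfl⟩
          exacts [Or.inl rfl, Or.inr ⟨⟨k, rfl⟩, fun h => (hpar h).elim⟩]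
        · rintro (rfl | ⟨⟨k, rfl⟩, -⟩)
          exacts [⟨none, trivial, rfl⟩, ⟨some k, trivial, rfl⟩]
  refine ⟨fun I hI X hX => (htree I hI).conn X fun l hl => (hresp I hI X l hl).2 (hX l hl), ?_⟩
  intro I hI l hl v hv
  obtain ⟨B, hB, hBu⟩ := hgroup I hI l hl
  obtain ⟨X, h1, h2, -, h4⟩ := (htree I hI).acyc l hl B hB v ((hBu v).2 hv)
  exact ⟨X, h1, fun u hu => h2 u ((hBu u).2 hu),
    fun l' hl' hne => (hresp I hI X l' hl').1 (h4 l' hl' hne)⟩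

/-! ### Boxes -/

theorem Proof.TranslatesTo.nonempty {ι : Type*} {L : ι → ConnectivePair} {S : ProofStructure L}
    {Γ : Multiset (Formula L)} {π : Proof L Γ} {N : Set S.V} {Λ : Set (Link L S.V)}
    (h : π.TranslatesTo S N Λ) : N.Nonempty := by
  cases π with
  | ax A =>
    obtain ⟨u, v, -, -, -, rfl, -⟩ := h
    exact ⟨u, Or.inl rfl⟩
  | cut A Γ Δ π₁ π₂ =>
    obtain ⟨N₁, N₂, Λ₁, Λ₂, u, v, h₁, h₂, -, hu, -, -, hv, -, -, rfl, rfl⟩ := h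
    exact ⟨u, Or.inl hu⟩
  | conn i b p hp A Γ π =>
    obtain ⟨N', Λ', prem, c, -, -, -, -, -, -, rfl, -⟩ := h
    exact ⟨c, Or.inl rfl⟩

theorem Proof.TranslatesTo.exists_conclusion {ι : Type*} {L : ι → ConnectivePair}
    {S : ProofStructure L} {Γ : Multiset (Formula L)} {π : Proof L Γ} {N : Set S.V}
    {Λ : Set (Link L S.V)} (h : π.TranslatesTo S N Λ) : ∀ v ∈ N, ∃ l ∈ Λ, v ∈ l.conclusions := by
  induction π generalizing N Λ with
  | ax A =>
    obtain ⟨u, v, -, -, -, rfl, rfl⟩ := h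
    exact fun w hw => ⟨_, rfl, Link.mem_conclusions_ax.2 hw⟩
  | cut A Γ Δ π₁ π₂ ih₁ ih₂ =>
    obtain ⟨N₁, N₂, Λ₁, Λ₂, u, v, h₁, h₂, -, -, -, -, -, -, -, rfl, rfl⟩ := h
    rintro w (hw | hw)
    · obtain ⟨l, hl, hwl⟩ := ih₁ h₁ w hw
      exact ⟨l, Or.inr (Or.inl hl), hwl⟩
    · obtain ⟨l, hl, hwl⟩ := ih₂ h₂ w hw
      exact ⟨l, Or.inr (Or.inr hl), hwl⟩
  | conn i b p hp A Γ π ih =>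
    obtain ⟨N', Λ', prem, c, hπ, -, -, -, -, -, rfl, rfl⟩ := h
    rintro w (rfl | hw)
    · exact ⟨_, Or.inl rfl, Link.mem_conclusions_conn.2 rfl⟩
    · obtain ⟨x, hx⟩ := Set.mem_iUnion.1 hw
      obtain ⟨l, hl, hwl⟩ := ih x (hπ x) w hx
      exact ⟨l, Or.inr (Set.mem_iUnion.2 ⟨x, hl⟩), hwl⟩

section Boxes

variable {ι : Type*} {L : ι → ConnectivePair} {S : ProofStructure L}

/-- The occurrences in `N` that are not premises of links in `Λ`. -/
noncomputable def terminals (S : ProofStructure L) (N : Set S.V) (Λ : Set (Link L S.V)) :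
    Finset S.V :=
  have := S.finite
  (Set.toFinite {v | v ∈ N ∧ ∀ l ∈ Λ, v ∉ l.premises}).toFinset

theorem mem_terminals {N : Set S.V} {Λ : Set (Link L S.V)} {v : S.V} :
    v ∈ terminals S N Λ ↔ v ∈ N ∧ ∀ l ∈ Λ, v ∉ l.premises := by
  simp [terminals]

/-- The part of `S` with occurrences `N` and links `Λ` is the proof-structure of a proof of its
terminal formulas. -/
structure IsBox (S : ProofStructure L) (N : Set S.V) (Λ : Set (Link L S.V)) : Prop where
  subset : Λ ⊆ S.links
  exists_proof : ∃ π : Proof L ((terminals S N Λ).val.map S.label), π.TranslatesTo S N Λ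

theorem IsBox.connected {N : Set S.V} {Λ : Set (Link L S.V)} (h : IsBox S N Λ)
    {I : Link L S.V → S.V} (hI : IsChoice S.links I) {X : Set S.V} (hX : ∀ l ∈ Λ, l.Uncut I X) :
    ∀ u ∈ N, ∀ v ∈ N, u ∈ X → v ∈ X := by
  obtain ⟨π, hπ⟩ := h.exists_proof
  exact hπ.connected (fun i b prem c hl => hI i b prem c (h.subset hl)) hX

theorem IsBox.mem {N : Set S.V} {Λ : Set (Link L S.V)} (h : IsBox S N Λ) {l : Link L S.V}
    (hl : l ∈ Λ) : (∀ v ∈ l.premises, v ∈ N) ∧ ∀ v ∈ l.conclusions, v ∈ N :=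
  h.exists_proof.choose_spec.mem l hl

theorem Link.Joined.mem {V : Type} {I : Link L V → V} {l : Link L V} {v : V}
    (h : l.Joined I v) : v ∈ l.premises ∨ v ∈ l.conclusions := by
  match l, h with
  | .ax _ _, h => exact Or.inr (Link.mem_conclusions_ax.2 h)
  | .cut _ _, h => exact Or.inl (Link.mem_premises_cut.2 h)
  | .conn _ _ _ _, .inl h => exact Or.inr (Link.mem_conclusions_conn.2 h)
  | .conn _ _ _ _, .inr h => exact Or.inl (Link.mem_premises_conn.2 h.1)

theorem Link.joined_of_mem_conclusions {V : Type} {I : Link L V → V} {l : Link L V} {v : V}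
    (h : v ∈ l.conclusions) : l.Joined I v := by
  match l, h with
  | .ax _ _, h => exact Link.mem_conclusions_ax.1 h
  | .cut _ _, h => simp [Link.conclusions] at h
  | .conn _ _ _ _, h => exact Or.inl (Link.mem_conclusions_conn.1 h)

theorem IsBox.joined_mem {N : Set S.V} {Λ : Set (Link L S.V)} (h : IsBox S N Λ)
    {I : Link L S.V → S.V} {l : Link L S.V} (hl : l ∈ Λ) {v : S.V} (hv : l.Joined I v) : v ∈ N :=
  hv.mem.elim ((h.mem hl).1 v) ((h.mem hl).2 v)

theorem ProofStructure.eq_of_mem_conclusions {l l' : Link L S.V} (hl : l ∈ S.links)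
    (hl' : l' ∈ S.links) {v : S.V} (hv : v ∈ l.conclusions) (hv' : v ∈ l'.conclusions) : l = l' :=
  (S.existsUnique_conclusion v).unique ⟨hl, hv⟩ ⟨hl', hv'⟩

/-- A family of disjoint boxes that contains all axiom links. -/
structure Boxing (S : ProofStructure L) (F : Set (Set S.V × Set (Link L S.V))) : Prop where
  box : ∀ β ∈ F, IsBox S β.1 β.2
  disj : ∀ β ∈ F, ∀ γ ∈ F, ∀ v, v ∈ β.1 → v ∈ γ.1 → β = γ
  ax : ∀ u v, .ax u v ∈ S.links → ∃ β ∈ F, .ax u v ∈ β.2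

/-- The occurrence `v` lies in one of the boxes. -/
def IsBoxed (F : Set (Set S.V × Set (Link L S.V))) (v : S.V) : Prop :=
  ∃ β ∈ F, v ∈ β.1

/-- The link `l` lies in one of the boxes. -/
def IsBoxedLink (F : Set (Set S.V × Set (Link L S.V))) (l : Link L S.V) : Prop :=
  ∃ β ∈ F, l ∈ β.2

/-- A link that can be added to the boxes: all its premises are boxed, and those of a par link are
in the same box. -/
structure Ready (F : Set (Set S.V × Set (Link L S.V))) (l : Link L S.V) : Prop where
  mem : l ∈ S.links
  not_boxed : ¬ IsBoxedLink F l
  premises : ∀ v ∈ l.premises, IsBoxed F v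
  par : ∀ i b prem c, l = .conn i b prem c → (L i).IsPar b → ∃ β ∈ F, ∀ k, prem k ∈ β.1

/-- `Y` is the part of the correctness graph for `I` above the conclusion `c` of the link `l`. -/
structure Upper (S : ProofStructure L) (I : Link L S.V → S.V) (l : Link L S.V) (c : S.V)
    (Y : Set S.V) : Prop where
  choice : IsChoice S.links I
  mem : l ∈ S.links
  concl : c ∈ l.conclusions
  not_mem : c ∉ Y
  up : ∀ u, l.Joined I u → u ≠ c → u ∈ Y
  uncut : ∀ l' ∈ S.links, l' ≠ l → l'.Uncut I Y

theorem Link.Uncut.compl {V : Type} {I : Link L V → V} {X : Set V} {l : Link L V}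
    (h : l.Uncut I X) : l.Uncut I Xᶜ :=
  fun u v hu hv huX hvX => huX (h v u hv hu hvX)

/-- The complement of the set that separates `w` from the other occurrences joined by the link above
it. -/
theorem ParCorrect.exists_upper (hS : ParCorrect S) {I : Link L S.V → S.V}
    (hI : IsChoice S.links I) (w : S.V) : ∃ l Y, Upper S I l w Y := by
  obtain ⟨l, ⟨hl, hw⟩, -⟩ := S.existsUnique_conclusion w
  obtain ⟨X, h1, h2, h3⟩ := hS.acyc I hI l hl w (Link.joined_of_mem_conclusions hw)
  exact ⟨l, Xᶜ, hI, hl, hw, fun h => h h1, fun u hu hne => h2 u hu hne,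
    fun l' hl' hne => (h3 l' hl' hne).compl⟩

/-- `Y` may be cut by `l` only, so intersecting with `Y` is harmless if `l` joins nothing in `Y ∩
Y'`. The part shrinks because `w` lies in `Y` but not in the part above itself. -/
theorem Upper.inter {I : Link L S.V → S.V} {l lw : Link L S.V} {c w : S.V} {Y Y' : Set S.V}
    (h : Upper S I l c Y) (h' : Upper S I lw w Y') (hne : lw ≠ l) (hw : w ∈ Y)
    (hl : ∀ u, l.Joined I u → u ∈ Y → u ∉ Y') :
    Upper S I lw w (Y ∩ Y') ∧ (Y ∩ Y').ncard < Y.ncard := by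
  have := S.finite
  refine ⟨⟨h.choice, h'.mem, h'.concl, fun hw' => h'.not_mem hw'.2, ?_, ?_⟩, ?_⟩
  · exact fun u hu huw => ⟨h.uncut lw h'.mem hne w u
      (Link.joined_of_mem_conclusions h'.concl) hu hw, h'.up u hu huw⟩
  · intro l' hl' hne' u v hu hv huY
    by_cases hll : l' = l
    · subst hll
      exact (hl u hu huY.1 huY.2).elim
    · exact ⟨h.uncut l' hl' hll u v hu hv huY.1, h'.uncut l' hl' hne' u v hu hv huY.2⟩
  · refine Set.ncard_lt_ncard ⟨Set.inter_subset_left, fun hsub => ?_⟩ (Set.toFinite _)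
    exact h'.not_mem (hsub hw).2

theorem Link.joined_congr {V : Type} {I I' : Link L V → V} {l : Link L V} (h : I l = I' l) {v : V} :
    l.Joined I v ↔ l.Joined I' v := by
  cases l with
  | ax u w => rfl
  | cut u w => rfl
  | conn i b prem c => simp only [Link.Joined, h]

open Classical in
theorem IsChoice.update {V : Type} {Λ : Set (Link L V)} {I : Link L V → V} (hI : IsChoice Λ I)
    {i : ι} {b : Bool} (prem : Fin (L i).arity → V) (c : V) (k : Fin (L i).arity) :
    IsChoice Λ (Function.update I (.conn i b prem c) (prem k)) := by
  intro i' b' prem' c' hl hpar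
  by_cases h : (Link.conn i' b' prem' c' : Link L V) = .conn i b prem c
  · rw [h, Function.update_self]
    cases h
    exact ⟨k, rfl⟩
  · rw [Function.update_of_ne h]
    exact hI _ _ _ _ hl hpar

open Classical in
theorem Link.uncut_update {V : Type} {I : Link L V → V} {X : Set V} {l l' : Link L V} {v : V}
    (h : l' ≠ l) : l'.Uncut (Function.update I l v) X ↔ l'.Uncut I X := by
  have : Function.update I l v l' = I l' := Function.update_of_ne h _ _
  simp only [Link.Uncut, Link.joined_congr this]

open Classical in
/-- The part above the conclusion of a par link does not depend on the premise chosen there. -/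
theorem Upper.update (hS : ParCorrect S) {I : Link L S.V → S.V} {i : ι} {b : Bool}
    {prem : Fin (L i).arity → S.V} {c : S.V} {Y : Set S.V}
    (h : Upper S I (.conn i b prem c) c Y) (k : Fin (L i).arity) :
    Upper S (Function.update I (.conn i b prem c) (prem k)) (.conn i b prem c) c Y ∧
      prem k ∈ Y := by
  set l : Link L S.V := .conn i b prem c with hldef
  have hI' : IsChoice S.links (Function.update I l (prem k)) := h.choice.update prem c k
  have hself : Function.update I l (prem k) l = prem k := Function.update_self _ _ _
  have huncut : ∀ l' ∈ S.links, l' ≠ l → l'.Uncut (Function.update I l (prem k)) Y :=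
    fun l' hl' hne => (Link.uncut_update hne).2 (h.uncut l' hl' hne)
  by_cases hpar : (L i).IsPar b
  · have hk : prem k ∈ Y := by
      -- If `prem k` were outside `Y`, no link would cut `Y` after the change of choice, although
      -- `Y` contains the old chosen premise and misses `c`.
      by_contra hk
      obtain ⟨k', hk'⟩ := h.choice i b prem c h.mem hpar
      have hk'Y : prem k' ∈ Y :=
        h.up _ (Or.inr ⟨⟨k', rfl⟩, fun _ => hk'⟩) (S.prem_ne_concl h.mem k')
      refine h.not_mem (hS.conn _ hI' Y (fun l' hl' => ?_) _ _ hk'Y)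
      by_cases hll : l' = l
      · subst hll
        rintro u v (rfl | ⟨-, hu⟩) - huY
        · exact (h.not_mem huY).elim
        · rw [hu hpar, ← hldef, hself] at huY
          exact (hk huY).elim
      · exact huncut l' hl' hll
    refine ⟨⟨hI', h.mem, h.concl, h.not_mem, ?_, huncut⟩, hk⟩
    rintro u (rfl | ⟨-, hu⟩) hne
    · exact (hne rfl).elim
    · rw [hu hpar, ← hldef, hself]
      exact hk
  · have hj : ∀ k', l.Joined I (prem k') := fun k' => Or.inr ⟨⟨k', rfl⟩, fun h => (hpar h).elim⟩
    have hup : ∀ k', prem k' ∈ Y := fun k' => h.up _ (hj k') (S.prem_ne_concl h.mem k')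
    refine ⟨⟨hI', h.mem, h.concl, h.not_mem, ?_, huncut⟩, hup k⟩
    rintro u (rfl | ⟨⟨k', rfl⟩, -⟩) hne
    · exact (hne rfl).elim
    · exact hup k'

end Boxes

/-! ### Existence of a ready link -/

section Readiness

variable {ι : Type*} {L : ι → ConnectivePair} {S : ProofStructure L}
  {F : Set (Set S.V × Set (Link L S.V))}

theorem Boxing.boxedLink_of_conclusion (hF : Boxing S F) {l : Link L S.V} (hl : l ∈ S.links)
    {v : S.V} (hv : v ∈ l.conclusions) (hb : IsBoxed F v) : IsBoxedLink F l := by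
  obtain ⟨β, hβ, hvβ⟩ := hb
  obtain ⟨π, hπ⟩ := (hF.box β hβ).exists_proof
  obtain ⟨l', hl', hv'⟩ := hπ.exists_conclusion v hvβ
  rw [S.eq_of_mem_conclusions hl ((hF.box β hβ).subset hl') hv hv']
  exact ⟨β, hβ, hl'⟩

theorem Boxing.not_boxedLink (hF : Boxing S F) {l : Link L S.V} {v : S.V}
    (hv : v ∈ l.conclusions) (hb : ¬ IsBoxed F v) : ¬ IsBoxedLink F l := by
  rintro ⟨β, hβ, hl⟩
  exact hb ⟨β, hβ, ((hF.box β hβ).mem hl).2 v hv⟩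

/-- An occurrence outside the boxes is the conclusion of a link of a connective. -/
theorem Boxing.exists_conn (hF : Boxing S F) {l : Link L S.V} (hl : l ∈ S.links) {v : S.V}
    (hv : v ∈ l.conclusions) (hb : ¬ IsBoxed F v) : ∃ i b prem, l = .conn i b prem v := by
  match l, hl, hv with
  | .ax u w, hl, hv => exact (hF.not_boxedLink hv hb (hF.ax u w hl)).elim
  | .cut u w, _, hv => simp [Link.conclusions] at hv
  | .conn i b prem c, _, hv => exact ⟨i, b, prem, by rw [Link.mem_conclusions_conn.1 hv]⟩

/-- If no link is ready, no part above an occurrence outside the boxes is minimal. -/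
theorem Upper.exists_smaller (hS : ParCorrect S) (hF : Boxing S F) (hready : ¬ ∃ l, Ready F l)
    {I : Link L S.V → S.V} {l : Link L S.V} {c : S.V} {Y : Set S.V} (h : Upper S I l c Y)
    (hc : ¬ IsBoxed F c) :
    ∃ I' l' c' Y', Upper S I' l' c' Y' ∧ ¬ IsBoxed F c' ∧ Y'.ncard < Y.ncard := by
  classical
  obtain ⟨i, b, prem, rfl⟩ := hF.exists_conn h.mem h.concl hc
  by_contra hmin
  push Not at hmin
  have hlb : ¬ IsBoxedLink F (.conn i b prem c) := hF.not_boxedLink h.concl hc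
  -- Once an unboxed premise is the chosen one, the part above it within `Y` is smaller than `Y`.
  have hprem : ∀ k, IsBoxed F (prem k) := by
    intro k
    by_contra hk
    obtain ⟨h', hkY⟩ := h.update hS k
    obtain ⟨lw, Y', hw⟩ := hS.exists_upper h'.choice (prem k)
    have hne : lw ≠ .conn i b prem c := by
      rintro rfl
      exact S.prem_ne_concl h.mem k (Link.mem_conclusions_conn.1 hw.concl)
    obtain ⟨h1, h2⟩ := h'.inter hw hne hkY fun u hu _ huY' => hw.not_mem
      (hw.uncut _ h.mem hne.symm u (prem k) hu (Or.inr ⟨⟨k, rfl⟩, fun _ => by simp⟩) huY')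
    exact absurd h2 (not_lt.2 (hmin _ _ _ _ h1 hk))
  by_cases hpar : (L i).IsPar b
  swap
  · refine hready ⟨.conn i b prem c, h.mem, hlb, ?_, ?_⟩
    · intro v hv
      obtain ⟨k, rfl⟩ := Link.mem_premises_conn.1 hv
      exact hprem k
    · intro i' b' prem' c' he hp
      cases he
      exact (hpar hp).elim
  let k₀ : Fin (L i).arity := ⟨0, (L i).arity_pos⟩
  obtain ⟨β, hβ, haβ⟩ := hprem k₀
  have hex : ∃ k₁, prem k₁ ∉ β.1 := by
    by_contra hall
    push Not at hall
    refine hready ⟨.conn i b prem c, h.mem, hlb, ?_, ?_⟩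
    · intro v hv
      obtain ⟨k, rfl⟩ := Link.mem_premises_conn.1 hv
      exact hprem k
    · intro i' b' prem' c' he _
      cases he
      exact ⟨β, hβ, hall⟩
  obtain ⟨k₁, hbβ⟩ := hex
  obtain ⟨h, haY⟩ := h.update hS k₀
  set l : Link L S.V := .conn i b prem c with hldef
  set I₀ := Function.update I l (prem k₀) with hI₀
  have hIl : I₀ l = prem k₀ := Function.update_self _ _ _
  have hjl : ∀ u, l.Joined I₀ u → u = c ∨ u = prem k₀ := by
    rintro u (rfl | ⟨-, hu⟩)
    · exact Or.inl rfl
    · exact Or.inr ((hu hpar).trans hIl)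
  have hbY : prem k₁ ∈ Y := (h.update hS k₁).2
  have hboxne : ∀ l', IsBoxedLink F l' → l' ≠ l := by
    rintro l' hl' rfl
    exact hlb hl'
  -- A box is connected by its own links, none of which is `l`; so `Y`, containing `prem k₀`,
  -- contains all of `β`.
  have hβY : ∀ u ∈ β.1, u ∈ Y := fun u hu =>
    (hF.box β hβ).connected h.choice (fun l' hl' =>
      h.uncut l' ((hF.box β hβ).subset hl') (hboxne l' ⟨β, hβ, hl'⟩)) _ haβ u hu haY
  -- an unboxed premise of a link attached to the box `β` yields a smaller part
  have hattach : ∀ l' ∈ S.links, l' ≠ l → ∀ x w, l'.Joined I₀ x → x ∈ β.1 → l'.Joined I₀ w →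
      w ∉ l'.conclusions → ¬ IsBoxed F w → False := by
    intro l' hl' hne x w hx hxβ hwj hwc hw
    obtain ⟨lw, Y', hY'⟩ := hS.exists_upper h.choice w
    have hwY : w ∈ Y := h.uncut l' hl' hne x w hx hwj (hβY x hxβ)
    have hne' : l' ≠ lw := by
      rintro rfl
      exact hwc hY'.concl
    have hlw : lw ≠ l := by
      rintro rfl
      rw [Link.mem_conclusions_conn.1 hY'.concl] at hwY
      exact h.not_mem hwY
    have hxY' : x ∉ Y' := fun hxY' => hY'.not_mem (hY'.uncut l' hl' hne' x w hx hwj hxY')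
    have haY' : prem k₀ ∉ Y' := by
      intro ha
      refine hxY' ((hF.box β hβ).connected h.choice (fun l'' hl'' => hY'.uncut l''
        ((hF.box β hβ).subset hl'') ?_) _ haβ x hxβ ha)
      rintro rfl
      exact hF.not_boxedLink hY'.concl hw ⟨β, hβ, hl''⟩
    obtain ⟨h1, h2⟩ := h.inter hY' hlw hwY (by
      intro u hu huY huY'
      rcases hjl u hu with rfl | rfl
      exacts [h.not_mem huY, haY' huY'])
    exact absurd h2 (not_lt.2 (hmin _ _ _ _ h1 hw))
  -- the pars through which the correctness graph leaves the box `β`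
  have hupper : ∀ w, ∃ Yw, ∀ lw ∈ S.links, w ∈ lw.conclusions → Upper S I₀ lw w Yw := by
    intro w
    obtain ⟨lw, Yw, hw⟩ := hS.exists_upper h.choice w
    refine ⟨Yw, fun l' hl' hwl' => ?_⟩
    rw [S.eq_of_mem_conclusions hl' hw.mem hwl' hw.concl]
    exact hw
  choose Yw hYw using hupper
  let E : Set S.V := {w | ¬ IsBoxed F w ∧ ∃ i' b' prem', .conn i' b' prem' w ∈ S.links ∧
    .conn i' b' prem' w ≠ l ∧ (L i').IsPar b' ∧ I₀ (.conn i' b' prem' w) ∈ β.1}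
  by_cases hall : ∀ w ∈ E, prem k₁ ∈ Yw w
  · let X : Set S.V := {v | v ∈ Y ∧ v ∉ β.1 ∧ ∀ w ∈ E, v ∈ Yw w}
    refine h.not_mem (hS.conn _ h.choice X (fun l' hl' => ?_) (prem k₁) c
      ⟨hbY, hbβ, hall⟩).1
    by_cases hll : l' = l
    · subst hll
      intro u v hu _ huX
      rcases hjl u hu with rfl | rfl
      exacts [(h.not_mem huX.1).elim, (huX.2.1 haβ).elim]
    have hgood : (∀ w ∈ E, w ∉ l'.conclusions) → (∀ u, l'.Joined I₀ u → u ∉ β.1) →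
        l'.Uncut I₀ X := by
      intro hE hβ' u v hu hv huX
      refine ⟨h.uncut l' hl' hll u v hu hv huX.1, hβ' v hv, fun w hw => ?_⟩
      obtain ⟨-, i', b', prem', hlw, -⟩ := id hw
      refine (hYw w _ hlw (Link.mem_conclusions_conn.2 rfl)).uncut l' hl' ?_ u v hu hv
        (huX.2.2 w hw)
      rintro rfl
      exact hE w hw (Link.mem_conclusions_conn.2 rfl)
    by_cases hlb' : IsBoxedLink F l'
    · obtain ⟨γ, hγ, hlγ⟩ := hlb'
      by_cases hγβ : γ = β
      · subst hγβ
        exact fun u v hu _ huX => (huX.2.1 ((hF.box γ hγ).joined_mem hlγ hu)).elim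
      · refine hgood (fun w hw hwc => hw.1 ⟨γ, hγ, ((hF.box γ hγ).mem hlγ).2 w hwc⟩) ?_
        exact fun u hu huβ => hγβ (hF.disj γ hγ β hβ u ((hF.box γ hγ).joined_mem hlγ hu) huβ)
    match l', hl', hll, hlb', hgood with
    | .ax u v, hl', _, hlb', _ => exact (hlb' (hF.ax u v hl')).elim
    | .cut p q, hl', hll, hlb', hgood =>
      refine hgood (fun w _ hwc => by simp [Link.conclusions] at hwc) fun x hx hxβ => ?_
      by_cases hp : IsBoxed F p
      · by_cases hq : IsBoxed F q
        · refine hready ⟨.cut p q, hl', hlb', ?_, nofun⟩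
          intro v hv
          rcases Link.mem_premises_cut.1 hv with rfl | rfl
          exacts [hp, hq]
        · exact hattach _ hl' hll x q hx hxβ (Or.inr rfl) (by simp [Link.conclusions]) hq
      · exact hattach _ hl' hll x p hx hxβ (Or.inl rfl) (by simp [Link.conclusions]) hp
    | .conn i' b' prem' c', hl', hll, hlb', hgood =>
      have hc' : ¬ IsBoxed F c' := fun hc' =>
        hlb' (hF.boxedLink_of_conclusion hl' (Link.mem_conclusions_conn.2 rfl) hc')
      by_cases hpar' : (L i').IsPar b'
      · by_cases hI : I₀ (.conn i' b' prem' c') ∈ β.1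
        · have hE : c' ∈ E := ⟨hc', i', b', prem', hl', hll, hpar', hI⟩
          rintro u v (rfl | ⟨-, hu⟩) - huX
          · exact ((hYw u _ hl' (Link.mem_conclusions_conn.2 rfl)).not_mem
              (huX.2.2 u hE)).elim
          · rw [hu hpar'] at huX
            exact (huX.2.1 hI).elim
        · refine hgood ?_ ?_
          · rintro w hw hwc
            rw [Link.mem_conclusions_conn] at hwc
            subst hwc
            obtain ⟨-, i'', b'', prem'', hl'', -, -, hI''⟩ := hw
            rw [S.eq_of_mem_conclusions hl'' hl' (Link.mem_conclusions_conn.2 rfl)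
              (Link.mem_conclusions_conn.2 rfl)] at hI''
            exact hI hI''
          · rintro u (rfl | ⟨-, hu⟩) huβ
            · exact hc' ⟨β, hβ, huβ⟩
            · rw [hu hpar'] at huβ
              exact hI huβ
      · have hj : ∀ k, Link.Joined I₀ (.conn i' b' prem' c') (prem' k) :=
          fun k => Or.inr ⟨⟨k, rfl⟩, fun h => (hpar' h).elim⟩
        have hprem' : ∃ k, ¬ IsBoxed F (prem' k) := by
          by_contra hcon
          push Not at hcon
          refine hready ⟨_, hl', hlb', ?_, ?_⟩
          · intro v hv
            obtain ⟨k, rfl⟩ := Link.mem_premises_conn.1 hv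
            exact hcon k
          · intro _ _ _ _ he hp
            cases he
            exact (hpar' hp).elim
        obtain ⟨k, hk⟩ := hprem'
        refine hgood ?_ ?_
        · rintro w hw hwc
          rw [Link.mem_conclusions_conn] at hwc
          subst hwc
          obtain ⟨-, i'', b'', prem'', hl'', -, hpar'', -⟩ := hw
          have := S.eq_of_mem_conclusions hl'' hl' (Link.mem_conclusions_conn.2 rfl)
            (Link.mem_conclusions_conn.2 rfl)
          cases this
          exact hpar' hpar''
        · intro x hx hxβ
          refine hattach _ hl' hll x (prem' k) hx hxβ (hj k) ?_ hk
          rw [Link.mem_conclusions_conn]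
          exact S.prem_ne_concl hl' k
  · push Not at hall
    obtain ⟨w, ⟨hwb, i', b', prem', hlw, hlwne, hpar', hIβ⟩, hbw⟩ := hall
    set lw : Link L S.V := .conn i' b' prem' w with hlwdef
    have hw := hYw w lw hlw (Link.mem_conclusions_conn.2 rfl)
    have hrange := h.choice i' b' prem' w hlw hpar'
    have hIw : I₀ lw ∈ Yw w := by
      refine hw.up _ (Or.inr ⟨hrange, fun _ => rfl⟩) ?_
      obtain ⟨k, hk⟩ := hrange
      rw [hlwdef, ← hk]
      exact S.prem_ne_concl hlw k
    have hlwb : ¬ IsBoxedLink F lw := hF.not_boxedLink (Link.mem_conclusions_conn.2 rfl) hwb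
    have hβw : ∀ u ∈ β.1, u ∈ Yw w := fun u hu =>
      (hF.box β hβ).connected h.choice (fun l' hl' => hw.uncut l' ((hF.box β hβ).subset hl')
        (fun he => hlwb (he ▸ ⟨β, hβ, hl'⟩))) _ hIβ u hu hIw
    have hmem : l ∈ S.links := h.mem
    have hI₁ : IsChoice S.links (Function.update I₀ l (prem k₁)) := h.choice.update prem c k₁
    -- After `l` is switched to `k₁`, it joins only `c` and `prem k₁`, which are both outside `Y ∩
    -- Yw w`. This part above `w` is smaller than `Y` because it misses `prem k₁`.
    have hlast : Upper S (Function.update I₀ l (prem k₁)) lw w (Y ∩ Yw w) := by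
      refine ⟨hI₁, hlw, hw.concl, fun hwY => hw.not_mem hwY.2, ?_, ?_⟩
      · rintro u (rfl | ⟨-, hu⟩) hne
        · exact (hne rfl).elim
        · have hu' := hu hpar'
          rw [← hlwdef, Function.update_of_ne hlwne] at hu'
          rw [hu']
          exact ⟨hβY _ hIβ, hIw⟩
      · intro l' hl' hne
        by_cases hll : l' = l
        · subst hll
          rintro u v (rfl | ⟨-, hu⟩) - huY
          · exact (h.not_mem huY.1).elim
          · have hu' := hu hpar
            rw [← hldef, Function.update_self] at hu'
            rw [hu'] at huY
            exact (hbw huY.2).elim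
        · rw [Link.uncut_update hll]
          exact fun u v hu hv huY => ⟨h.uncut l' hl' hll u v hu hv huY.1,
            hw.uncut l' hl' hne u v hu hv huY.2⟩
    have := S.finite
    refine absurd (Set.ncard_lt_ncard ⟨Set.inter_subset_left, fun hsub => ?_⟩ (Set.toFinite Y))
      (not_lt.2 (hmin _ _ _ _ hlast hwb))
    exact hbw (hsub hbY).2

/-- Infinite descent on the size of the part. -/
theorem Upper.false_of_not_ready (hS : ParCorrect S) (hF : Boxing S F)
    (hready : ¬ ∃ l, Ready F l) : ∀ (N : ℕ) (I : Link L S.V → S.V) (l : Link L S.V) (c : S.V)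
    (Y : Set S.V), Upper S I l c Y → ¬ IsBoxed F c → Y.ncard = N → False := by
  intro N
  induction N using Nat.strong_induction_on with
  | _ N ih =>
    intro I l c Y h hc hN
    obtain ⟨I', l', c', Y', h', hc', hlt⟩ := h.exists_smaller hS hF hready hc
    exact ih _ (hN ▸ hlt) I' l' c' Y' h' hc' rfl

theorem exists_isChoice_links (S : ProofStructure L) : ∃ I, IsChoice S.links I := by
  let I : Link L S.V → S.V := fun l => match l with
    | .ax u _ => u
    | .cut u _ => u
    | .conn i' _ prem' _ => prem' ⟨0, (L i').arity_pos⟩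
  exact ⟨I, fun i b prem c _ _ => ⟨_, rfl⟩⟩

/-- As long as some link is not boxed, some link is ready. -/
theorem Boxing.exists_ready (hS : ParCorrect S) (hF : Boxing S F) {l : Link L S.V}
    (hl : l ∈ S.links) (hlb : ¬ IsBoxedLink F l) : ∃ l, Ready F l := by
  by_contra hready
  have hbox : ∀ v, IsBoxed F v := by
    intro v
    by_contra hv
    obtain ⟨I, hI⟩ := exists_isChoice_links S
    obtain ⟨l', Y, h⟩ := hS.exists_upper hI v
    exact Upper.false_of_not_ready hS hF hready _ I l' v Y h hv rfl
  match l, hl, hlb with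
  | .ax u v, hl, hlb => exact hlb (hF.ax u v hl)
  | .cut u v, hl, hlb => exact hready ⟨_, hl, hlb, fun w _ => hbox w, nofun⟩
  | .conn i b prem c, hl, hlb =>
    exact hlb (hF.boxedLink_of_conclusion hl (Link.mem_conclusions_conn.2 rfl) (hbox c))

end Readiness

/-! ### Merging boxes along a ready link -/

section Merging

variable {ι : Type*} {L : ι → ConnectivePair} {S : ProofStructure L}
  {F : Set (Set S.V × Set (Link L S.V))}

theorem Proof.exists_translatesTo_congr {Γ Δ : Multiset (Formula L)} {N : Set S.V}
    {Λ : Set (Link L S.V)} (h : Γ = Δ) (hπ : ∃ π : Proof L Γ, π.TranslatesTo S N Λ) :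
    ∃ π : Proof L Δ, π.TranslatesTo S N Λ :=
  h ▸ hπ

theorem Proof.translatesTo_congr {Γ : Multiset (Formula L)} {π : Proof L Γ} {N N' : Set S.V}
    {Λ Λ' : Set (Link L S.V)} (hN : N = N') (hΛ : Λ = Λ') (hπ : π.TranslatesTo S N Λ) :
    π.TranslatesTo S N' Λ' :=
  hN ▸ hΛ ▸ hπ

theorem map_val_eq_sum {α β : Type*} (s : Finset α) (g : α → β) :
    s.val.map g = ∑ a ∈ s, ({g a} : Multiset β) :=
  (Multiset.sum_map_singleton _).symm.trans (congrArg _ (Multiset.map_map _ _ _))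

theorem isBox_ax {u v : S.V} (h : .ax u v ∈ S.links) : IsBox S {u, v} {.ax u v} := by
  classical
  have hne : u ≠ v := by
    have := S.nodup_conclusions _ h
    simpa [Link.conclusions] using this
  have hlabel : S.label v = (S.label u).neg := S.wellLabelled _ h
  refine ⟨Set.singleton_subset_iff.2 h, ?_⟩
  refine Proof.exists_translatesTo_congr ?_
    ⟨.ax (S.label u), u, v, hne, rfl, hlabel, rfl, rfl⟩
  have hT : terminals S {u, v} {.ax u v} = {u, v} := by
    ext w
    rw [mem_terminals]
    simp [Link.premises]
  rw [hT, ← hlabel, map_val_eq_sum, Finset.sum_pair hne]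
  rfl

/-- An occurrence is a premise of at most one link, so `u` and `v` are still terminal in their boxes
and the cut rule applies. The other terminals survive. -/
theorem isBox_cut {u v : S.V} (h : .cut u v ∈ S.links) {N₁ N₂ : Set S.V}
    {Λ₁ Λ₂ : Set (Link L S.V)} (h₁ : IsBox S N₁ Λ₁) (h₂ : IsBox S N₂ Λ₂) (hd : Disjoint N₁ N₂)
    (hu : u ∈ N₁) (hv : v ∈ N₂) (hl₁ : .cut u v ∉ Λ₁) (hl₂ : .cut u v ∉ Λ₂) :
    IsBox S (N₁ ∪ N₂) (insert (.cut u v) (Λ₁ ∪ Λ₂)) := by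
  classical
  have hlabel : S.label v = (S.label u).neg := S.wellLabelled _ h
  refine ⟨Set.insert_subset h (Set.union_subset h₁.subset h₂.subset), ?_⟩
  have hu₁ : ∀ l ∈ Λ₁, u ∉ l.premises := by
    intro l hl hul
    rw [S.unique_premise l (h₁.subset hl) _ h u hul (Link.mem_premises_cut.2 (Or.inl rfl))] at hl
    exact hl₁ hl
  have hv₂ : ∀ l ∈ Λ₂, v ∉ l.premises := by
    intro l hl hul
    rw [S.unique_premise l (h₂.subset hl) _ h v hul (Link.mem_premises_cut.2 (Or.inr rfl))] at hl
    exact hl₂ hl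
  have huT : u ∈ terminals S N₁ Λ₁ := mem_terminals.2 ⟨hu, hu₁⟩
  have hvT : v ∈ terminals S N₂ Λ₂ := mem_terminals.2 ⟨hv, hv₂⟩
  have hsplit : ∀ {T : Finset S.V} {w : S.V}, w ∈ T →
      T.val.map S.label = S.label w ::ₘ (T.erase w).val.map S.label := by
    intro T w hw
    rw [map_val_eq_sum, map_val_eq_sum, ← Finset.add_sum_erase T _ hw, Multiset.singleton_add]
  obtain ⟨π₁, hπ₁⟩ := Proof.exists_translatesTo_congr (hsplit huT) h₁.exists_proof
  obtain ⟨π₂, hπ₂⟩ := Proof.exists_translatesTo_congr ((hsplit hvT).trans (by rw [hlabel]))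
    h₂.exists_proof
  refine Proof.exists_translatesTo_congr ?_ ⟨.cut (S.label u) _ _ π₁ π₂, N₁, N₂, Λ₁, Λ₂, u, v,
    hπ₁, hπ₂, hd, hu, hu₁, rfl, hv, hv₂, hlabel, rfl, rfl⟩
  have hdis : Disjoint ((terminals S N₁ Λ₁).erase u) ((terminals S N₂ Λ₂).erase v) := by
    rw [Finset.disjoint_left]
    intro w hw hw'
    exact Set.disjoint_left.1 hd (mem_terminals.1 (Finset.mem_of_mem_erase hw)).1
      (mem_terminals.1 (Finset.mem_of_mem_erase hw')).1
  have hT : terminals S (N₁ ∪ N₂) (insert (.cut u v) (Λ₁ ∪ Λ₂)) =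
      (terminals S N₁ Λ₁).erase u ∪ (terminals S N₂ Λ₂).erase v := by
    ext w
    rw [Finset.mem_union, Finset.mem_erase, Finset.mem_erase, mem_terminals, mem_terminals,
      mem_terminals]
    constructor
    · rintro ⟨hw, hwl⟩
      have hwuv : ¬ (w = u ∨ w = v) := fun hwuv =>
        hwl _ (Or.inl rfl) (Link.mem_premises_cut.2 hwuv)
      push Not at hwuv
      rcases hw with hw | hw
      · exact Or.inl ⟨hwuv.1, hw, fun l hl => hwl l (Or.inr (Or.inl hl))⟩
      · exact Or.inr ⟨hwuv.2, hw, fun l hl => hwl l (Or.inr (Or.inr hl))⟩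
    · rintro (⟨hne, hw, hwl⟩ | ⟨hne, hw, hwl⟩)
      · refine ⟨Or.inl hw, ?_⟩
        rintro l (rfl | hl | hl) hwp
        · rcases Link.mem_premises_cut.1 hwp with rfl | rfl
          exacts [hne rfl, Set.disjoint_left.1 hd hw hv]
        · exact hwl l hl hwp
        · exact Set.disjoint_left.1 hd hw ((h₂.mem hl).1 w hwp)
      · refine ⟨Or.inr hw, ?_⟩
        rintro l (rfl | hl | hl) hwp
        · rcases Link.mem_premises_cut.1 hwp with rfl | rfl
          exacts [Set.disjoint_left.1 hd hu hw, hne rfl]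
        · exact Set.disjoint_left.1 hd ((h₁.mem hl).1 w hwp) hw
        · exact hwl l hl hwp
  rw [hT, map_val_eq_sum, map_val_eq_sum, map_val_eq_sum, Finset.sum_union hdis]

/-- The box of the class `x` has the premises in `x` among its terminals; its other terminals serve
as the context of that premise of the rule. -/
theorem isBox_conn {i : ι} {b : Bool} {prem : Fin (L i).arity → S.V} {c : S.V}
    (h : .conn i b prem c ∈ S.links) {p : Setoid (Fin (L i).arity)} (hp : p ∈ (L i).rules b)
    {N : Quotient p → Set S.V} {Λ : Quotient p → Set (Link L S.V)} (hbox : ∀ x, IsBox S (N x) (Λ x))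
    (hd : ∀ x y, x ≠ y → Disjoint (N x) (N y)) (hprem : ∀ j, prem j ∈ N (Quotient.mk p j))
    (hl : ∀ x, .conn i b prem c ∉ Λ x) (hc : ∀ x, c ∉ N x) :
    IsBox S (insert c (⋃ x, N x)) (insert (.conn i b prem c) (⋃ x, Λ x)) := by
  classical
  have hlabel : S.label c = .conn i b fun j => S.label (prem j) := S.wellLabelled _ h
  have huniq : ∀ x y v, v ∈ N x → v ∈ N y → x = y := by
    intro x y v hx hy
    by_contra hne
    exact Set.disjoint_left.1 (hd x y hne) hx hy
  refine ⟨Set.insert_subset h (Set.iUnion_subset fun x => (hbox x).subset), ?_⟩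
  have hterm : ∀ j, ∀ l ∈ Λ (Quotient.mk p j), prem j ∉ l.premises := by
    intro j l hlΛ hj
    rw [S.unique_premise l ((hbox _).subset hlΛ) _ h _ hj (Link.mem_premises_conn.2 ⟨j, rfl⟩)]
      at hlΛ
    exact hl _ hlΛ
  -- The active premises of each class, and below them the remaining terminals.
  let A : Quotient p → Finset S.V := fun x =>
    (Finset.univ.filter fun j => Quotient.mk p j = x).image prem
  let R : Quotient p → Finset S.V := fun x => terminals S (N x) (Λ x) \ A x
  have hA : ∀ x, A x ⊆ terminals S (N x) (Λ x) := by
    intro x v hv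
    obtain ⟨j, hj, rfl⟩ := Finset.mem_image.1 hv
    obtain rfl := (Finset.mem_filter.1 hj).2
    exact mem_terminals.2 ⟨hprem j, hterm j⟩
  have hsplit : ∀ x, (terminals S (N x) (Λ x)).val.map S.label =
      (Finset.univ.filter fun j => Quotient.mk p j = x).val.map (fun j => S.label (prem j)) +
        (R x).val.map S.label := by
    intro x
    rw [map_val_eq_sum, map_val_eq_sum, map_val_eq_sum, ← Finset.sum_sdiff (hA x), add_comm]
    congr 1
    exact Finset.sum_image fun j _ j' _ hjj => S.prem_injective h hjj
  have hπ := fun x => Proof.exists_translatesTo_congr (hsplit x) (hbox x).exists_proof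
  choose π hπ using hπ
  refine Proof.exists_translatesTo_congr ?_ ⟨.conn i b p hp (fun j => S.label (prem j)) _ π, N, Λ,
    prem, c, hπ, hd, S.prem_injective h, fun j => ⟨hprem j, hterm j, rfl⟩, hc, hlabel, rfl, rfl⟩
  have hRN : ∀ x, ∀ v ∈ R x, v ∈ N x := fun x v hv =>
    (mem_terminals.1 (Finset.mem_sdiff.1 hv).1).1
  have hT : terminals S (insert c (⋃ x, N x)) (insert (.conn i b prem c) (⋃ x, Λ x)) =
      insert c (Finset.univ.biUnion R) := by
    ext v
    rw [mem_terminals, Finset.mem_insert, Finset.mem_biUnion]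
    constructor
    · rintro ⟨rfl | hv, hvl⟩
      · exact Or.inl rfl
      · obtain ⟨x, hx⟩ := Set.mem_iUnion.1 hv
        refine Or.inr ⟨x, Finset.mem_univ _, Finset.mem_sdiff.2 ⟨mem_terminals.2 ⟨hx, fun l hl =>
          hvl l (Or.inr (Set.mem_iUnion.2 ⟨x, hl⟩))⟩, fun hvA => ?_⟩⟩
        obtain ⟨j, -, rfl⟩ := Finset.mem_image.1 hvA
        exact hvl _ (Or.inl rfl) (Link.mem_premises_conn.2 ⟨j, rfl⟩)
    · rintro (rfl | ⟨x, -, hx⟩)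
      · refine ⟨Or.inl rfl, ?_⟩
        rintro l (rfl | hlΛ) hvp
        · obtain ⟨j, hj⟩ := Link.mem_premises_conn.1 hvp
          exact S.prem_ne_concl h j hj
        · obtain ⟨x, hx⟩ := Set.mem_iUnion.1 hlΛ
          exact hc x (((hbox x).mem hx).1 _ hvp)
      · obtain ⟨hxT, hxA⟩ := Finset.mem_sdiff.1 hx
        obtain ⟨hxN, hxl⟩ := mem_terminals.1 hxT
        refine ⟨Or.inr (Set.mem_iUnion.2 ⟨x, hxN⟩), ?_⟩
        rintro l (rfl | hlΛ) hvp
        · obtain ⟨j, rfl⟩ := Link.mem_premises_conn.1 hvp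
          refine hxA (Finset.mem_image.2 ⟨j, ?_, rfl⟩)
          rw [Finset.mem_filter]
          exact ⟨Finset.mem_univ _, huniq _ _ _ (hprem j) hxN⟩
        · obtain ⟨y, hy⟩ := Set.mem_iUnion.1 hlΛ
          obtain rfl := huniq x y v hxN (((hbox y).mem hy).1 v hvp)
          exact hxl l hy hvp
  have hcR : c ∉ Finset.univ.biUnion R := by
    rw [Finset.mem_biUnion]
    rintro ⟨x, -, hx⟩
    exact hc x (hRN x c hx)
  rw [hT, map_val_eq_sum, Finset.sum_insert hcR, Finset.sum_biUnion, ← hlabel,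
    Multiset.singleton_add]
  · congr 1
    exact Finset.sum_congr rfl fun x _ => map_val_eq_sum _ _
  · intro x _ y _ hxy
    rw [Function.onFun, Finset.disjoint_left]
    exact fun v hx hy => hxy (huniq x y v (hRN x v hx) (hRN y v hy))

/-- Old boxes that meet the new one have their links absorbed by it and are dropped; the others are
kept. -/
theorem Boxing.insert (hF : Boxing S F) {ν : Set S.V × Set (Link L S.V)} (hν : IsBox S ν.1 ν.2)
    (hsub : ∀ β ∈ F, ∀ v ∈ β.1, v ∈ ν.1 → β.2 ⊆ ν.2) :
    ∃ F', Boxing S F' ∧ (∀ l, IsBoxedLink F l → IsBoxedLink F' l) ∧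
      ∀ l ∈ ν.2, IsBoxedLink F' l := by
  let F' : Set (Set S.V × Set (Link L S.V)) := {β | β = ν ∨ (β ∈ F ∧ ∀ v ∈ β.1, v ∉ ν.1)}
  have hold : ∀ l, IsBoxedLink F l → IsBoxedLink F' l := by
    rintro l ⟨β, hβ, hl⟩
    by_cases hd : ∀ v ∈ β.1, v ∉ ν.1
    · exact ⟨β, Or.inr ⟨hβ, hd⟩, hl⟩
    · push Not at hd
      obtain ⟨v, hv, hvν⟩ := hd
      exact ⟨ν, Or.inl rfl, hsub β hβ v hv hvν hl⟩
  refine ⟨F', ⟨?_, ?_, fun u v h => hold _ (hF.ax u v h)⟩, hold, fun l hl => ⟨ν, Or.inl rfl, hl⟩⟩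
  · rintro β (rfl | ⟨hβ, -⟩)
    exacts [hν, hF.box β hβ]
  · rintro β (rfl | ⟨hβ, hβν⟩) γ (rfl | ⟨hγ, hγν⟩) v hvβ hvγ
    · rfl
    · exact (hγν v hvγ hvβ).elim
    · exact (hβν v hvβ hvγ).elim
    · exact hF.disj β hβ γ hγ v hvβ hvγ

/-- Two premises of a link that are joined by it do not lie in the same box. -/
theorem Boxing.ne_of_joined (hS : ParCorrect S) (hF : Boxing S F) {l : Link L S.V}
    (hl : l ∈ S.links) (hlb : ¬ IsBoxedLink F l) {I : Link L S.V → S.V}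
    (hI : IsChoice S.links I) {u v : S.V} (hu : l.Joined I u) (hv : l.Joined I v) (hne : v ≠ u)
    {β : Set S.V × Set (Link L S.V)} (hβ : β ∈ F) (huβ : u ∈ β.1) : v ∉ β.1 := by
  intro hvβ
  obtain ⟨X, h1, h2, h3⟩ := hS.acyc I hI l hl u hu
  refine h2 v hv hne ((hF.box β hβ).connected hI (fun l' hl' => h3 l' ((hF.box β hβ).subset hl') ?_)
    u huβ v hvβ h1)
  rintro rfl
  exact hlb ⟨β, hβ, hl'⟩

/-- A ready link can be added to the boxes. -/
theorem Ready.exists_boxing (hpt : ∀ i b, (L i).IsPar b ∨ (L i).IsTensor b) (hS : ParCorrect S)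
    (hF : Boxing S F) {l : Link L S.V} (h : Ready F l) :
    ∃ F', Boxing S F' ∧ (∀ l, IsBoxedLink F l → IsBoxedLink F' l) ∧ IsBoxedLink F' l := by
  have hnot : ∀ β ∈ F, l ∉ β.2 := fun β hβ hl => h.not_boxed ⟨β, hβ, hl⟩
  match l, h, hnot with
  | .ax u v, h, _ => exact (h.not_boxed (hF.ax u v h.mem)).elim
  | .cut u v, h, hnot =>
    obtain ⟨β, hβ, hu⟩ := h.premises u (Link.mem_premises_cut.2 (Or.inl rfl))
    obtain ⟨γ, hγ, hv⟩ := h.premises v (Link.mem_premises_cut.2 (Or.inr rfl))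
    obtain ⟨I, hI⟩ := exists_isChoice_links S
    have hvu : v ≠ u := by
      have := S.nodup_premises _ h.mem
      rw [Link.premises] at this
      rintro rfl
      simp at this
    have hβγ : β ≠ γ := by
      rintro rfl
      exact hF.ne_of_joined hS h.mem h.not_boxed hI (Or.inl rfl) (Or.inr rfl) hvu hβ hu hv
    have hd : Disjoint β.1 γ.1 := by
      rw [Set.disjoint_left]
      exact fun w hw hw' => hβγ (hF.disj β hβ γ hγ w hw hw')
    obtain ⟨F', h1, h2, h3⟩ := hF.insert (ν := ⟨_, _⟩)
      (isBox_cut h.mem (hF.box β hβ) (hF.box γ hγ) hd hu hv (hnot β hβ) (hnot γ hγ)) (by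
        rintro δ hδ w hw (hw' | hw')
        · rw [hF.disj δ hδ β hβ w hw hw']
          exact fun l hl => Or.inr (Or.inl hl)
        · rw [hF.disj δ hδ γ hγ w hw hw']
          exact fun l hl => Or.inr (Or.inr hl))
    exact ⟨F', h1, h2, h3 _ (Or.inl rfl)⟩
  | .conn i b prem c, h, hnot =>
    have hc : ∀ β ∈ F, c ∉ β.1 := fun β hβ hcβ => h.not_boxed
      (hF.boxedLink_of_conclusion h.mem (Link.mem_conclusions_conn.2 rfl) ⟨β, hβ, hcβ⟩)
    have hmerge : ∀ p ∈ (L i).rules b, ∀ β : Quotient p → Set S.V × Set (Link L S.V),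
        (∀ x, β x ∈ F) → (∀ x y, β x = β y → x = y) →
        (∀ j, prem j ∈ (β (Quotient.mk p j)).1) →
        ∃ F', Boxing S F' ∧ (∀ l, IsBoxedLink F l → IsBoxedLink F' l) ∧
          IsBoxedLink F' (.conn i b prem c) := by
      intro p hp β hβ hinj hprem
      obtain ⟨F', h1, h2, h3⟩ := hF.insert (ν := ⟨_, _⟩)
        (isBox_conn h.mem hp (fun x => hF.box _ (hβ x)) (fun x y hxy => by
          rw [Set.disjoint_left]
          exact fun v hx hy => hxy (hinj x y (hF.disj _ (hβ x) _ (hβ y) v hx hy))) hprem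
          (fun x => hnot _ (hβ x)) (fun x => hc _ (hβ x))) (by
        rintro δ hδ w hw (rfl | hw')
        · exact (hc δ hδ hw).elim
        · obtain ⟨x, hx⟩ := Set.mem_iUnion.1 hw'
          rw [hF.disj δ hδ _ (hβ x) w hw hx]
          exact fun l hl => Or.inr (Set.mem_iUnion.2 ⟨x, hl⟩))
      exact ⟨F', h1, h2, h3 _ (Or.inl rfl)⟩
    by_cases hpar : (L i).IsPar b
    · obtain ⟨β, hβ, hall⟩ := h.par i b prem c rfl hpar
      refine hmerge ⊤ (by rw [show (L i).rules b = {⊤} from hpar]; rfl) (fun _ => β) (fun _ => hβ)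
        ?_ hall
      intro x y _
      obtain ⟨j, rfl⟩ := Quotient.exists_rep x
      obtain ⟨j', rfl⟩ := Quotient.exists_rep y
      exact Quotient.sound trivial
    · have htensor := (hpt i b).resolve_left hpar
      choose β hβ hmem using fun j => h.premises (prem j) (Link.mem_premises_conn.2 ⟨j, rfl⟩)
      obtain ⟨I, hI⟩ := exists_isChoice_links S
      have hj : ∀ k, Link.Joined I (.conn i b prem c) (prem k) :=
        fun k => Or.inr ⟨⟨k, rfl⟩, fun h => (hpar h).elim⟩
      -- The tensor rule has one premise for each singleton class, which is represented by its only
      -- member.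
      have hout : ∀ j : Fin (L i).arity, (Quotient.mk (⊥ : Setoid (Fin (L i).arity)) j).out = j :=
        fun j => Quotient.exact (s := ⊥) (Quotient.out_eq _)
      refine hmerge ⊥ (by rw [show (L i).rules b = {⊥} from htensor]; rfl) (fun x => β x.out)
        (fun x => hβ _) ?_ ?_
      · intro x y hxy
        by_contra hne
        refine hF.ne_of_joined hS h.mem h.not_boxed hI (hj x.out) (hj y.out) ?_ (hβ x.out)
          (hmem x.out) (hxy ▸ hmem y.out)
        intro he
        have := S.prem_injective h.mem he
        exact hne (by rw [← Quotient.out_eq x, ← Quotient.out_eq y, this])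
      · intro j
        rw [hout]
        exact hmem j

theorem boxing_ax (S : ProofStructure L) :
    Boxing S {β | ∃ u v, .ax u v ∈ S.links ∧ β = ({u, v}, {.ax u v})} := by
  refine ⟨?_, ?_, fun u v h => ⟨_, ⟨u, v, h, rfl⟩, rfl⟩⟩
  · rintro _ ⟨u, v, h, rfl⟩
    exact isBox_ax h
  · rintro _ ⟨u, v, h, rfl⟩ _ ⟨u', v', h', rfl⟩ w hw hw'
    have := S.eq_of_mem_conclusions h h' (Link.mem_conclusions_ax.2 hw)
      (Link.mem_conclusions_ax.2 hw')
    cases this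
    rfl

/-- A link is determined by its first conclusion or, if it is a cut, by its first premise. -/
theorem ProofStructure.finite_links (S : ProofStructure L) : S.links.Finite := by
  have := S.finite
  let g : Link L S.V → Option S.V × Option S.V := fun l => (l.conclusions.head?, l.premises.head?)
  refine Set.Finite.of_injOn (f := g) (t := Set.univ) (fun _ _ => trivial) ?_ Set.finite_univ
  intro l hl l' hl' hg
  have hg1 : l.conclusions.head? = l'.conclusions.head? := congrArg Prod.fst hg
  have hg2 : l.premises.head? = l'.premises.head? := congrArg Prod.snd hg
  rcases hh : l.conclusions.head? with _ | v
  · match l, hl, hh with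
    | .ax u w, _, hh => simp [Link.conclusions] at hh
    | .conn i b prem c, _, hh => simp [Link.conclusions] at hh
    | .cut u w, hl, hh =>
      have hu : l'.premises.head? = some u := hg2.symm
      exact S.unique_premise _ hl _ hl' u (Link.mem_premises_cut.2 (Or.inl rfl))
        (List.mem_of_mem_head? hu)
  · exact S.eq_of_mem_conclusions hl hl' (List.mem_of_mem_head? hh)
      (List.mem_of_mem_head? (hg1.symm.trans hh))

/-- If all links are boxed, there is only one box. -/
theorem Boxing.sequentializable (hS : ParCorrect S) (hF : Boxing S F)
    (hall : ∀ l ∈ S.links, IsBoxedLink F l) : S.Sequentializable := by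
  obtain ⟨I, hI⟩ := exists_isChoice_links S
  obtain ⟨v⟩ := S.nonempty
  obtain ⟨l, ⟨hl, hv⟩, -⟩ := S.existsUnique_conclusion v
  obtain ⟨β, hβ, hlβ⟩ := hall l hl
  have huniv : ∀ w, w ∈ β.1 := by
    intro w
    -- Every link lies inside one box, and boxes are disjoint, so no link cuts `β`.
    refine hS.conn I hI β.1 (fun l' hl' => ?_) v w (((hF.box β hβ).mem hlβ).2 v hv)
    obtain ⟨γ, hγ, hlγ⟩ := hall l' hl'
    intro x y hx hy hxβ
    rw [← hF.disj γ hγ β hβ x ((hF.box γ hγ).joined_mem hlγ hx) hxβ]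
    exact (hF.box γ hγ).joined_mem hlγ hy
  have hlinks : β.2 = S.links := by
    refine Set.Subset.antisymm (hF.box β hβ).subset fun l' hl' => ?_
    obtain ⟨γ, hγ, hlγ⟩ := hall l' hl'
    obtain ⟨π, hπ⟩ := (hF.box γ hγ).exists_proof
    obtain ⟨w, hw⟩ := hπ.nonempty
    rw [← hF.disj γ hγ β hβ w hw (huniv w)]
    exact hlγ
  obtain ⟨π, hπ⟩ := (hF.box β hβ).exists_proof
  exact ⟨_, π, Proof.translatesTo_congr (Set.eq_univ_of_forall huniv) hlinks hπ⟩

/-- Induction on the number of unboxed links, starting from the axiom links as boxes. -/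
theorem ParCorrect.sequentializable (hpt : ∀ i b, (L i).IsPar b ∨ (L i).IsTensor b)
    (hS : ParCorrect S) : S.Sequentializable := by
  have key : ∀ (n : ℕ) (F : Set (Set S.V × Set (Link L S.V))), Boxing S F →
      {l ∈ S.links | ¬ IsBoxedLink F l}.ncard = n → S.Sequentializable := by
    intro n
    induction n using Nat.strong_induction_on with
    | _ n ih =>
      intro F hF hn
      by_cases hall : ∀ l ∈ S.links, IsBoxedLink F l
      · exact hF.sequentializable hS hall
      · push Not at hall
        obtain ⟨l, hl, hlb⟩ := hall
        obtain ⟨l', hready⟩ := hF.exists_ready hS hl hlb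
        obtain ⟨F', hF', h1, h2⟩ := hready.exists_boxing hpt hS hF
        refine ih _ (hn ▸ Set.ncard_lt_ncard ⟨?_, fun hsub => ?_⟩ ?_) F' hF' rfl
        · exact fun l'' hl'' => ⟨hl''.1, fun hb => hl''.2 (h1 _ hb)⟩
        · exact (hsub ⟨hready.mem, hready.not_boxed⟩).2 h2
        · exact S.finite_links.subset fun _ h => h.1
  exact key _ _ (boxing_ax S) rfl

end Merging

/-- The sequentialization theorem for the par-switching. -/
theorem IsParSwitching.sequentializationTheorem {ι : Type*} {L : ι → ConnectivePair}
    {f : Switching L} (hf : IsParSwitching f) : SequentializationTheorem f :=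
  fun _ hS => (hf.parCorrect hS).sequentializable fun i b => (hf i b).imp And.left And.left

end GMLL

theorem mainTheorem3 {ι : Type*} (L : ι → GMLL.ConnectivePair)
    (hL : ∃ i b, (L i).arity = 2 ∧ (L i).IsPar b) (f : GMLL.Switching L) :
    (GMLL.ExpansionProperty f ∧ GMLL.SequentializationTheorem f) ↔ GMLL.IsParSwitching f :=
  ⟨fun h => GMLL.isParSwitching_of_expansion_of_sequentialization hL h.1 h.2,
    fun h => ⟨h.expansionProperty, h.sequentializationTheorem⟩⟩
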